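/- Let $X,S,Y$ be random vectors with values in $\mathbb R^{n_x},\mathbb R^{n_s},\mathbb R^{n_y}$ such that $(X,S,Y)$ is jointly Gaussian with mean zero and $Q_Y=\mathbf E[YY^T]$ is invertible. Write $Q_{U,V}=\mathbf E[UV^T]$ for centered vectors, $Q_{U,V|Z}=\mathbf E[(U-\mathbf E(U|Z))(V-\mathbf E(V|Z))^T]$ and $Q_{U|Z}=Q_{U,U|Z}$. For $\Delta_X\ge 0$ let $\mathcal M_A(\Delta_X)$ be the set of random vectors $\widehat X$ in $\mathbb R^{n_x}$, defined jointly with $(X,S,Y)$ (on a probability space that may be enlarged), such that $\mathbf P_{\widehat X|S,Y,X}=\mathbf P_{\widehat X|S,Y}$ and $\mathbf E\|X-\widehat X\|^2\le\Delta_X$, and let $$R_{S;\widehat X|Y}(\Delta_X)=\inf_{\widehat X\in\mathcal M_A(\Delta_X)} I(S;\widehat X|Y)\in[0,\infty],\qquad \inf\emptyset=\infty.$$ Call $(\Sigma_\Delta,H,Q_W)$, with $\Sigma_\Delta,Q_W\in\mathbb R^{n_x\times n_x}$ and $H\in\mathbb R^{n_x\times n_s}$, feasible if $\Sigma_\Delta\succeq0$,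 $Q_W\succeq0$, $$HQ_{X,S|Y}^T=Q_{X|Y}-\Sigma_\Delta,\qquad HQ_{X,S|Y}^T=Q_{X,S|Y}H^T\succeq0,\qquad Q_W=HQ_{X,S|Y}^T-HQ_{S|Y}H^T=Q_{X|Y}-\Sigma_\Delta-HQ_{S|Y}H^T.$$ Here $Q_{X|Y}\succeq 0$, $Q_{S|Y}\succeq0$ and $Q_{X,S|Y}=Q_{X,S}-Q_{X,Y}Q_Y^{-1}Q_{Y,S}$. For $0\preceq B\preceq A$, the quantity $\frac12\log(\det A/\det B)$ is $+\infty$ if $\det A\ne0=\det B$, and if $\det A=0$ it is understood as $\lim_{\varepsilon\downarrow0}\frac12\log\big(\det(A+\varepsilon I)/\det(B+\varepsilon I)\big)\in[0,\infty]$. The symbol $\dagger$ denotes the Moore–Penrose pseudoinverse. Then the following hold. (a) Let $(\Sigma_\Delta,H,Q_W)$ be feasible, let $W\in G(0,Q_W)$ (centered Gaussian with covariance $Q_W$) be independent of $(X,S,Y)$, and put $$\widehat X=HS+(Q_{X,Y}-HQ_{S,Y})Q_Y^{-1}Y+W .$$ Then almost surely $\widehat X=HS+\mathbf E(X|Y)-H\,\mathbf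 E(S|Y)+W$; $\mathbf E[(X-\widehat X)(X-\widehat X)^T]=\Sigma_\Delta$; (i) $\mathbf P_{X|\widehat X,Y}=\mathbf P_{X|\widehat X}$; (ii) $\mathbf P_{\widehat X|S,Y,X}=\mathbf P_{\widehat X|S,Y}$ and $\mathbf P_{X|S,Y,\widehat X}=\mathbf P_{X|S,Y}$; (iii) $\mathbf E(X|\widehat X,Y)=\mathbf E(X|\widehat X)=\widehat X$ a.s., and $\mathbf E(X|Y)=\mathbf E(\widehat X|Y)$ a.s. Moreover $$Q_{\widehat X|Y}=HQ_{S|Y}H^T+Q_W=Q_{X|Y}-\Sigma_\Delta,\qquad Q_{S|\widehat X,Y}=Q_{S|Y}-Q_{S|Y}H^TQ_{\widehat X|Y}^\dagger HQ_{S|Y},$$ $\widehat X\in\mathcal M_A(\Delta_X)$ whenever $\operatorname{trace}(\Sigma_\Delta)\le\Delta_X$, and $$I(S;\widehat X|Y)=\tfrac12\log\frac{\det Q_{S|Y}}{\det Q_{S|\widehat X,Y}}=\tfrac12\log\frac{\det Q_{\widehat X|Y}}{\det Q_W}.$$ (b) With $Q_{\widehat X|Y}$ and $Q_{S|\widehat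 X,Y}$ given in terms of $(\Sigma_\Delta,H)$ by the formulas in (a), $$R_{S;\widehat X|Y}(\Delta_X)=\inf\ \tfrac12\log\frac{\det Q_{S|Y}}{\det Q_{S|\widehat X,Y}}=\inf\ \tfrac12\log\frac{\det Q_{\widehat X|Y}}{\det Q_W},$$ where both infima are over the feasible $(\Sigma_\Delta,H,Q_W)$ with $\operatorname{trace}(\Sigma_\Delta)\le\Delta_X$, subject to $Q_{S|Y}\succeq Q_{S|\widehat X,Y}\succeq0$ in the first and $Q_{\widehat X|Y}\succeq Q_W\succeq0$ in the second. Every $\widehat X\in\mathcal M_A(\Delta_X)$ has $I(S;\widehat X|Y)\ge R_{S;\widehat X|Y}(\Delta_X)$, and if $\mathcal M_A(\Delta_X)\neq\emptyset$ then $R_{S;\widehat X|Y}(\Delta_X)$ and both infima are attained by a realization as in (a). -/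

import Mathlib

open MeasureTheory ProbabilityTheory InformationTheory
open scoped ENNReal NNReal Matrix

noncomputable section

namespace RemoteRDF

/-- `ℝⁿ` with the Euclidean norm. -/
abbrev Vec (n : ℕ) : Type := EuclideanSpace ℝ (Fin n)

/-! ### Linear algebra -/

/-- The four Penrose equations: `B` is the Moore–Penrose pseudoinverse of `A`. -/
structure IsPseudoinverse {m n : ℕ} (A : Matrix (Fin m) (Fin n) ℝ)
    (B : Matrix (Fin n) (Fin m) ℝ) : Prop where
  mul_mul_left : A * B * A = A
  mul_mul_right : B * A * B = B
  symm_left : (A * B)ᵀ = A * B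
  symm_right : (B * A)ᵀ = B * A

/-- The Moore–Penrose pseudoinverse `A†` (see `isPseudoinverse_pinv` and
`IsPseudoinverse.unique`). -/
def pinv {n : ℕ} (A : Matrix (Fin n) (Fin n) ℝ) : Matrix (Fin n) (Fin n) ℝ :=
  Classical.epsilon (IsPseudoinverse A)

theorem IsPseudoinverse.unique {m n : ℕ} {A : Matrix (Fin m) (Fin n) ℝ}
    {B C : Matrix (Fin n) (Fin m) ℝ} (hB : IsPseudoinverse A B) (hC : IsPseudoinverse A C) :
    B = C := by
  have h1 : A * B = A * C := by
    calc A * B = (A * B)ᵀ := hB.symm_left.symm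
      _ = ((A * C) * (A * B))ᵀ := by
          rw [← Matrix.mul_assoc, hC.mul_mul_left]
      _ = (A * B) * (A * C) := by
          rw [Matrix.transpose_mul, hB.symm_left, hC.symm_left]
      _ = A * C := by rw [← Matrix.mul_assoc, hB.mul_mul_left]
  have h2 : B * A = C * A := by
    calc B * A = (B * A)ᵀ := hB.symm_right.symm
      _ = ((B * A) * (C * A))ᵀ := by
          rw [Matrix.mul_assoc, ← Matrix.mul_assoc A, hC.mul_mul_left]
      _ = (C * A) * (B * A) := by
          rw [Matrix.transpose_mul, hB.symm_right, hC.symm_right]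
      _ = C * A := by rw [Matrix.mul_assoc, ← Matrix.mul_assoc A, hB.mul_mul_left]
  calc B = B * A * B := hB.mul_mul_right.symm
    _ = C * A * C := by rw [h2, Matrix.mul_assoc, h1, ← Matrix.mul_assoc]
    _ = C := hC.mul_mul_right

theorem isPseudoinverse_pinv {n : ℕ} {A : Matrix (Fin n) (Fin n) ℝ} (hA : A.IsHermitian) :
    IsPseudoinverse A (pinv A) := by
  refine Classical.epsilon_spec (p := IsPseudoinverse A) ?_
  obtain ⟨U, d, hU, hd⟩ : ∃ (U : Matrix (Fin n) (Fin n) ℝ) (d : Fin n → ℝ),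
      Uᵀ * U = 1 ∧ A = U * Matrix.diagonal d * Uᵀ := by
    refine ⟨hA.eigenvectorUnitary, hA.eigenvalues, ?_, ?_⟩
    · have := Unitary.coe_star_mul_self hA.eigenvectorUnitary
      simpa [Matrix.star_eq_conjTranspose] using this
    · have := hA.spectral_theorem
      rw [Unitary.conjStarAlgAut_apply] at this
      simpa [Matrix.star_eq_conjTranspose, Function.comp_def] using this
  have key : ∀ a b : Fin n → ℝ, U * Matrix.diagonal a * Uᵀ * (U * Matrix.diagonal b * Uᵀ)
      = U * Matrix.diagonal (fun i => a i * b i) * Uᵀ := by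
    intro a b
    calc _ = U * Matrix.diagonal a * (Uᵀ * U) * Matrix.diagonal b * Uᵀ := by
          simp only [Matrix.mul_assoc]
      _ = _ := by rw [hU, Matrix.mul_one, Matrix.mul_assoc U, Matrix.diagonal_mul_diagonal]
  refine ⟨U * Matrix.diagonal (fun i => (d i)⁻¹) * Uᵀ, ?_, ?_, ?_, ?_⟩
  · rw [hd, key, key]; congr 3; funext i; exact mul_inv_mul_cancel _
  · rw [hd, key, key]; congr 3; funext i; simpa using mul_inv_mul_cancel (d i)⁻¹
  · rw [hd, key]; simp [Matrix.mul_assoc]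
  · rw [hd, key]; simp [Matrix.mul_assoc]

/-- `½ log (det A / det B) ∈ [0, ∞]` for positive semidefinite `B ⪯ A`.
If `det A ≠ 0` this is the literal expression (`∞` if `det B = 0`). If `det A = 0`, where the
quotient would read `0 / 0`, it is the limit of `½ log (det (A + ε I) / det (B + ε I))` as
`ε ↓ 0`. For `B ⪯ A` this expression is antitone in `ε`, so the limit is a supremum; it is the
corresponding quotient of the determinants of `A` and `B` restricted to the range of `A`. -/
def halfLogDetRatio {n : ℕ} (A B : Matrix (Fin n) (Fin n) ℝ) : ℝ≥0∞ :=
  if A.det ≠ 0 then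
    if B.det = 0 then ∞ else ENNReal.ofReal (1 / 2 * Real.log (A.det / B.det))
  else
    ⨆ (ε : ℝ) (_ : 0 < ε), ENNReal.ofReal
      (1 / 2 * Real.log ((A + ε • (1 : Matrix (Fin n) (Fin n) ℝ)).det /
        (B + ε • (1 : Matrix (Fin n) (Fin n) ℝ)).det))

/-! ### Random vectors -/

section Probability

variable {Ω : Type*} [MeasurableSpace Ω]

/-- The matrix `Q_{U,V} = E[U Vᵀ]` (the covariance, for centered random vectors). -/
def covMat {m n : ℕ} (μ : Measure Ω) (U : Ω → Vec m) (V : Ω → Vec n) :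
    Matrix (Fin m) (Fin n) ℝ :=
  Matrix.of fun i j => ∫ ω, U ω i * V ω j ∂μ

/-- The conditional expectation `E(U | Z)` given a random variable `Z`. -/
def cexp {n : ℕ} {β : Type*} [MeasurableSpace β] (μ : Measure Ω) (U : Ω → Vec n) (Z : Ω → β) :
    Ω → Vec n :=
  condExp (MeasurableSpace.comap Z inferInstance) μ U

/-- The (nonrandom) conditional covariance
`Q_{U,V|Z} = E[(U - E(U|Z)) (V - E(V|Z))ᵀ]` of jointly Gaussian vectors. -/
def condCov {m n : ℕ} {β : Type*} [MeasurableSpace β] (μ : Measure Ω) (U : Ω → Vec m)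
    (V : Ω → Vec n) (Z : Ω → β) : Matrix (Fin m) (Fin n) ℝ :=
  covMat μ (fun ω => U ω - cexp μ U Z ω) (fun ω => V ω - cexp μ V Z ω)

/-- `P_{U|V,T} = P_{U|V}` almost surely. -/
def CondLawDrops {α β γ : Type*} [MeasurableSpace α] [StandardBorelSpace α] [Nonempty α]
    [MeasurableSpace β] [MeasurableSpace γ] (μ : Measure Ω) [IsFiniteMeasure μ]
    (U : Ω → α) (V : Ω → β) (T : Ω → γ) : Prop :=
  ∀ᵐ p ∂(μ.map fun ω => (V ω, T ω)),
    condDistrib U (fun ω => (V ω, T ω)) μ p = condDistrib U V μ p.1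

/-- The conditional mutual information `I(A;B|C)`: the divergence of `P_{C,A,B}` from
`P_C ⊗ (P_{A|C} × P_{B|C})`, in nats. -/
def condMutualInfo {α β γ : Type*} [MeasurableSpace α] [StandardBorelSpace α] [Nonempty α]
    [MeasurableSpace β] [StandardBorelSpace β] [Nonempty β] [MeasurableSpace γ]
    (μ : Measure Ω) [IsFiniteMeasure μ] (A : Ω → α) (B : Ω → β) (C : Ω → γ) : ℝ≥0∞ :=
  klDiv (μ.map fun ω => (C ω, (A ω, B ω)))
    ((μ.map C) ⊗ₘ ((condDistrib A C μ) ×ₖ (condDistrib B C μ)))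

/-- `U ∈ G(0, Q)`: a centered Gaussian vector (possibly degenerate) with covariance `Q`. -/
structure IsCenteredGaussian {n : ℕ} (μ : Measure Ω) (U : Ω → Vec n)
    (Q : Matrix (Fin n) (Fin n) ℝ) : Prop where
  measurable : Measurable U
  gaussian : HasGaussianLaw U μ
  mean : ∫ ω, U ω ∂μ = 0
  cov : covMat μ U U = Q

/-- Membership of `Xhat` in the set `M_A(Δ)` of admissible reproductions:
`P_{Xhat|S,Y,X} = P_{Xhat|S,Y}` and `E ‖X - Xhat‖² ≤ Δ`. -/
structure IsAdmissible {nx ns ny : ℕ} (μ : Measure Ω) [IsFiniteMeasure μ] (X : Ω → Vec nx)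
    (S : Ω → Vec ns) (Y : Ω → Vec ny) (Xhat : Ω → Vec nx) (Δ : ℝ≥0) : Prop where
  measurable : Measurable Xhat
  markov : CondLawDrops μ Xhat (fun ω => (S ω, Y ω)) X
  distortion : ∫⁻ ω, ‖X ω - Xhat ω‖ₑ ^ 2 ∂μ ≤ Δ

/-- The affine realization `Xhat = H S + (Q_{X,Y} - H Q_{S,Y}) Q_Y⁻¹ Y + W`. -/
def realization {nx ns ny : ℕ} (μ : Measure Ω) (X : Ω → Vec nx) (S : Ω → Vec ns)
    (Y : Ω → Vec ny) (H : Matrix (Fin nx) (Fin ns) ℝ) (W : Ω → Vec nx) : Ω → Vec nx :=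
  fun ω => Matrix.toEuclideanLin H (S ω)
    + Matrix.toEuclideanLin ((covMat μ X Y - H * covMat μ S Y) * (covMat μ Y Y)⁻¹) (Y ω) + W ω

end Probability

/-- The joint laws of quadruples `((X, S, Y), Xhat)` with `(X, S, Y)` distributed as `P` and
`Xhat ∈ M_A(Δ)`. Working with laws means that the underlying probability space may be as rich as
necessary. -/
def admissibleLaws {nx ns ny : ℕ} (P : Measure (Vec nx × Vec ns × Vec ny)) (Δ : ℝ≥0) :
    Set (ProbabilityMeasure ((Vec nx × Vec ns × Vec ny) × Vec nx)) :=
  {ν | (ν : Measure ((Vec nx × Vec ns × Vec ny) × Vec nx)).map Prod.fst = P ∧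
    IsAdmissible (ν : Measure ((Vec nx × Vec ns × Vec ny) × Vec nx))
      (fun q => q.1.1) (fun q => q.1.2.1) (fun q => q.1.2.2) (fun q => q.2) Δ}

/-- The rate distortion function `R_{S;Xhat|Y}(Δ) = inf_{M_A(Δ)} I(S;Xhat|Y)`, with values in
`[0, ∞]` (`∞` if `M_A(Δ)` is empty). -/
def rdf {nx ns ny : ℕ} (P : Measure (Vec nx × Vec ns × Vec ny)) (Δ : ℝ≥0) : ℝ≥0∞ :=
  ⨅ ν ∈ admissibleLaws P Δ,
    condMutualInfo (ν : Measure ((Vec nx × Vec ns × Vec ny) × Vec nx))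
      (fun q => q.1.2.1) (fun q => q.2) (fun q => q.1.2.2)

/-! ### The parameters of the test channel -/

/-- The constraints on `(Σ, H, Q_W)`, where `QX = Q_{X|Y}`, `QXS = Q_{X,S|Y}`, `QS = Q_{S|Y}`. -/
structure IsFeasible {nx ns : ℕ} (QX : Matrix (Fin nx) (Fin nx) ℝ)
    (QXS : Matrix (Fin nx) (Fin ns) ℝ) (QS : Matrix (Fin ns) (Fin ns) ℝ)
    (Sig : Matrix (Fin nx) (Fin nx) ℝ) (H : Matrix (Fin nx) (Fin ns) ℝ)
    (QW : Matrix (Fin nx) (Fin nx) ℝ) : Prop where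
  sig_psd : Sig.PosSemidef
  gain : H * QXSᵀ = QX - Sig
  gain_symm : H * QXSᵀ = QXS * Hᵀ
  gain_psd : (H * QXSᵀ).PosSemidef
  noise : QW = H * QXSᵀ - H * QS * Hᵀ
  noise_psd : QW.PosSemidef

/-- The matrix `Q_{S|Y} - Q_{S|Y} Hᵀ (Q_{X|Y} - Σ)† H Q_{S|Y}`, the value of `Q_{S|Xhat,Y}`. -/
def postCovS {nx ns : ℕ} (QX : Matrix (Fin nx) (Fin nx) ℝ) (QS : Matrix (Fin ns) (Fin ns) ℝ)
    (Sig : Matrix (Fin nx) (Fin nx) ℝ) (H : Matrix (Fin nx) (Fin ns) ℝ) :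
    Matrix (Fin ns) (Fin ns) ℝ :=
  QS - QS * Hᵀ * pinv (QX - Sig) * H * QS

end RemoteRDF

end

open RemoteRDF

open MeasureTheory ProbabilityTheory InformationTheory
open scoped ENNReal NNReal Matrix

noncomputable section

namespace RemoteRDF

/-! ### Positive semidefinite matrices -/

section LinearAlgebra

open Matrix

/-! Regressing on `Y` leaves residuals `x` of `X` and `s` of `S`, centered and independent of `Y`. A
realization is `E(X|Y) + z` with `z = H s + W`. Feasibility makes `E[x zᵀ]` and `E[z zᵀ]` the same
matrix `QX - Sig`, so the error `x - z` is uncorrelated with `z` and `Y`. By joint Gaussianity it is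
independent of `(Xhat, Y)`, and the statements about conditional laws and expectations in (a) follow
from this and similar independences (`isRealization_realization`).

The rates come from one principle. If `S = F(Y) + s` with `s` Gaussian of covariance `A` and
independent of `Y`, and some function of `(Y, B)` estimates `s` with error covariance `D ⪯ A`, then
the Donsker–Varadhan inequality, tested on a Gaussian log-likelihood ratio, gives `I(S;B|Y) ≥ ½ log
(det A / det D)`. Only second moments enter, so `B` is arbitrary
(`halfLogDetRatio_le_condMutualInfo`). If the error is Gaussian and independent of `(Y, B)`, that
ratio is the true density and equality holds. Applied to `S` estimated from `Xhat`, and to `Xhat`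
estimated from `S`, this yields the two formulas in (a).

Singular covariances are handled by writing `A = T Tᵀ`, `D = T diag(lam) Tᵀ` with `T` left
invertible and `lam` in `[0, 1]` (`exists_simultaneous_diagonalization`). Both forms of the
log-determinant ratio become `-½ ∑ log (lam i)`, infinite when some `lam i` is zero.

For the converse, let `z` be the residual on `Y` of an admissible `Xhat` after centering, and let `P
z` be the best linear estimate of `x` from `z`. The Markov condition forces `E[x zᵀ] = QXS * Kzᵀ`,
with `Kz` the regression of `z` on `s`. Then `H = P * Kz` is a feasible gain; its distortion is no
larger, and its rate is at most `I(S;Xhat|Y)` by the lower bound (`IsAdmissible.exists_feasible`).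
Hence the infimum over laws is the infimum over feasible parameters.

The minimum is attained because the rate is a supremum over `ε` of continuous functions of the gain,
hence lower semicontinuous, and because gains can be projected onto the range of `QS` without
changing the problem, which makes the parameter set compact (`exists_feasible_minimizer`). -/

theorem exists_orthogonal_diagonalization {n : ℕ} {A : Matrix (Fin n) (Fin n) ℝ}
    (hA : A.IsHermitian) : ∃ (U : Matrix (Fin n) (Fin n) ℝ) (d : Fin n → ℝ),
      Uᵀ * U = 1 ∧ U * Uᵀ = 1 ∧ A = U * diagonal d * Uᵀ := by
  refine ⟨hA.eigenvectorUnitary, hA.eigenvalues, ?_, ?_, ?_⟩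
  · have := Unitary.coe_star_mul_self hA.eigenvectorUnitary
    simpa [Matrix.star_eq_conjTranspose] using this
  · have := Unitary.coe_mul_star_self hA.eigenvectorUnitary
    simpa [Matrix.star_eq_conjTranspose] using this
  · have := hA.spectral_theorem
    rw [Unitary.conjStarAlgAut_apply] at this
    simpa [Matrix.star_eq_conjTranspose, Function.comp_def] using this

theorem diagonal_eq_of_conj {n : ℕ} {A U : Matrix (Fin n) (Fin n) ℝ} {d : Fin n → ℝ}
    (hU : Uᵀ * U = 1) (hA : A = U * diagonal d * Uᵀ) : diagonal d = Uᵀ * A * U := by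
  calc diagonal d = (Uᵀ * U) * diagonal d * (Uᵀ * U) := by rw [hU]; simp
    _ = _ := by rw [hA]; simp only [Matrix.mul_assoc]

theorem PosSemidef.conj_transpose {m n : ℕ} {A : Matrix (Fin n) (Fin n) ℝ}
    (hA : A.PosSemidef) (E : Matrix (Fin m) (Fin n) ℝ) : (E * A * Eᵀ).PosSemidef := by
  simpa using hA.mul_mul_conjTranspose_same E

theorem PosSemidef.transpose_eq {n : ℕ} {A : Matrix (Fin n) (Fin n) ℝ}
    (hA : A.PosSemidef) : Aᵀ = A := by
  simpa using hA.isHermitian.eq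

theorem PosSemidef.exists_eq_transpose_mul {n : ℕ} {A : Matrix (Fin n) (Fin n) ℝ}
    (hA : A.PosSemidef) : ∃ B : Matrix (Fin n) (Fin n) ℝ, A = Bᵀ * B := by
  obtain ⟨U, d, hU, -, hd⟩ := exists_orthogonal_diagonalization hA.isHermitian
  have h0 : ∀ i, 0 ≤ d i := fun i => by
    have := (PosSemidef.conj_transpose hA Uᵀ).diag_nonneg (i := i)
    rw [transpose_transpose, ← diagonal_eq_of_conj hU hd] at this
    simpa using this
  refine ⟨diagonal (fun i => √(d i)) * Uᵀ, ?_⟩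
  rw [transpose_mul, transpose_transpose, diagonal_transpose, Matrix.mul_assoc,
    ← Matrix.mul_assoc (diagonal _) (diagonal _), diagonal_mul_diagonal, hd, Matrix.mul_assoc]
  congr 3; funext i; rw [Real.mul_self_sqrt (h0 i)]

/-- With `D = Bᵀ B`, the hypothesis says that the Gram matrix of `B Eᵀ` vanishes. -/
theorem mul_eq_zero_of_mul_mul_transpose {m n : ℕ} {D : Matrix (Fin n) (Fin n) ℝ}
    (hD : D.PosSemidef) {E : Matrix (Fin m) (Fin n) ℝ} (h : E * D * Eᵀ = 0) : E * D = 0 := by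
  obtain ⟨B, rfl⟩ := PosSemidef.exists_eq_transpose_mul hD
  have h1 : (B * Eᵀ)ᴴ * (B * Eᵀ) = 0 := by
    simpa [Matrix.mul_assoc] using h
  have h2 : B * Eᵀ = 0 := Matrix.conjTranspose_mul_self_eq_zero.mp h1
  have h3 : E * Bᵀ = 0 := by simpa using congrArg transpose h2
  rw [← Matrix.mul_assoc, h3, Matrix.zero_mul]

/-- `E (A - D) Eᵀ` reduces to `-E D Eᵀ`, so `E D Eᵀ` and its negative are both positive semidefinite
and the trace is zero. This is the inclusion of the range of `D` in that of `A`. -/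
theorem mul_eq_zero_of_le {m n : ℕ} {A D : Matrix (Fin n) (Fin n) ℝ}
    (hD : D.PosSemidef) (hAD : (A - D).PosSemidef) {E : Matrix (Fin m) (Fin n) ℝ}
    (h : E * A = 0) : E * D = 0 := by
  refine mul_eq_zero_of_mul_mul_transpose hD ?_
  have h1 := PosSemidef.conj_transpose hD E
  have h2 := PosSemidef.conj_transpose hAD E
  rw [Matrix.mul_sub, h, zero_sub, Matrix.neg_mul] at h2
  refine (h1.trace_eq_zero_iff).mp (le_antisymm ?_ h1.trace_nonneg)
  have := h2.trace_nonneg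
  rw [trace_neg] at this
  linarith

/-- Simultaneous diagonalization of `0 ⪯ D ⪯ A` on the range of `A`. -/
theorem exists_simultaneous_diagonalization {n : ℕ} {A D : Matrix (Fin n) (Fin n) ℝ}
    (hD : D.PosSemidef) (hAD : (A - D).PosSemidef) :
    ∃ (k : ℕ) (T : Matrix (Fin n) (Fin k) ℝ) (R : Matrix (Fin k) (Fin n) ℝ) (lam : Fin k → ℝ),
      R * T = 1 ∧ A = T * Tᵀ ∧ D = T * diagonal lam * Tᵀ ∧ ∀ i, 0 ≤ lam i ∧ lam i ≤ 1 := by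
  have hA : A.PosSemidef := by simpa using hAD.add hD
  obtain ⟨U, a, hU, -, ha⟩ := exists_orthogonal_diagonalization hA.isHermitian
  have h0 : ∀ i, 0 ≤ a i := fun i => by
    have := (PosSemidef.conj_transpose hA Uᵀ).diag_nonneg (i := i)
    rw [transpose_transpose, ← diagonal_eq_of_conj hU ha] at this
    simpa using this
  set k := Fintype.card {i // a i ≠ 0}
  let e : Fin k ≃ {i // a i ≠ 0} := (Fintype.equivFin _).symm
  -- Eigenvectors of the nonzero eigenvalues only, scaled by their square roots. `L` is the matching
  -- left inverse, so `V * L` is the projection onto the range of `A`.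
  let V : Matrix (Fin n) (Fin k) ℝ := of fun i j => U i (e j) * √(a (e j))
  let L : Matrix (Fin k) (Fin n) ℝ := of fun j i => (√(a (e j)))⁻¹ * U i (e j)
  have hs : ∀ j, √(a (e j)) ≠ 0 := fun j =>
    (Real.sqrt_pos.mpr (lt_of_le_of_ne (h0 _) (e j).2.symm)).ne'
  have hLV : L * V = 1 := by
    ext i j
    have h1 := congrFun (congrFun hU (e i)) (e j)
    rw [mul_apply] at h1 ⊢
    have h2 : ∑ x, L i x * V x j = (√(a (e i)))⁻¹ * √(a (e j)) * ∑ x, Uᵀ (e i) x * U x (e j) := by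
      rw [Finset.mul_sum]
      refine Finset.sum_congr rfl fun x _ => ?_
      simp only [L, V, of_apply, transpose_apply]; ring
    rw [h2, h1]
    by_cases hij : i = j
    · subst hij; simp [inv_mul_cancel₀ (hs i)]
    · have : (e i : Fin n) ≠ e j := fun h => hij (e.injective (Subtype.ext h))
      simp [hij, this]
  have hVV : A = V * Vᵀ := by
    ext i j
    have h1 : (V * Vᵀ) i j = ∑ x : {i // a i ≠ 0}, U i x * a x * U j x := by
      rw [mul_apply, ← Equiv.sum_comp e]
      refine Finset.sum_congr rfl fun x _ => ?_
      simp only [V, of_apply, transpose_apply]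
      rw [show U i (e x) * √(a (e x)) * (U j (e x) * √(a (e x)))
        = U i (e x) * (√(a (e x)) * √(a (e x))) * U j (e x) by ring, Real.mul_self_sqrt (h0 _)]
    rw [h1, ha, mul_apply]
    simp only [mul_diagonal, transpose_apply]
    rw [← Finset.sum_subtype (Finset.univ.filter fun i => a i ≠ 0) (by simp)
      (fun x => U i x * a x * U j x), Finset.sum_filter]
    refine Finset.sum_congr rfl fun x _ => ?_
    by_cases hx : a x = 0 <;> simp [hx]
  have hE : (1 - V * L) * D = 0 := by
    refine mul_eq_zero_of_le hD hAD ?_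
    rw [Matrix.sub_mul, Matrix.one_mul, hVV, Matrix.mul_assoc V L, ← Matrix.mul_assoc L, hLV,
      Matrix.one_mul, sub_self]
  have hVLD : V * L * D = D := by
    rw [Matrix.sub_mul, Matrix.one_mul, sub_eq_zero] at hE
    exact hE.symm
  have hDM : D = V * (L * D * Lᵀ) * Vᵀ := by
    have h1 : D * (V * L)ᵀ = D := by
      have := congrArg transpose hVLD
      rwa [transpose_mul, PosSemidef.transpose_eq hD] at this
    calc D = V * L * D * (V * L)ᵀ := by rw [hVLD, h1]
      _ = _ := by rw [transpose_mul]; simp only [Matrix.mul_assoc]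
  -- In the coordinates given by `V`, `A` is the identity and `D` is `L D Lᵀ`. A further orthogonal
  -- change of basis diagonalizes `D` and keeps `A` the identity.
  have hMpsd := PosSemidef.conj_transpose hD L
  obtain ⟨U', lam, hU', hU'2, hlam⟩ := exists_orthogonal_diagonalization hMpsd.isHermitian
  have hdl := diagonal_eq_of_conj hU' hlam
  refine ⟨k, V * U', U'ᵀ * L, lam, ?_, ?_, ?_, fun i => ⟨?_, ?_⟩⟩
  · calc U'ᵀ * L * (V * U') = U'ᵀ * (L * V) * U' := by simp only [Matrix.mul_assoc]
      _ = 1 := by rw [hLV, Matrix.mul_one, hU']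
  · calc A = V * (U' * U'ᵀ) * Vᵀ := by rw [hU'2, Matrix.mul_one, hVV]
      _ = _ := by rw [transpose_mul]; simp only [Matrix.mul_assoc]
  · calc D = V * (U' * diagonal lam * U'ᵀ) * Vᵀ := by rw [← hlam, ← hDM]
      _ = _ := by rw [transpose_mul]; simp only [Matrix.mul_assoc]
  · have := (PosSemidef.conj_transpose hMpsd U'ᵀ).diag_nonneg (i := i)
    rw [transpose_transpose, ← hdl] at this
    simpa using this
  · have h1 : 1 - L * D * Lᵀ = L * (A - D) * Lᵀ := by
      rw [Matrix.mul_sub, Matrix.sub_mul]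
      congr 1
      calc (1 : Matrix (Fin k) (Fin k) ℝ) = (L * V) * (L * V)ᵀ := by rw [hLV]; simp
        _ = _ := by rw [hVV, transpose_mul]; simp only [Matrix.mul_assoc]
    have h2 := PosSemidef.conj_transpose hAD L
    rw [← h1] at h2
    have := (PosSemidef.conj_transpose h2 U'ᵀ).diag_nonneg (i := i)
    rw [transpose_transpose, Matrix.mul_sub, Matrix.sub_mul, ← hdl, Matrix.mul_one, hU'] at this
    simpa using this

theorem one_le_det_one_add {n : ℕ} {P : Matrix (Fin n) (Fin n) ℝ} (hP : P.PosSemidef) :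
    1 ≤ (1 + P).det := by
  obtain ⟨U, d, hU, hU2, hd⟩ := exists_orthogonal_diagonalization hP.isHermitian
  have h0 : ∀ i, 0 ≤ d i := fun i => by
    have := (PosSemidef.conj_transpose hP Uᵀ).diag_nonneg (i := i)
    rw [transpose_transpose, ← diagonal_eq_of_conj hU hd] at this
    simpa using this
  have h1 : 1 + P = U * diagonal (fun i => 1 + d i) * Uᵀ := by
    rw [← diagonal_add, diagonal_one, Matrix.mul_add, Matrix.add_mul, Matrix.mul_one, hU2, ← hd]
  have h2 : U.det * Uᵀ.det = 1 := by rw [← det_mul, hU2, det_one]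
  rw [h1, det_mul, det_mul, mul_right_comm, h2, one_mul, det_diagonal]
  calc (1 : ℝ) = ∏ _i : Fin n, (1 : ℝ) := by simp
    _ ≤ ∏ i, (1 + d i) := Finset.prod_le_prod (fun _ _ => zero_le_one) fun i _ => by linarith [h0 i]

/-- A congruence by a square root `C` of `B` reduces this to `B = 1`. -/
theorem det_le_det_add {n : ℕ} {B P : Matrix (Fin n) (Fin n) ℝ} (hB : B.PosDef)
    (hP : P.PosSemidef) : B.det ≤ (B + P).det := by
  obtain ⟨C, hC⟩ := PosSemidef.exists_eq_transpose_mul hB.posSemidef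
  have hd : C.det * C.det = B.det := by rw [hC, det_mul, det_transpose]
  have hC0 : IsUnit C.det := by
    refine isUnit_iff_ne_zero.mpr fun h => hB.det_pos.ne' ?_
    rw [← hd, h, zero_mul]
  have h1 : B + P = Cᵀ * (1 + C⁻¹ᵀ * P * C⁻¹) * C := by
    rw [Matrix.mul_add, Matrix.add_mul, Matrix.mul_one, ← hC]
    congr 1
    calc P = (C⁻¹ * C)ᵀ * P * (C⁻¹ * C) := by rw [nonsing_inv_mul _ hC0]; simp
      _ = _ := by rw [transpose_mul]; simp only [Matrix.mul_assoc]
  have h2 : (C⁻¹ᵀ * P * C⁻¹).PosSemidef := by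
    simpa using PosSemidef.conj_transpose hP C⁻¹ᵀ
  have h3 := one_le_det_one_add h2
  rw [h1, det_mul, det_mul, det_transpose, mul_right_comm, hd]
  exact le_mul_of_one_le_right hB.det_pos.le h3

/-- The value `½ ∑ log (1 / lam i)`, infinite as soon as some `lam i` vanishes. -/
def diagRate {k : ℕ} (lam : Fin k → ℝ) : ℝ≥0∞ :=
  if ∏ i, lam i = 0 then ∞ else ENNReal.ofReal (1 / 2 * Real.log (1 / ∏ i, lam i))

/-- Sylvester's identity `det (1 + M N) = det (1 + N M)` moves the determinant from size `n` to size
`k`. The powers of `ε` come from factoring `ε` out of matrices of different sizes. -/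
theorem det_conj_diagonal_add {n k : ℕ} (T : Matrix (Fin n) (Fin k) ℝ) (lam : Fin k → ℝ)
    {ε : ℝ} (hε : ε ≠ 0) :
    (T * diagonal lam * Tᵀ + ε • 1).det
      = ε ^ n * (ε ^ k)⁻¹ * (diagonal lam * (Tᵀ * T) + ε • 1).det := by
  have h1 : T * diagonal lam * Tᵀ + ε • 1
      = ε • (1 + (ε⁻¹ • T) * (diagonal lam * Tᵀ)) := by
    rw [smul_add, smul_mul, smul_smul, mul_inv_cancel₀ hε, one_smul, add_comm, Matrix.mul_assoc]
  have h2 : diagonal lam * (Tᵀ * T) + ε • 1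
      = ε • (1 + (diagonal lam * Tᵀ) * (ε⁻¹ • T)) := by
    rw [smul_add, Matrix.mul_smul, smul_smul, mul_inv_cancel₀ hε, one_smul, add_comm,
      Matrix.mul_assoc]
  rw [h1, h2, det_smul, det_smul, det_one_add_mul_comm]
  simp only [Fintype.card_fin]
  have : ε ^ k ≠ 0 := pow_ne_zero _ hε
  field_simp

theorem continuous_det_add_smul {n : ℕ} (A : Matrix (Fin n) (Fin n) ℝ) :
    Continuous fun ε : ℝ => (A + ε • (1 : Matrix (Fin n) (Fin n) ℝ)).det := by
  fun_prop

/-! ### Determinant ratios in the diagonalizing coordinates. -/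

section Diagonalized

variable {n k : ℕ} {A D : Matrix (Fin n) (Fin n) ℝ} {T : Matrix (Fin n) (Fin k) ℝ}
  {R : Matrix (Fin k) (Fin n) ℝ} {lam : Fin k → ℝ}

theorem posDef_gram (hRT : R * T = 1) : (Tᵀ * T).PosDef := by
  have := PosDef.conjTranspose_mul_self T (by
    intro x y hxy
    have : R *ᵥ (T *ᵥ x) = R *ᵥ (T *ᵥ y) := by
      simpa using congrArg (fun v => R *ᵥ v) hxy
    simpa [hRT] using this)
  simpa using this

/-- The reduction to size `k` is used for `lam` and for the constant `1`. Both carry the same power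
of `ε`, which cancels on cross-multiplying. -/
theorem det_add_mul_det_gram (hA : A = T * Tᵀ) (hD : D = T * diagonal lam * Tᵀ) {ε : ℝ}
    (hε : ε ≠ 0) :
    (D + ε • 1).det * (Tᵀ * T + ε • 1).det
      = (A + ε • 1).det * (diagonal lam * (Tᵀ * T) + ε • 1).det := by
  have h1 := det_conj_diagonal_add T lam hε
  have h2 := det_conj_diagonal_add T (fun _ => 1) hε
  rw [diagonal_one, Matrix.mul_one, Matrix.one_mul, ← hA] at h2
  rw [hD, h1, h2]; ring

/-- The limit `ε → 0` of `det_add_mul_det_gram`, divided by the nonzero Gram determinant of `T`. -/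
theorem det_eq_det_mul_prod (hRT : R * T = 1) (hA : A = T * Tᵀ)
    (hD : D = T * diagonal lam * Tᵀ) : D.det = A.det * ∏ i, lam i := by
  have h := fun (M : Matrix (Fin n) (Fin n) ℝ) =>
    ((continuous_det_add_smul M).tendsto 0).mono_left (nhdsWithin_le_nhds (s := {0}ᶜ))
  have h' := fun (M : Matrix (Fin k) (Fin k) ℝ) =>
    ((continuous_det_add_smul M).tendsto 0).mono_left (nhdsWithin_le_nhds (s := {0}ᶜ))
  have e := tendsto_nhds_unique_of_eventuallyEq ((h D).mul (h' (Tᵀ * T)))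
    ((h A).mul (h' (diagonal lam * (Tᵀ * T)))) (by
      filter_upwards [self_mem_nhdsWithin] with ε hε
      exact det_add_mul_det_gram hA hD hε)
  simp only [zero_smul, add_zero, det_mul, det_diagonal] at e
  have hG : (Tᵀ * T).det ≠ 0 := (posDef_gram hRT).det_pos.ne'
  rw [← mul_assoc] at e
  exact mul_right_cancel₀ hG e

theorem PosSemidef.add_smul_one_posDef {M : Matrix (Fin n) (Fin n) ℝ} (hM : M.PosSemidef)
    {ε : ℝ} (hε : 0 < ε) : (M + ε • (1 : Matrix (Fin n) (Fin n) ℝ)).PosDef :=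
  PosDef.posSemidef_add hM (PosDef.one.smul hε)

theorem det_ratio_eq (hRT : R * T = 1) (hA : A = T * Tᵀ) (hD : D = T * diagonal lam * Tᵀ)
    (hApsd : A.PosSemidef) (hDpsd : D.PosSemidef) {ε : ℝ} (hε : 0 < ε) :
    0 < (diagonal lam * (Tᵀ * T) + ε • 1).det ∧
    (A + ε • 1).det / (D + ε • 1).det
      = (Tᵀ * T + ε • 1).det / (diagonal lam * (Tᵀ * T) + ε • 1).det := by
  have h := det_add_mul_det_gram hA hD hε.ne'
  have hA0 := (PosSemidef.add_smul_one_posDef hApsd hε).det_pos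
  have hD0 := (PosSemidef.add_smul_one_posDef hDpsd hε).det_pos
  have hG0 := (PosSemidef.add_smul_one_posDef (posDef_gram hRT).posSemidef hε).det_pos
  have hl : 0 < (diagonal lam * (Tᵀ * T) + ε • 1).det := by
    have : 0 < (A + ε • 1).det * (diagonal lam * (Tᵀ * T) + ε • 1).det := by
      rw [← h]; exact mul_pos hD0 hG0
    exact (mul_pos_iff_of_pos_left hA0).mp this
  refine ⟨hl, ?_⟩
  rw [div_eq_div_iff hD0.ne' hl.ne', ← h, mul_comm]

/-- Factoring `diagonal lam` out on the left leaves `Tᵀ T + ε` plus the diagonal of `ε (1 / lam i -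
1)`, which is nonnegative since `lam i ≤ 1`. Thus no regularized ratio exceeds `1 / ∏ lam i`. -/
theorem prod_mul_det_gram_le (hRT : R * T = 1) (hlam : ∀ i, 0 < lam i ∧ lam i ≤ 1) {ε : ℝ}
    (hε : 0 < ε) :
    (∏ i, lam i) * (Tᵀ * T + ε • 1).det ≤ (diagonal lam * (Tᵀ * T) + ε • 1).det := by
  have hP : (diagonal fun i => ε * ((lam i)⁻¹ - 1)).PosSemidef := by
    refine PosSemidef.diagonal fun i => ?_
    have := (one_le_inv₀ (hlam i).1).mpr (hlam i).2
    exact mul_nonneg hε.le (by linarith)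
  have h1 := det_le_det_add
    (PosSemidef.add_smul_one_posDef (posDef_gram hRT).posSemidef hε) hP
  have h2 : diagonal lam * (Tᵀ * T) + ε • 1
      = diagonal lam * (Tᵀ * T + ε • 1 + diagonal fun i => ε * ((lam i)⁻¹ - 1)) := by
    rw [Matrix.mul_add, Matrix.mul_add, add_assoc]
    congr 1
    rw [← diagonal_one, ← diagonal_smul, diagonal_mul_diagonal, diagonal_mul_diagonal,
      diagonal_add]
    congr 1; funext i
    have := (hlam i).1.ne'
    simp only [Pi.smul_apply, smul_eq_mul]
    field_simp; ring
  rw [h2, det_mul, det_diagonal]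
  exact mul_le_mul_of_nonneg_left h1 (Finset.prod_nonneg fun i _ => (hlam i).1.le)

/-- The regularized form of `halfLogDetRatio`. -/
def regLogDetRatio (A B : Matrix (Fin n) (Fin n) ℝ) : ℝ≥0∞ :=
  ⨆ (ε : ℝ) (_ : 0 < ε), ENNReal.ofReal
    (1 / 2 * Real.log ((A + ε • (1 : Matrix (Fin n) (Fin n) ℝ)).det /
      (B + ε • (1 : Matrix (Fin n) (Fin n) ℝ)).det))

/-- The supremum over `ε` dominates the limit `ε ↓ 0`. If every `lam i` is positive,
`prod_mul_det_gram_le` bounds all terms by that limit. If some `lam i` is zero, the reduced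
denominator tends to `0` from above while the numerator tends to `det (Tᵀ T) > 0`, so the limit is
`∞`. -/
theorem regLogDetRatio_eq_diagRate (hRT : R * T = 1) (hA : A = T * Tᵀ)
    (hD : D = T * diagonal lam * Tᵀ) (hlam : ∀ i, 0 ≤ lam i ∧ lam i ≤ 1) :
    regLogDetRatio A D = diagRate lam := by
  have hApsd : A.PosSemidef := by
    rw [hA]; simpa using posSemidef_self_mul_conjTranspose T
  have hDpsd : D.PosSemidef := by
    rw [hD]; exact PosSemidef.conj_transpose (PosSemidef.diagonal fun i => (hlam i).1) T
  have hG := (posDef_gram hRT).det_pos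
  have hratio := fun (ε : ℝ) (hε : 0 < ε) => det_ratio_eq hRT hA hD hApsd hDpsd hε
  have hg : Filter.Tendsto (fun ε : ℝ => (Tᵀ * T + ε • 1).det) (nhdsWithin 0 (Set.Ioi 0))
      (nhds (Tᵀ * T).det) := by
    simpa using ((continuous_det_add_smul (Tᵀ * T)).tendsto 0).mono_left
      (nhdsWithin_le_nhds (s := Set.Ioi 0))
  have hl : Filter.Tendsto (fun ε : ℝ => (diagonal lam * (Tᵀ * T) + ε • 1).det)
      (nhdsWithin 0 (Set.Ioi 0)) (nhds ((∏ i, lam i) * (Tᵀ * T).det)) := by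
    have := ((continuous_det_add_smul (diagonal lam * (Tᵀ * T))).tendsto 0).mono_left
      (nhdsWithin_le_nhds (s := Set.Ioi 0))
    rwa [zero_smul, add_zero, det_mul, det_diagonal] at this
  have hle : ∀ ε : ℝ, 0 < ε → ENNReal.ofReal (1 / 2 * Real.log
      ((Tᵀ * T + ε • 1).det / (diagonal lam * (Tᵀ * T) + ε • 1).det)) ≤ regLogDetRatio A D := by
    intro ε hε
    rw [← (hratio ε hε).2]
    exact le_iSup₂ (f := fun (ε : ℝ) (_ : 0 < ε) => ENNReal.ofReal
      (1 / 2 * Real.log ((A + ε • (1 : Matrix (Fin n) (Fin n) ℝ)).det /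
        (D + ε • (1 : Matrix (Fin n) (Fin n) ℝ)).det))) ε hε
  have hev : ∀ᶠ ε : ℝ in nhdsWithin 0 (Set.Ioi 0), ENNReal.ofReal (1 / 2 * Real.log
      ((Tᵀ * T + ε • 1).det / (diagonal lam * (Tᵀ * T) + ε • 1).det)) ≤ regLogDetRatio A D := by
    filter_upwards [self_mem_nhdsWithin] with ε hε using hle ε hε
  unfold diagRate
  split_ifs with h0
  · rw [h0, zero_mul] at hl
    have hl' : Filter.Tendsto (fun ε : ℝ => (diagonal lam * (Tᵀ * T) + ε • 1).det)
        (nhdsWithin 0 (Set.Ioi 0)) (nhdsWithin 0 (Set.Ioi 0)) := by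
      refine tendsto_nhdsWithin_iff.mpr ⟨hl, ?_⟩
      filter_upwards [self_mem_nhdsWithin] with ε hε using (hratio ε hε).1
    have ht := (hg.pos_mul_atTop hG hl'.inv_tendsto_nhdsGT_zero)
    have ht2 := ENNReal.tendsto_ofReal_atTop.comp
      ((Real.tendsto_log_atTop.comp ht).const_mul_atTop (show (0 : ℝ) < 1 / 2 by norm_num))
    exact top_le_iff.mp (le_of_tendsto ht2 hev)
  · have hpos : ∀ i, 0 < lam i ∧ lam i ≤ 1 := fun i =>
      ⟨lt_of_le_of_ne (hlam i).1 fun h => h0 (Finset.prod_eq_zero (Finset.mem_univ i) h.symm),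
        (hlam i).2⟩
    have hprod : 0 < ∏ i, lam i := Finset.prod_pos fun i _ => (hpos i).1
    apply le_antisymm
    · refine iSup₂_le fun ε hε => ENNReal.ofReal_le_ofReal ?_
      rw [(hratio ε hε).2]
      have hG0 := (PosSemidef.add_smul_one_posDef (posDef_gram hRT).posSemidef hε).det_pos
      refine mul_le_mul_of_nonneg_left (Real.log_le_log (div_pos hG0 (hratio ε hε).1) ?_)
        (by norm_num)
      rw [div_le_div_iff₀ (hratio ε hε).1 hprod, one_mul, mul_comm]
      exact prod_mul_det_gram_le hRT hpos hε
    · have ht := hg.div hl (mul_pos hprod hG).ne'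
      have e1 : (Tᵀ * T).det / ((∏ i, lam i) * (Tᵀ * T).det) = 1 / ∏ i, lam i := by
        field_simp
      rw [e1] at ht
      exact le_of_tendsto (ENNReal.tendsto_ofReal
        ((ht.log (by positivity)).const_mul (1 / 2 : ℝ))) hev

theorem halfLogDetRatio_eq_diagRate (hRT : R * T = 1) (hA : A = T * Tᵀ)
    (hD : D = T * diagonal lam * Tᵀ) (hlam : ∀ i, 0 ≤ lam i ∧ lam i ≤ 1) :
    halfLogDetRatio A D = diagRate lam := by
  by_cases hA0 : A.det = 0
  · rw [← regLogDetRatio_eq_diagRate hRT hA hD hlam]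
    simp [halfLogDetRatio, hA0, regLogDetRatio]
  · have hdet := det_eq_det_mul_prod hRT hA hD
    have h1 : D.det = 0 ↔ ∏ i, lam i = 0 := by rw [hdet]; simp [hA0]
    simp only [halfLogDetRatio, ne_eq, hA0, not_false_eq_true, if_true, diagRate, h1]
    split_ifs with h2
    · rfl
    · rw [hdet]; congr 3; field_simp

end Diagonalized

/-- The supremum form, free of case distinctions, is the one that gives lower semicontinuity in the
minimization. -/
theorem halfLogDetRatio_eq_regLogDetRatio {n : ℕ} {A D : Matrix (Fin n) (Fin n) ℝ}
    (hD : D.PosSemidef) (hAD : (A - D).PosSemidef) :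
    halfLogDetRatio A D = regLogDetRatio A D := by
  obtain ⟨k, T, R, lam, hRT, hA, hD', hlam⟩ := exists_simultaneous_diagonalization hD hAD
  rw [halfLogDetRatio_eq_diagRate hRT hA hD' hlam, regLogDetRatio_eq_diagRate hRT hA hD' hlam]

end LinearAlgebra

/-! ### Second moments of random vectors -/

section SecondMoments

open Matrix

variable {Ω : Type*} [MeasurableSpace Ω] {μ : Measure Ω}

theorem toEuclideanLin_apply_apply {m n : ℕ} (A : Matrix (Fin m) (Fin n) ℝ) (v : Vec n)
    (i : Fin m) : toEuclideanLin A v i = ∑ j, A i j * v j := by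
  simp [toLpLin_apply, mulVec, dotProduct]

theorem toEuclideanLin_mul_apply {l m n : ℕ} (A : Matrix (Fin l) (Fin m) ℝ)
    (B : Matrix (Fin m) (Fin n) ℝ) (v : Vec n) :
    toEuclideanLin (A * B) v = toEuclideanLin A (toEuclideanLin B v) := by
  simp [toLpLin_apply]

theorem measurable_toEuclideanLin {m n : ℕ} (A : Matrix (Fin m) (Fin n) ℝ) :
    Measurable fun v : Vec n => toEuclideanLin A v :=
  (LinearMap.continuous_of_finiteDimensional _).measurable

theorem MemLp.toEuclideanLin {m n : ℕ} (A : Matrix (Fin m) (Fin n) ℝ) {p : ℝ≥0∞} {U : Ω → Vec n}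
    (hU : MemLp U p μ) : MemLp (fun ω => Matrix.toEuclideanLin A (U ω)) p μ :=
  (LinearMap.toContinuousLinearMap (Matrix.toEuclideanLin A)).comp_memLp' hU

theorem MemLp.coord {n : ℕ} {p : ℝ≥0∞} {U : Ω → Vec n}
    (hU : MemLp U p μ) (i : Fin n) : MemLp (fun ω => U ω i) p μ :=
  (EuclideanSpace.proj (𝕜 := ℝ) i).comp_memLp' hU

theorem integrable_coord_mul {m n : ℕ} {U : Ω → Vec m} {V : Ω → Vec n} (hU : MemLp U 2 μ)
    (hV : MemLp V 2 μ) (i : Fin m) (j : Fin n) : Integrable (fun ω => U ω i * V ω j) μ :=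
  (MemLp.coord hU i).integrable_mul (MemLp.coord hV j)

theorem covMat_transpose {m n : ℕ} (U : Ω → Vec m) (V : Ω → Vec n) :
    (covMat μ U V)ᵀ = covMat μ V U := by
  ext i j
  simp only [covMat, transpose_apply, of_apply, mul_comm]

theorem covMat_congr {m n : ℕ} {U U' : Ω → Vec m} {V V' : Ω → Vec n} (hU : U =ᵐ[μ] U')
    (hV : V =ᵐ[μ] V') : covMat μ U V = covMat μ U' V' := by
  ext i j
  refine integral_congr_ae ?_
  filter_upwards [hU, hV] with ω h1 h2
  rw [h1, h2]

theorem covMat_add_left {m n : ℕ} {U U' : Ω → Vec m} {V : Ω → Vec n} (hU : MemLp U 2 μ)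
    (hU' : MemLp U' 2 μ) (hV : MemLp V 2 μ) :
    covMat μ (fun ω => U ω + U' ω) V = covMat μ U V + covMat μ U' V := by
  ext i j
  simp only [covMat, of_apply, Matrix.add_apply, PiLp.add_apply, add_mul]
  exact integral_add (integrable_coord_mul hU hV i j) (integrable_coord_mul hU' hV i j)

theorem covMat_sub_left {m n : ℕ} {U U' : Ω → Vec m} {V : Ω → Vec n} (hU : MemLp U 2 μ)
    (hU' : MemLp U' 2 μ) (hV : MemLp V 2 μ) :
    covMat μ (fun ω => U ω - U' ω) V = covMat μ U V - covMat μ U' V := by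
  ext i j
  simp only [covMat, of_apply, Matrix.sub_apply, PiLp.sub_apply, sub_mul]
  exact integral_sub (integrable_coord_mul hU hV i j) (integrable_coord_mul hU' hV i j)

theorem covMat_add_right {m n : ℕ} {U : Ω → Vec m} {V V' : Ω → Vec n} (hU : MemLp U 2 μ)
    (hV : MemLp V 2 μ) (hV' : MemLp V' 2 μ) :
    covMat μ U (fun ω => V ω + V' ω) = covMat μ U V + covMat μ U V' := by
  rw [← covMat_transpose, covMat_add_left hV hV' hU, transpose_add, covMat_transpose,
    covMat_transpose]

theorem covMat_sub_right {m n : ℕ} {U : Ω → Vec m} {V V' : Ω → Vec n} (hU : MemLp U 2 μ)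
    (hV : MemLp V 2 μ) (hV' : MemLp V' 2 μ) :
    covMat μ U (fun ω => V ω - V' ω) = covMat μ U V - covMat μ U V' := by
  rw [← covMat_transpose, covMat_sub_left hV hV' hU, transpose_sub, covMat_transpose,
    covMat_transpose]

theorem covMat_lin_left {l m n : ℕ} (A : Matrix (Fin l) (Fin m) ℝ) {U : Ω → Vec m}
    {V : Ω → Vec n} (hU : MemLp U 2 μ) (hV : MemLp V 2 μ) :
    covMat μ (fun ω => toEuclideanLin A (U ω)) V = A * covMat μ U V := by
  ext i j
  simp only [covMat, of_apply, mul_apply, toEuclideanLin_apply_apply, Finset.sum_mul]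
  rw [integral_finsetSum]
  · refine Finset.sum_congr rfl fun x _ => ?_
    rw [← integral_const_mul]
    simp only [mul_assoc]
  · intro x _
    simp only [mul_assoc]
    exact (integrable_coord_mul hU hV x j).const_mul _

theorem covMat_lin_right {l m n : ℕ} (A : Matrix (Fin l) (Fin n) ℝ) {U : Ω → Vec m}
    {V : Ω → Vec n} (hU : MemLp U 2 μ) (hV : MemLp V 2 μ) :
    covMat μ U (fun ω => toEuclideanLin A (V ω)) = covMat μ U V * Aᵀ := by
  rw [← covMat_transpose, covMat_lin_left A hV hU, transpose_mul, covMat_transpose]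

theorem integral_coord {n : ℕ} {U : Ω → Vec n} (hU : Integrable U μ) (i : Fin n) :
    ∫ ω, U ω i ∂μ = (∫ ω, U ω ∂μ) i :=
  (EuclideanSpace.proj (𝕜 := ℝ) i).integral_comp_comm hU

theorem covMat_eq_zero_of_indepFun {m n : ℕ} {U : Ω → Vec m} {V : Ω → Vec n}
    (hU : Integrable U μ) (hV : Integrable V μ) (h : IndepFun U V μ) (h0 : ∫ ω, V ω ∂μ = 0) :
    covMat μ U V = 0 := by
  ext i j
  have h1 : IndepFun (fun ω => U ω i) (fun ω => V ω j) μ :=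
    h.comp (φ := fun v : Vec m => v i) (ψ := fun v : Vec n => v j) (by fun_prop) (by fun_prop)
  have h2 := h1.integral_fun_mul_eq_mul_integral
    (hU.eval_piLp i).aestronglyMeasurable (hV.eval_piLp j).aestronglyMeasurable
  simp only [covMat, of_apply, Matrix.zero_apply]
  rw [h2, integral_coord hV, h0]; simp

theorem covMat_self_quadratic {n : ℕ} {U : Ω → Vec n} (hU : MemLp U 2 μ) (v : Fin n → ℝ) :
    v ⬝ᵥ (covMat μ U U *ᵥ v) = ∫ ω, (∑ i, v i * U ω i) ^ 2 ∂μ := by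
  have h1 : ∀ ω, (∑ i, v i * U ω i) ^ 2 = ∑ i, ∑ j, v i * v j * (U ω i * U ω j) := fun ω => by
    rw [sq, Finset.sum_mul_sum]
    refine Finset.sum_congr rfl fun i _ => Finset.sum_congr rfl fun j _ => by ring
  simp_rw [h1]
  rw [integral_finsetSum _ fun i _ => integrable_finsetSum _ fun j _ =>
    (integrable_coord_mul hU hU i j).const_mul _]
  simp only [dotProduct, mulVec, covMat, of_apply, Finset.mul_sum]
  refine Finset.sum_congr rfl fun i _ => ?_
  rw [integral_finsetSum _ fun j _ => (integrable_coord_mul hU hU i j).const_mul _]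
  refine Finset.sum_congr rfl fun j _ => ?_
  rw [integral_const_mul]; ring

theorem covMat_self_posSemidef {n : ℕ} {U : Ω → Vec n} (hU : MemLp U 2 μ) :
    (covMat μ U U).PosSemidef := by
  refine PosSemidef.of_dotProduct_mulVec_nonneg ?_ fun v => ?_
  · rw [IsHermitian, conjTranspose_eq_transpose_of_trivial, covMat_transpose]
  · rw [star_trivial, covMat_self_quadratic hU]
    exact integral_nonneg fun ω => sq_nonneg _

theorem trace_covMat_self {n : ℕ} {U : Ω → Vec n} (hU : MemLp U 2 μ) :
    (covMat μ U U).trace = ∫ ω, ‖U ω‖ ^ 2 ∂μ := by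
  simp only [trace, diag, covMat, of_apply, EuclideanSpace.real_norm_sq_eq]
  rw [integral_finsetSum _ fun i _ => by
    simpa [sq] using integrable_coord_mul hU hU i i]
  simp only [sq]

theorem ae_eq_zero_of_covMat_self {n : ℕ} {U : Ω → Vec n} (hU : MemLp U 2 μ)
    (h : covMat μ U U = 0) : U =ᵐ[μ] 0 := by
  have h1 := trace_covMat_self hU
  rw [h, trace_zero] at h1
  have h2 := (integral_eq_zero_iff_of_nonneg (fun ω => sq_nonneg ‖U ω‖)
    ((memLp_two_iff_integrable_sq_norm hU.1).mp hU)).mp h1.symm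
  filter_upwards [h2] with ω hω
  simpa using hω

end SecondMoments

/-! ### Independence and conditional laws -/

section Independence

open Matrix

variable {Ω : Type*} [MeasurableSpace Ω] {μ : Measure Ω}

theorem strongDual_vec_apply {n : ℕ} (L : StrongDual ℝ (Vec n)) (v : Vec n) :
    L v = ∑ i, v i * L (EuclideanSpace.single i 1) := by
  conv_lhs => rw [← (EuclideanSpace.basisFun (Fin n) ℝ).sum_repr v]
  simp

/-- Every linear functional of `V` is uncorrelated with the coordinates of the centered vector
`U`. -/
def Uncorrelated {n : ℕ} {E : Type*} [NormedAddCommGroup E] [NormedSpace ℝ E] (μ : Measure Ω)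
    (U : Ω → Vec n) (V : Ω → E) : Prop :=
  ∀ i (L : StrongDual ℝ E), ∫ ω, U ω i * L (V ω) ∂μ = 0

theorem Uncorrelated.of_covMat {m n : ℕ} {U : Ω → Vec m} {V : Ω → Vec n} (hU : MemLp U 2 μ)
    (hV : MemLp V 2 μ) (h : covMat μ U V = 0) : Uncorrelated μ U V := by
  intro i L
  have e : ∀ ω, U ω i * L (V ω) = ∑ j, U ω i * V ω j * L (EuclideanSpace.single j 1) :=
    fun ω => by rw [strongDual_vec_apply L (V ω), Finset.mul_sum]; simp only [mul_assoc]
  simp_rw [e]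
  rw [integral_finsetSum _ fun j _ => (integrable_coord_mul hU hV i j).mul_const _]
  refine Finset.sum_eq_zero fun j _ => ?_
  rw [integral_mul_const]
  have := congrFun (congrFun h i) j
  simp only [covMat, of_apply, Matrix.zero_apply] at this
  rw [this, zero_mul]

theorem Uncorrelated.prodMk {n : ℕ} {E F : Type*} [NormedAddCommGroup E] [NormedSpace ℝ E]
    [NormedAddCommGroup F] [NormedSpace ℝ F] {U : Ω → Vec n} {V : Ω → E} {T : Ω → F}
    (hU : MemLp U 2 μ) (hV : MemLp V 2 μ) (hT : MemLp T 2 μ) (h1 : Uncorrelated μ U V)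
    (h2 : Uncorrelated μ U T) : Uncorrelated μ U (fun ω => (V ω, T ω)) := by
  intro i L
  have e : ∀ ω, U ω i * L (V ω, T ω) = U ω i * (L ∘L .inl ℝ E F) (V ω)
      + U ω i * (L ∘L .inr ℝ E F) (T ω) := fun ω => by
    rw [← mul_add]; congr 1
    simp [← map_add]
  simp_rw [e]
  rw [integral_add, h1, h2, add_zero]
  · exact (MemLp.coord hU i).integrable_mul ((L ∘L .inl ℝ E F).comp_memLp' hV)
  · exact (MemLp.coord hU i).integrable_mul ((L ∘L .inr ℝ E F).comp_memLp' hT)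

/-- For jointly Gaussian vectors, vanishing covariance of all pairs of functionals gives
independence. Since `U` is centered, the mean of `V` plays no role. -/
theorem Uncorrelated.indepFun {n : ℕ} {E : Type*} [NormedAddCommGroup E] [NormedSpace ℝ E]
    [MeasurableSpace E] [BorelSpace E] [SecondCountableTopology E] [CompleteSpace E]
    {U : Ω → Vec n} {V : Ω → E} (hG : HasGaussianLaw (fun ω => (U ω, V ω)) μ)
    (h0 : ∫ ω, U ω ∂μ = 0) (h : Uncorrelated μ U V) : IndepFun U V μ := by
  have := hG.isProbabilityMeasure
  refine hG.indepFun_of_covariance_strongDual fun L₁ L₂ => ?_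
  have hU := hG.fst.memLp_two
  have hV := hG.snd.memLp_two
  rw [covariance_eq_sub (L₁.comp_memLp' hU) (L₂.comp_memLp' hV)]
  have h1 : ∫ ω, (L₁ ∘ U) ω ∂μ = 0 := by
    have := L₁.integral_comp_comm (hU.integrable one_le_two)
    rw [h0, map_zero] at this
    exact this
  have h2 : ∫ ω, ((L₁ ∘ U) * (L₂ ∘ V)) ω ∂μ = 0 := by
    have e : ∀ ω, ((L₁ ∘ U) * (L₂ ∘ V)) ω
        = ∑ i, L₁ (EuclideanSpace.single i 1) * (U ω i * L₂ (V ω)) := fun ω => by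
      simp only [Pi.mul_apply, Function.comp_apply]
      rw [strongDual_vec_apply L₁ (U ω), Finset.sum_mul]
      exact Finset.sum_congr rfl fun i _ => by ring
    simp_rw [e]
    have hi : ∀ i, Integrable (fun ω => U ω i * L₂ (V ω)) μ := fun i =>
      (MemLp.coord hU i).integrable_mul (L₂.comp_memLp' hV)
    rw [integral_finsetSum _ fun i _ => (hi i).const_mul _]
    refine Finset.sum_eq_zero fun i _ => ?_
    rw [integral_const_mul, h i L₂, mul_zero]
  rw [h1, h2]; simp

/-- The conditional expectation of `M(Z) + u` given `Z`, for `u` centered and independent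
of `Z`. -/
theorem cexp_ae_eq {n : ℕ} {β : Type*} [MeasurableSpace β] [IsFiniteMeasure μ] {U u : Ω → Vec n}
    {Z : Ω → β} {M : β → Vec n} (hZ : Measurable Z) (hM : Measurable M) (hu : Measurable u)
    (hUM : U =ᵐ[μ] fun ω => M (Z ω) + u ω) (hMi : Integrable (fun ω => M (Z ω)) μ)
    (hui : Integrable u μ) (h0 : ∫ ω, u ω ∂μ = 0) (hind : IndepFun u Z μ) :
    cexp μ U Z =ᵐ[μ] fun ω => M (Z ω) := by
  have h1 : condExp (MeasurableSpace.comap Z inferInstance) μ (fun ω => M (Z ω))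
      = fun ω => M (Z ω) :=
    condExp_of_stronglyMeasurable hZ.comap_le
      ((hM.comp (comap_measurable Z)).stronglyMeasurable) hMi
  have h2 := condExp_indep_eq hu.comap_le hZ.comap_le (comap_measurable u).stronglyMeasurable
    hind
  have h3 := condExp_congr_ae (m := MeasurableSpace.comap Z inferInstance) hUM
  have h4 := condExp_add hMi hui (MeasurableSpace.comap Z inferInstance)
  rw [h1] at h4
  unfold cexp
  refine h3.trans (h4.trans ?_)
  filter_upwards [h2] with ω hω
  simp [hω, h0]

section Kernels

variable {β : Type*} [MeasurableSpace β] {n : ℕ}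

/-- The kernel `z ↦ law of M z + u`, where `u` has law `ρ`. -/
def shiftKernel (ρ : Measure (Vec n)) [IsProbabilityMeasure ρ] (M : β → Vec n) :
    Kernel β (Vec n) :=
  (Kernel.id ×ₖ Kernel.const β ρ).map fun p => M p.1 + p.2

theorem shiftKernel_apply (ρ : Measure (Vec n)) [IsProbabilityMeasure ρ] {M : β → Vec n}
    (hM : Measurable M) (z : β) : shiftKernel ρ M z = ρ.map (fun v => M z + v) := by
  have hm : Measurable fun p : β × Vec n => M p.1 + p.2 :=
    (hM.comp measurable_fst).add measurable_snd
  rw [shiftKernel, Kernel.map_apply _ hm, Kernel.prod_apply, Kernel.id_apply,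
    Kernel.const_apply, Measure.dirac_prod, Measure.map_map hm (by fun_prop)]
  rfl

theorem isMarkovKernel_shiftKernel (ρ : Measure (Vec n)) [IsProbabilityMeasure ρ] {M : β → Vec n}
    (hM : Measurable M) : IsMarkovKernel (shiftKernel ρ M) :=
  Kernel.IsMarkovKernel.map _ ((hM.comp measurable_fst).add measurable_snd)

theorem lintegral_shiftKernel (ρ : Measure (Vec n)) [IsProbabilityMeasure ρ] {M : β → Vec n}
    (hM : Measurable M) (z : β) {f : Vec n → ℝ≥0∞} (hf : Measurable f) :
    ∫⁻ v, f v ∂(shiftKernel ρ M z) = ∫⁻ v, f (M z + v) ∂ρ := by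
  rw [shiftKernel_apply ρ hM, lintegral_map hf (by fun_prop)]

variable [IsProbabilityMeasure μ]

/-- The law of `(Z, u)` is a product, so Fubini exhibits the law of `(Z, U)` as a composition
product with the shift kernel; disintegrations are unique almost everywhere. -/
theorem condDistrib_ae_eq_shiftKernel {U u : Ω → Vec n} {Z : Ω → β} {M : β → Vec n}
    (hZ : Measurable Z) (hM : Measurable M) (hu : Measurable u)
    (hUM : U = fun ω => M (Z ω) + u ω) (hind : IndepFun u Z μ)
    [IsProbabilityMeasure (μ.map u)] :
    condDistrib U Z μ =ᵐ[μ.map Z] shiftKernel (μ.map u) M := by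
  have := isMarkovKernel_shiftKernel (μ.map u) hM
  have hU : Measurable U := by rw [hUM]; exact (hM.comp hZ).add hu
  refine condDistrib_ae_eq_of_measure_eq_compProd Z hU.aemeasurable ?_
  refine Measure.ext_of_lintegral _ fun f hf => ?_
  have h1 := (indepFun_iff_map_prod_eq_prod_map_map hZ.aemeasurable hu.aemeasurable).mp hind.symm
  have hg : Measurable fun p : β × Vec n => f (p.1, M p.1 + p.2) :=
    hf.comp (measurable_fst.prodMk ((hM.comp measurable_fst).add measurable_snd))
  rw [Measure.lintegral_compProd hf, lintegral_map hf (hZ.prodMk hU)]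
  calc ∫⁻ a, f (Z a, U a) ∂μ = ∫⁻ p, f (p.1, M p.1 + p.2) ∂(μ.map fun ω => (Z ω, u ω)) := by
        rw [lintegral_map hg (hZ.prodMk hu), hUM]
    _ = ∫⁻ z, ∫⁻ v, f (z, M z + v) ∂(μ.map u) ∂(μ.map Z) := by
        rw [h1, lintegral_prod _ hg.aemeasurable]
    _ = _ := by
        refine lintegral_congr fun z => ?_
        rw [lintegral_shiftKernel _ hM z (f := fun v => f (z, v)) (by fun_prop)]

/-- Both conditional laws are the law of `u` shifted by `M (V)`, and that shift does not see `T`. -/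
theorem condLawDrops_of_indepFun {γ : Type*} [MeasurableSpace γ] {U u : Ω → Vec n} {V : Ω → β}
    {T : Ω → γ} {M : β → Vec n} (hV : Measurable V) (hT : Measurable T) (hM : Measurable M)
    (hu : Measurable u) (hUM : U = fun ω => M (V ω) + u ω)
    (hind : IndepFun u (fun ω => (V ω, T ω)) μ) : CondLawDrops μ U V T := by
  have := Measure.isProbabilityMeasure_map (μ := μ) hu.aemeasurable
  have h1 := condDistrib_ae_eq_shiftKernel (Z := fun ω => (V ω, T ω)) (M := fun p => M p.1)
    (hV.prodMk hT) (hM.comp measurable_fst) hu hUM hind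
  have h2 := condDistrib_ae_eq_shiftKernel hV hM hu hUM
    (hind.comp measurable_id measurable_fst)
  have h3 : ∀ᵐ p ∂(μ.map fun ω => (V ω, T ω)),
      condDistrib U V μ p.1 = shiftKernel (μ.map u) M p.1 := by
    refine ae_of_ae_map (μ := μ.map fun ω => (V ω, T ω)) (f := Prod.fst)
      (p := fun v => condDistrib U V μ v = shiftKernel (μ.map u) M v)
      measurable_fst.aemeasurable ?_
    rw [Measure.map_map measurable_fst (hV.prodMk hT)]
    exact h2
  filter_upwards [h1, h3] with p hp1 hp3
  rw [hp1, hp3, shiftKernel_apply (M := fun p : β × γ => M p.1) _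
    (hM.comp measurable_fst), shiftKernel_apply _ hM]

end Kernels

end Independence

/-! ### Divergence and Gaussian densities -/

section Divergence

variable {α : Type*} [MeasurableSpace α]

theorem integrable_exp_of_lintegral {ν : Measure α} {f : α → ℝ} (hf : Measurable f)
    (h : ∫⁻ x, ENNReal.ofReal (Real.exp (f x)) ∂ν = 1) :
    Integrable (fun x => Real.exp (f x)) ν ∧ ∫ x, Real.exp (f x) ∂ν = 1 := by
  have hm : AEStronglyMeasurable (fun x => Real.exp (f x)) ν :=
    (Real.measurable_exp.comp hf).aestronglyMeasurable
  have h0 : 0 ≤ᵐ[ν] fun x => Real.exp (f x) := ae_of_all _ fun x => (Real.exp_pos _).le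
  refine ⟨⟨hm, ?_⟩, ?_⟩
  · rw [hasFiniteIntegral_iff_ofReal h0, h]; exact ENNReal.one_lt_top
  · rw [integral_eq_lintegral_of_nonneg_ae h0 hm, h, ENNReal.toReal_one]

/-- The Donsker–Varadhan lower bound for the divergence. -/
theorem ofReal_integral_le_klDiv {μ ν : Measure α} [IsProbabilityMeasure μ]
    [IsProbabilityMeasure ν] {f : α → ℝ} (hf : Measurable f) (hfμ : Integrable f μ)
    (h : ∫⁻ x, ENNReal.ofReal (Real.exp (f x)) ∂ν = 1) :
    ENNReal.ofReal (∫ x, f x ∂μ) ≤ klDiv μ ν := by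
  by_cases hfin : klDiv μ ν = ∞
  · rw [hfin]; exact le_top
  obtain ⟨hac, hinteg⟩ := klDiv_ne_top_iff.mp hfin
  obtain ⟨hi, h1⟩ := integrable_exp_of_lintegral hf h
  have := isProbabilityMeasure_tilted hi
  -- The divergence of `μ` from `ν.tilted f` is nonnegative and equals that from `ν` minus `∫ f dμ`;
  -- the normalizing constant is `1`.
  have h2 := integral_llr_add_sub_measure_univ_nonneg
    (hac.trans (absolutelyContinuous_tilted hi)) (integrable_llr_tilted_right hac hfμ hinteg hi)
  rw [integral_llr_tilted_right hac hfμ hi hinteg, h1] at h2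
  rw [klDiv_of_ac_of_integrable hac hinteg]
  refine ENNReal.ofReal_le_ofReal ?_
  simp only [Real.log_one, probReal_univ] at h2 ⊢
  linarith

/-- A normalized density `exp f` is an exponential tilt, whose log-likelihood ratio is `f` itself.
This is the equality case of the Donsker–Varadhan bound. -/
theorem klDiv_withDensity_exp {ν : Measure α} [IsProbabilityMeasure ν] {f : α → ℝ}
    (hf : Measurable f) (h : ∫⁻ x, ENNReal.ofReal (Real.exp (f x)) ∂ν = 1)
    (hfμ : Integrable f (ν.withDensity fun x => ENNReal.ofReal (Real.exp (f x)))) :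
    klDiv (ν.withDensity fun x => ENNReal.ofReal (Real.exp (f x))) ν
      = ENNReal.ofReal (∫ x, f x ∂(ν.withDensity fun x => ENNReal.ofReal (Real.exp (f x)))) := by
  obtain ⟨hi, h1⟩ := integrable_exp_of_lintegral hf h
  have ht : (ν.withDensity fun x => ENNReal.ofReal (Real.exp (f x))) = ν.tilted f := by
    simp [Measure.tilted, h1]
  rw [ht] at hfμ ⊢
  have := isProbabilityMeasure_tilted hi
  have hl : llr (ν.tilted f) ν =ᵐ[ν.tilted f] f := by
    refine (tilted_absolutelyContinuous ν f).ae_le ?_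
    filter_upwards [log_rnDeriv_tilted_left_self hi] with x hx
    rw [llr, hx, h1, Real.log_one, sub_zero]
  rw [klDiv_of_ac_of_integrable (tilted_absolutelyContinuous ν f) ((integrable_congr hl).mpr hfμ),
    integral_congr_ae hl]
  simp

/-- The log-likelihood ratio of `N(ρ, diag lam)` and `N(0, 1)`. -/
def gaussLLR {k : ℕ} (lam ρ v : Fin k → ℝ) : ℝ :=
  ∑ i, (-(1 / 2) * Real.log (lam i) - (v i - ρ i) ^ 2 / (2 * lam i) + v i ^ 2 / 2)

theorem measurable_gaussLLR {k : ℕ} (lam : Fin k → ℝ) :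
    Measurable fun p : (Fin k → ℝ) × (Fin k → ℝ) => gaussLLR lam p.1 p.2 := by
  unfold gaussLLR
  fun_prop

theorem gaussianReal_eq_withDensity {l : ℝ} (hl : 0 < l) (r : ℝ) :
    gaussianReal r l.toNNReal = (gaussianReal 0 1).withDensity fun x => ENNReal.ofReal
      (Real.exp (-(1 / 2) * Real.log l - (x - r) ^ 2 / (2 * l) + x ^ 2 / 2)) := by
  rw [gaussianReal_of_var_ne_zero _ (by simpa using hl), gaussianReal_of_var_ne_zero _ one_ne_zero,
    ← withDensity_mul _ (measurable_gaussianPDF 0 1) (by fun_prop)]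
  congr 1
  ext x
  simp only [Pi.mul_apply, gaussianPDF]
  rw [← ENNReal.ofReal_mul (gaussianPDFReal_nonneg _ _ _)]
  congr 1
  simp only [gaussianPDFReal, NNReal.coe_one, mul_one, sub_zero, Real.coe_toNNReal _ hl.le]
  have h1 : Real.exp (-(1 / 2) * Real.log l) = (√l)⁻¹ := by
    rw [← Real.sqrt_inv, Real.sqrt_eq_rpow, Real.rpow_def_of_pos (by positivity), Real.log_inv]
    congr 1; ring
  rw [show -(1 / 2) * Real.log l - (x - r) ^ 2 / (2 * l) + x ^ 2 / 2
    = -(1 / 2) * Real.log l + (-(x - r) ^ 2 / (2 * l) + x ^ 2 / 2) by ring, Real.exp_add,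
    Real.exp_add, h1, Real.sqrt_mul (by positivity) l, mul_inv]
  have h2 : Real.exp (-x ^ 2 / 2) * Real.exp (x ^ 2 / 2) = 1 := by
    rw [← Real.exp_add]; simp [neg_div]
  linear_combination (-(√(2 * Real.pi))⁻¹ * (√l)⁻¹ * Real.exp (-(x - r) ^ 2 / (2 * l))) * h2

/-- It suffices to compare boxes. There the integrand is a product of functions of single
coordinates, which are independent under the product measure. -/
theorem pi_withDensity_prod {k : ℕ} (ν : Fin k → Measure ℝ) [∀ i, IsProbabilityMeasure (ν i)]
    (h : Fin k → ℝ → ℝ≥0∞) (hh : ∀ i, Measurable (h i))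
    [∀ i, SigmaFinite ((ν i).withDensity (h i))] :
    Measure.pi (fun i => (ν i).withDensity (h i))
      = (Measure.pi ν).withDensity fun v => ∏ i, h i (v i) := by
  refine (Measure.pi_eq fun s hs => ?_)
  have hm : ∀ i, Measurable ((s i).indicator (h i)) := fun i => (hh i).indicator (hs i)
  rw [withDensity_apply _ (MeasurableSet.univ_pi hs),
    ← lintegral_indicator (MeasurableSet.univ_pi hs)]
  have e : ∀ v : Fin k → ℝ, (Set.univ.pi s).indicator (fun v => ∏ i, h i (v i)) v
      = ∏ i, (s i).indicator (h i) (v i) := fun v => by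
    by_cases hv : v ∈ Set.univ.pi s
    · rw [Set.indicator_of_mem hv]
      exact Finset.prod_congr rfl fun i _ => (Set.indicator_of_mem (hv i (Set.mem_univ i)) _).symm
    · rw [Set.indicator_of_notMem hv]
      obtain ⟨i, hi⟩ : ∃ i, v i ∉ s i := by simpa using hv
      exact (Finset.prod_eq_zero (Finset.mem_univ i) (Set.indicator_of_notMem hi _)).symm
  simp_rw [e]
  rw [lintegral_prod_eq_prod_lintegral_of_indepFun Finset.univ
    (fun i (v : Fin k → ℝ) => (s i).indicator (h i) (v i))
    (iIndepFun_pi fun i => (hm i).aemeasurable) fun i => (hm i).comp (measurable_pi_apply i)]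
  refine Finset.prod_congr rfl fun i _ => ?_
  rw [withDensity_apply _ (hs i), ← lintegral_indicator (hs i),
    ← (measurePreserving_eval ν i).lintegral_comp (hm i)]

theorem pi_gaussianReal_eq_withDensity {k : ℕ} {lam : Fin k → ℝ} (hl : ∀ i, 0 < lam i)
    (ρ : Fin k → ℝ) :
    Measure.pi (fun i => gaussianReal (ρ i) (lam i).toNNReal)
      = (Measure.pi fun _ : Fin k => gaussianReal 0 1).withDensity
        fun v => ENNReal.ofReal (Real.exp (gaussLLR lam ρ v)) := by
  have h1 := fun i => gaussianReal_eq_withDensity (hl i) (ρ i)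
  have : ∀ i, SigmaFinite ((gaussianReal 0 1).withDensity fun x => ENNReal.ofReal
      (Real.exp (-(1 / 2) * Real.log (lam i) - (x - ρ i) ^ 2 / (2 * lam i) + x ^ 2 / 2))) :=
    fun i => by rw [← h1 i]; infer_instance
  simp_rw [h1]
  rw [pi_withDensity_prod (fun _ : Fin k => gaussianReal 0 1) _ (fun i => by fun_prop)]
  congr 1
  ext v
  rw [gaussLLR, Real.exp_sum, ENNReal.ofReal_prod_of_nonneg fun i _ => (Real.exp_pos _).le]

theorem pi_gaussianReal_map_add {k : ℕ} (lam : Fin k → ℝ) (ρ : Fin k → ℝ) :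
    (Measure.pi fun i => gaussianReal 0 (lam i).toNNReal).map (fun v => ρ + v)
      = Measure.pi (fun i => gaussianReal (ρ i) (lam i).toNNReal) := by
  have := Measure.pi_map_pi (μ := fun i => gaussianReal 0 (lam i).toNNReal)
    (f := fun i x => ρ i + x) (fun i => by fun_prop)
  rw [show (fun v : Fin k → ℝ => ρ + v) = fun v i => ρ i + v i from rfl, this]
  congr 1; ext1 i
  rw [gaussianReal_map_const_add, zero_add]

end Divergence

/-! ### Gaussian vectors in coordinates on the range of their covariance. -/

section GaussianLaw

open Matrix

variable {Ω : Type*} [MeasurableSpace Ω] {μ : Measure Ω} {n k : ℕ}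
  {T : Matrix (Fin n) (Fin k) ℝ} {R : Matrix (Fin k) (Fin n) ℝ} {lam : Fin k → ℝ}
  {D : Matrix (Fin n) (Fin n) ℝ} {w : Ω → Vec n}

/-- The coordinates of `R v`. -/
def coords (R : Matrix (Fin k) (Fin n) ℝ) (v : Vec n) : Fin k → ℝ :=
  fun i => toEuclideanLin R v i

theorem measurable_coords (R : Matrix (Fin k) (Fin n) ℝ) : Measurable (coords R) := by
  have := measurable_toEuclideanLin R
  unfold coords
  fun_prop

theorem mul_conj_diagonal_mul_transpose (hRT : R * T = 1) (hD : D = T * diagonal lam * Tᵀ) :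
    R * D * Rᵀ = diagonal lam := by
  calc R * D * Rᵀ = (R * T) * diagonal lam * (R * T)ᵀ := by
        rw [hD, transpose_mul]; simp only [Matrix.mul_assoc]
    _ = _ := by rw [hRT]; simp

/-- The vector `w - T R w` has covariance `(1 - T R) D (1 - T R)ᵀ`, which is zero because `T R T =
T`. -/
theorem ae_eq_of_covMat_range (hw : MemLp w 2 μ) (hRT : R * T = 1)
    (hD : covMat μ w w = T * diagonal lam * Tᵀ) :
    w =ᵐ[μ] fun ω => toEuclideanLin T (toEuclideanLin R (w ω)) := by
  have hm := MemLp.toEuclideanLin (T * R) hw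
  have h0 : (1 - T * R) * covMat μ w w = 0 := by
    rw [hD, Matrix.sub_mul, Matrix.one_mul]
    calc _ = T * diagonal lam * Tᵀ - T * (R * T) * diagonal lam * Tᵀ := by
          simp only [Matrix.mul_assoc]
      _ = 0 := by rw [hRT]; simp
  have h1 : covMat μ (fun ω => w ω - toEuclideanLin (T * R) (w ω))
      (fun ω => w ω - toEuclideanLin (T * R) (w ω)) = 0 := by
    have hs : MemLp (fun ω => w ω - toEuclideanLin (T * R) (w ω)) 2 μ := hw.sub hm
    rw [covMat_sub_left hw hm hs, covMat_sub_right hw hw hm,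
      covMat_sub_right hm hw hm, covMat_lin_left _ hw hw, covMat_lin_right _ hw hw,
      covMat_lin_left _ hw hm, covMat_lin_right _ hw hw]
    calc _ = (1 - T * R) * covMat μ w w * (1 - T * R)ᵀ := by
          rw [transpose_sub, transpose_one, Matrix.mul_sub, Matrix.mul_one, Matrix.sub_mul,
            Matrix.one_mul, Matrix.sub_mul, Matrix.mul_assoc (T * R)]
          abel
      _ = 0 := by rw [h0, Matrix.zero_mul]
  filter_upwards [ae_eq_zero_of_covMat_self (hw.sub hm) h1] with ω hω
  rw [← toEuclideanLin_mul_apply]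
  exact sub_eq_zero.mp hω

/-- `R w` is Gaussian with diagonal covariance, so its coordinates are independent. A vanishing `lam
i` is allowed and gives a point mass. -/
theorem map_coords_eq_pi_gaussianReal (hG : HasGaussianLaw w μ) (h0 : ∫ ω, w ω ∂μ = 0)
    (hRT : R * T = 1) (hD : covMat μ w w = T * diagonal lam * Tᵀ) :
    μ.map (fun ω => coords R (w ω))
      = Measure.pi fun i => gaussianReal 0 (lam i).toNNReal := by
  have := hG.isProbabilityMeasure
  have hw := hG.memLp_two
  have hRw := MemLp.toEuclideanLin R hw
  have hGR : HasGaussianLaw (fun ω => toEuclideanLin R (w ω)) μ :=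
    hG.map_fun (LinearMap.toContinuousLinearMap (toEuclideanLin R))
  have hcov : covMat μ (fun ω => toEuclideanLin R (w ω)) (fun ω => toEuclideanLin R (w ω))
      = diagonal lam := by
    rw [covMat_lin_left _ hw hRw, covMat_lin_right _ hw hw, ← Matrix.mul_assoc,
      mul_conj_diagonal_mul_transpose hRT hD]
  have hmean : ∀ i, ∫ ω, toEuclideanLin R (w ω) i ∂μ = 0 := fun i => by
    rw [integral_coord (hRw.integrable one_le_two)]
    have := (LinearMap.toContinuousLinearMap (toEuclideanLin R)).integral_comp_comm
      (hw.integrable one_le_two)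
    rw [h0, map_zero] at this
    have h2 : ∫ ω, toEuclideanLin R (w ω) ∂μ = 0 := this
    rw [h2]; rfl
  have hc : ∀ i j, cov[fun ω => toEuclideanLin R (w ω) i, fun ω => toEuclideanLin R (w ω) j; μ]
      = diagonal lam i j := fun i j => by
    rw [covariance_eq_sub (MemLp.coord hRw i) (MemLp.coord hRw j), hmean i, zero_mul, sub_zero,
      ← hcov]
    rfl
  have hGpi : HasGaussianLaw (fun ω i => toEuclideanLin R (w ω) i) μ :=
    hGR.map_equiv_fun (PiLp.continuousLinearEquiv 2 ℝ (fun _ : Fin k => ℝ))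
  have hind := HasGaussianLaw.iIndepFun_of_covariance_eq_zero
    (X := fun i ω => toEuclideanLin R (w ω) i) hGpi fun i j hij => by
      rw [hc, diagonal_apply_ne _ hij]
  unfold coords
  rw [(iIndepFun_iff_map_fun_eq_pi_map fun i => (hGpi.eval i).aemeasurable).mp hind]
  congr 1; ext1 i
  rw [(hGpi.eval i).map_eq_gaussianReal, hmean i, ← covariance_self (hGpi.eval i).aemeasurable,
    hc i i, diagonal_apply_eq]

end GaussianLaw

/-! ### Conditional mutual information with a Gaussian argument -/

section MutualInfo

open Matrix

variable {Ω : Type*} [MeasurableSpace Ω] {μ : Measure Ω} [IsProbabilityMeasure μ]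

/-- Data processing for the map exchanging the last two coordinates, which carries joint law to
joint law and reference measure to reference measure. -/
theorem condMutualInfo_swap_le {α β γ : Type*} [MeasurableSpace α] [StandardBorelSpace α]
    [Nonempty α] [MeasurableSpace β] [StandardBorelSpace β] [Nonempty β] [MeasurableSpace γ]
    {A : Ω → α} {B : Ω → β} {C : Ω → γ} (hA : Measurable A) (hB : Measurable B)
    (hC : Measurable C) : condMutualInfo μ B A C ≤ condMutualInfo μ A B C := by
  have := Measure.isProbabilityMeasure_map (μ := μ) hC.aemeasurable
  have hg : Measurable fun p : γ × (α × β) => (p.1, (p.2.2, p.2.1)) := by fun_prop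
  have h := klDiv_map_le (μ.map fun ω => (C ω, (A ω, B ω)))
    ((μ.map C) ⊗ₘ ((condDistrib A C μ) ×ₖ (condDistrib B C μ))) hg
  rw [Measure.map_map hg (by fun_prop)] at h
  have e : ((μ.map C) ⊗ₘ ((condDistrib A C μ) ×ₖ (condDistrib B C μ))).map
      (fun p : γ × (α × β) => (p.1, (p.2.2, p.2.1)))
      = (μ.map C) ⊗ₘ ((condDistrib B C μ) ×ₖ (condDistrib A C μ)) := by
    refine Measure.ext_of_lintegral _ fun f hf => ?_
    have hfg : Measurable fun p : γ × (α × β) => f (p.1, (p.2.2, p.2.1)) := hf.comp hg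
    rw [lintegral_map hf hg, Measure.lintegral_compProd hfg, Measure.lintegral_compProd hf]
    refine lintegral_congr fun c => ?_
    rw [Kernel.prod_apply, Kernel.prod_apply, ← Measure.prod_swap, lintegral_map (by fun_prop)
      measurable_swap]
    rfl
  rw [e] at h
  exact h

theorem condMutualInfo_comm {α β γ : Type*} [MeasurableSpace α] [StandardBorelSpace α]
    [Nonempty α] [MeasurableSpace β] [StandardBorelSpace β] [Nonempty β] [MeasurableSpace γ]
    {A : Ω → α} {B : Ω → β} {C : Ω → γ} (hA : Measurable A) (hB : Measurable B)
    (hC : Measurable C) : condMutualInfo μ A B C = condMutualInfo μ B A C :=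
  le_antisymm (condMutualInfo_swap_le hB hA hC) (condMutualInfo_swap_le hA hB hC)

variable {β γ : Type*} [MeasurableSpace β] [MeasurableSpace γ]
  {n : ℕ} {S s : Ω → Vec n} {B : Ω → β} {Y : Ω → γ} {F : γ → Vec n}

theorem measurable_assemble (hF : Measurable F) :
    Measurable fun q : (γ × β) × Vec n => (q.1.1, (F q.1.1 + q.2, q.1.2)) := by
  fun_prop

variable {k : ℕ} {T : Matrix (Fin n) (Fin k) ℝ} {R : Matrix (Fin k) (Fin n) ℝ}
  {lam : Fin k → ℝ} {r : γ × β → Vec n}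

/-- The log-likelihood ratio used to compare the law of `(Y, S, B)` with the reference measure. -/
def condLLR (R : Matrix (Fin k) (Fin n) ℝ) (lam : Fin k → ℝ) (F : γ → Vec n)
    (r : γ × β → Vec n) (p : γ × (Vec n × β)) : ℝ :=
  gaussLLR lam (coords R (r (p.1, p.2.2))) (coords R (p.2.1 - F p.1))

theorem measurable_condLLR (hF : Measurable F) (hr : Measurable r) :
    Measurable (condLLR R lam F r) := by
  have h := measurable_coords R
  have h1 : Measurable fun p : γ × (Vec n × β) => r (p.1, p.2.2) := by fun_prop
  have h2 : Measurable fun p : γ × (Vec n × β) => p.2.1 - F p.1 := by fun_prop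
  have h3 := (measurable_gaussLLR lam).fun_comp ((h.fun_comp h1).prodMk (h.fun_comp h2))
  unfold condLLR
  exact h3

/-- Normalization of the Donsker–Varadhan test function. For fixed `(y, b)` the integrand depends on
`s` only through `R s`, which is standard Gaussian, and it is the density of a Gaussian probability
measure with variances `lam`, here arbitrary positive numbers. -/
theorem lintegral_exp_condLLR (hB : Measurable B) (hY : Measurable Y) (hs : Measurable s)
    (hF : Measurable F) (hr : Measurable r) (hG : HasGaussianLaw s μ) (h0 : ∫ ω, s ω ∂μ = 0)
    (hRT : R * T = 1) (hA : covMat μ s s = T * Tᵀ) (hl : ∀ i, 0 < lam i) :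
    ∫⁻ p, ENNReal.ofReal (Real.exp (condLLR R lam F r p))
      ∂(((μ.map fun ω => (Y ω, B ω)).prod (μ.map s)).map
        fun q => (q.1.1, (F q.1.1 + q.2, q.1.2))) = 1 := by
  have := Measure.isProbabilityMeasure_map (μ := μ) hs.aemeasurable
  have := Measure.isProbabilityMeasure_map (μ := μ) (hY.prodMk hB).aemeasurable
  have hg := measurable_assemble (β := β) hF
  have hm : Measurable fun p : γ × (Vec n × β) =>
      ENNReal.ofReal (Real.exp (condLLR R lam F r p)) :=
    (Real.measurable_exp.comp (measurable_condLLR hF hr)).ennreal_ofReal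
  have hlaw := map_coords_eq_pi_gaussianReal (lam := fun _ => 1) hG h0 hRT
    (by rw [hA, diagonal_one, Matrix.mul_one])
  have hmg : Measurable fun q : (γ × β) × Vec n =>
      ENNReal.ofReal (Real.exp (condLLR R lam F r (q.1.1, (F q.1.1 + q.2, q.1.2)))) :=
    hm.comp hg
  rw [lintegral_map hm hg, lintegral_prod _ hmg.aemeasurable]
  have inner : ∀ q : γ × β, ∫⁻ v, ENNReal.ofReal (Real.exp (condLLR R lam F r
      (q.1, (F q.1 + v, q.2)))) ∂(μ.map s) = 1 := fun q => by
    set ρ : Fin k → ℝ := coords R (r q) with hρ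
    have hm2 : Measurable fun x : Fin k → ℝ =>
        ENNReal.ofReal (Real.exp (gaussLLR lam ρ x)) := by
      have := (measurable_gaussLLR lam).comp (measurable_prodMk_left (x := ρ))
      exact (Real.measurable_exp.comp this).ennreal_ofReal
    calc _ = ∫⁻ v, ENNReal.ofReal (Real.exp (gaussLLR lam ρ
          (coords R v))) ∂(μ.map s) := by
          simp only [condLLR, add_sub_cancel_left, hρ]
      _ = ∫⁻ x, ENNReal.ofReal (Real.exp (gaussLLR lam ρ x))
          ∂(Measure.pi fun _ : Fin k => gaussianReal 0 1) := by
          rw [show (Measure.pi fun _ : Fin k => gaussianReal 0 1)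
            = μ.map (fun ω => coords R (s ω)) by rw [hlaw]; simp,
            lintegral_map hm2 ((measurable_coords R).fun_comp hs),
            lintegral_map (hm2.fun_comp (measurable_coords R)) hs]
      _ = 1 := by
          rw [← setLIntegral_univ, ← withDensity_apply _ MeasurableSet.univ,
            ← pi_gaussianReal_eq_withDensity hl, measure_univ]
  simp_rw [inner]
  simp

variable [StandardBorelSpace β] [Nonempty β]

/-- The reference measure of `I(S;B|Y)` for `S = F(Y) + s` with `s` independent of `Y`. -/
theorem condIndep_coupling_eq (hB : Measurable B) (hY : Measurable Y) (hs : Measurable s)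
    (hF : Measurable F) (hS : S = fun ω => F (Y ω) + s ω) (hind : IndepFun s Y μ) :
    (μ.map Y) ⊗ₘ ((condDistrib S Y μ) ×ₖ (condDistrib B Y μ))
      = ((μ.map fun ω => (Y ω, B ω)).prod (μ.map s)).map
        fun q => (q.1.1, (F q.1.1 + q.2, q.1.2)) := by
  have := Measure.isProbabilityMeasure_map (μ := μ) hs.aemeasurable
  have := Measure.isProbabilityMeasure_map (μ := μ) hY.aemeasurable
  have := isMarkovKernel_shiftKernel (μ.map s) hF
  have h1 := condDistrib_ae_eq_shiftKernel hY hF hs hS hind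
  have h2 : ((condDistrib S Y μ) ×ₖ (condDistrib B Y μ) : Kernel γ (Vec n × β)) =ᵐ[μ.map Y]
      ((shiftKernel (μ.map s) F) ×ₖ (condDistrib B Y μ) : Kernel γ (Vec n × β)) := by
    filter_upwards [h1] with y hy
    rw [Kernel.prod_apply, Kernel.prod_apply, hy]
  rw [Measure.compProd_congr h2, ← compProd_map_condDistrib hB.aemeasurable]
  have hg := measurable_assemble (β := β) hF
  refine Measure.ext_of_lintegral _ fun f hf => ?_
  have hfg : Measurable fun q : (γ × β) × Vec n => f (q.1.1, (F q.1.1 + q.2, q.1.2)) :=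
    hf.comp hg
  rw [lintegral_map hf hg, Measure.lintegral_compProd hf,
    lintegral_prod _ hfg.aemeasurable, Measure.lintegral_compProd]
  · refine lintegral_congr fun y => ?_
    rw [Kernel.prod_apply, lintegral_prod_symm _ (by fun_prop)]
    refine lintegral_congr fun b => ?_
    rw [lintegral_shiftKernel _ hF y (f := fun v => f (y, (v, b))) (by fun_prop)]
  · exact hfg.lintegral_prod_right'

/-- The log-likelihood ratio is quadratic, so its mean needs only second moments and no Gaussian
law. The parameters `lam'` of the test function are kept apart from the true error variances `lam`,
which may vanish. -/
theorem integral_gaussLLR {lam' : Fin k → ℝ} {ρ : Ω → Vec n} (hs : MemLp s 2 μ)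
    (hρ : MemLp ρ 2 μ) (hRT : R * T = 1) (hA : covMat μ s s = T * Tᵀ)
    (hD : covMat μ (fun ω => s ω - ρ ω) (fun ω => s ω - ρ ω) = T * diagonal lam * Tᵀ) :
    Integrable (fun ω => gaussLLR lam' (coords R (ρ ω)) (coords R (s ω))) μ ∧
    ∫ ω, gaussLLR lam' (coords R (ρ ω)) (coords R (s ω)) ∂μ
      = ∑ i, (-(1 / 2) * Real.log (lam' i) - lam i / (2 * lam' i) + 1 / 2) := by
  have hsρ : MemLp (fun ω => s ω - ρ ω) 2 μ := hs.sub hρ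
  have key : ∀ {u : Ω → Vec n} {l : Fin k → ℝ}, MemLp u 2 μ →
      covMat μ u u = T * diagonal l * Tᵀ → ∀ i,
      Integrable (fun ω => coords R (u ω) i ^ 2) μ ∧ ∫ ω, coords R (u ω) i ^ 2 ∂μ = l i := by
    intro u l hu hl i
    have hRu := MemLp.toEuclideanLin R hu
    refine ⟨by simpa [coords, sq] using integrable_coord_mul hRu hRu i i, ?_⟩
    have h1 : covMat μ (fun ω => toEuclideanLin R (u ω)) (fun ω => toEuclideanLin R (u ω))
        = diagonal l := by
      rw [covMat_lin_left _ hu hRu, covMat_lin_right _ hu hu, ← Matrix.mul_assoc,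
        mul_conj_diagonal_mul_transpose hRT hl]
    have h2 := congrFun (congrFun h1 i) i
    rw [diagonal_apply_eq] at h2
    rw [← h2]
    simp only [covMat, of_apply, coords, sq]
  have k1 := fun i => key (l := fun _ => 1) hs (by rw [hA, diagonal_one, Matrix.mul_one]) i
  have k2 := fun i => key hsρ hD i
  have e : ∀ ω, gaussLLR lam' (coords R (ρ ω)) (coords R (s ω))
      = ∑ i, (-(1 / 2) * Real.log (lam' i) - coords R (s ω - ρ ω) i ^ 2 / (2 * lam' i)
        + coords R (s ω) i ^ 2 / 2) := fun ω => by
    simp only [gaussLLR, coords, map_sub, PiLp.sub_apply]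
  have hi : ∀ i, Integrable (fun ω => -(1 / 2) * Real.log (lam' i)
      - coords R (s ω - ρ ω) i ^ 2 / (2 * lam' i)) μ := fun i =>
    (integrable_const _).sub ((k2 i).1.div_const _)
  have hi2 : ∀ i, Integrable (fun ω => -(1 / 2) * Real.log (lam' i)
      - coords R (s ω - ρ ω) i ^ 2 / (2 * lam' i) + coords R (s ω) i ^ 2 / 2) μ := fun i =>
    (hi i).add ((k1 i).1.div_const _)
  simp_rw [e]
  refine ⟨integrable_finsetSum _ fun i _ => hi2 i, ?_⟩
  rw [integral_finsetSum _ fun i _ => hi2 i]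
  refine Finset.sum_congr rfl fun i _ => ?_
  rw [integral_add (hi i) ((k1 i).1.div_const _),
    integral_sub (integrable_const _) ((k2 i).1.div_const _), integral_div, integral_div,
    (k1 i).2, (k2 i).2]
  simp

end MutualInfo

/-! ### Gaussian lower and upper bounds for conditional mutual information. -/

section MutualInfoBounds

open Matrix

variable {Ω : Type*} [MeasurableSpace Ω] {μ : Measure Ω}
  {β γ : Type*} [MeasurableSpace β] [StandardBorelSpace β] [Nonempty β] [MeasurableSpace γ]
  {n : ℕ} {S s : Ω → Vec n} {B : Ω → β} {Y : Ω → γ} {F : γ → Vec n} {r : γ × β → Vec n}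
  {A D : Matrix (Fin n) (Fin n) ℝ}

/-- The choice `lam' = lam` is barred when some `lam i` is zero, so `lam' = lam + δ` is used. The
discarded term `½ - lam i / (2 (lam i + δ))` is nonnegative, and `δ ↓ 0` gives the claim, including
the infinite case. -/
theorem diagRate_le_of_forall {k : ℕ} {lam : Fin k → ℝ} (hlam : ∀ i, 0 ≤ lam i) {c : ℝ≥0∞}
    (h : ∀ lam' : Fin k → ℝ, (∀ i, 0 < lam' i) → ENNReal.ofReal
      (∑ i, (-(1 / 2) * Real.log (lam' i) - lam i / (2 * lam' i) + 1 / 2)) ≤ c) :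
    diagRate lam ≤ c := by
  have h1 : ∀ δ : ℝ, 0 < δ →
      ENNReal.ofReal (1 / 2 * Real.log (∏ i, (lam i + δ))⁻¹) ≤ c := fun δ hδ => by
    have hp : ∀ i, 0 < lam i + δ := fun i => by linarith [hlam i]
    refine le_trans (ENNReal.ofReal_le_ofReal ?_) (h _ hp)
    rw [Real.log_inv, Real.log_prod fun i _ => (hp i).ne', mul_neg, Finset.mul_sum,
      ← Finset.sum_neg_distrib]
    refine Finset.sum_le_sum fun i _ => ?_
    have : lam i / (2 * (lam i + δ)) ≤ 1 / 2 := by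
      rw [div_le_div_iff₀ (by linarith [hp i]) two_pos]; linarith
    linarith
  have hcont : Filter.Tendsto (fun δ : ℝ => ∏ i, (lam i + δ)) (nhdsWithin 0 (Set.Ioi 0))
      (nhds (∏ i, lam i)) := by
    have : Continuous fun δ : ℝ => ∏ i, (lam i + δ) := by fun_prop
    simpa using (this.tendsto 0).mono_left (nhdsWithin_le_nhds (s := Set.Ioi 0))
  have hev : ∀ᶠ δ : ℝ in nhdsWithin 0 (Set.Ioi 0),
      ENNReal.ofReal (1 / 2 * Real.log (∏ i, (lam i + δ))⁻¹) ≤ c := by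
    filter_upwards [self_mem_nhdsWithin] with δ hδ using h1 δ hδ
  unfold diagRate
  split_ifs with h0
  · rw [h0] at hcont
    have hc : Filter.Tendsto (fun δ : ℝ => ∏ i, (lam i + δ)) (nhdsWithin 0 (Set.Ioi 0))
        (nhdsWithin 0 (Set.Ioi 0)) := by
      refine tendsto_nhdsWithin_iff.mpr ⟨hcont, ?_⟩
      filter_upwards [self_mem_nhdsWithin] with δ hδ
      exact Finset.prod_pos fun i _ => add_pos_of_nonneg_of_pos (hlam i) hδ
    exact le_of_tendsto (ENNReal.tendsto_ofReal_atTop.comp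
      ((Real.tendsto_log_atTop.comp hc.inv_tendsto_nhdsGT_zero).const_mul_atTop
        (show (0 : ℝ) < 1 / 2 by norm_num))) hev
  · rw [one_div (∏ i, lam i)]
    exact le_of_tendsto (ENNReal.tendsto_ofReal
      (((hcont.inv₀ h0).log (inv_ne_zero h0)).const_mul (1 / 2 : ℝ))) hev

/-- Change of measure from `N(ρ, D)` to `N(0, A)`, on the common range of `A` and `D`. -/
theorem lintegral_gaussian_shift {k : ℕ} {T : Matrix (Fin n) (Fin k) ℝ}
    {R : Matrix (Fin k) (Fin n) ℝ} {lam : Fin k → ℝ} {w : Ω → Vec n} (hs : Measurable s)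
    (hw : Measurable w) (hGs : HasGaussianLaw s μ) (hGw : HasGaussianLaw w μ)
    (hs0 : ∫ ω, s ω ∂μ = 0) (hw0 : ∫ ω, w ω ∂μ = 0) (hRT : R * T = 1)
    (hA : covMat μ s s = T * Tᵀ) (hD : covMat μ w w = T * diagonal lam * Tᵀ)
    (hl : ∀ i, 0 < lam i) {ρ : Vec n}
    (hρ : ρ = toEuclideanLin T (toEuclideanLin R ρ)) {ψ : Vec n → ℝ≥0∞} (hψ : Measurable ψ) :
    ∫⁻ v, ψ (ρ + v) ∂(μ.map w) = ∫⁻ v, ENNReal.ofReal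
      (Real.exp (gaussLLR lam (coords R ρ) (coords R v))) * ψ v ∂(μ.map s) := by
  have hA' : covMat μ s s = T * diagonal (fun _ : Fin k => (1 : ℝ)) * Tᵀ := by
    rw [hA, diagonal_one, Matrix.mul_one]
  have hlaw_s := map_coords_eq_pi_gaussianReal hGs hs0 hRT hA'
  have hlaw_w := map_coords_eq_pi_gaussianReal hGw hw0 hRT hD
  simp only [Real.toNNReal_one] at hlaw_s
  have hc := measurable_coords R
  -- `emb` undoes `coords R` on the range of `T`, where `ρ` lies and where `s` and `w` lie almost
  -- surely. The change of measure can therefore be done in `Fin k → ℝ`, where densities exist.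
  let emb : (Fin k → ℝ) → Vec n := fun x => toEuclideanLin T (WithLp.toLp 2 x)
  have hemb : Measurable emb := (measurable_toEuclideanLin T).comp (by fun_prop)
  have hembc : ∀ v : Vec n, emb (coords R v) = toEuclideanLin T (toEuclideanLin R v) :=
    fun v => rfl
  have hg : Measurable fun x : Fin k → ℝ =>
      ENNReal.ofReal (Real.exp (gaussLLR lam (coords R ρ) x)) := by
    have := (measurable_gaussLLR lam).fun_comp (measurable_prodMk_left (x := coords R ρ))
    exact (Real.measurable_exp.comp this).ennreal_ofReal
  have hψe : Measurable fun x => ψ (emb x) := hψ.fun_comp hemb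
  calc ∫⁻ v, ψ (ρ + v) ∂(μ.map w) = ∫⁻ ω, ψ (ρ + w ω) ∂μ :=
        lintegral_map (by fun_prop) hw
    _ = ∫⁻ ω, ψ (emb (coords R ρ + coords R (w ω))) ∂μ := by
        refine lintegral_congr_ae ?_
        filter_upwards [ae_eq_of_covMat_range hGw.memLp_two hRT hD] with ω hω
        have : emb (coords R ρ + coords R (w ω)) = ρ + w ω := by
          have h1 : emb (coords R ρ + coords R (w ω))
              = emb (coords R ρ) + emb (coords R (w ω)) := by
            simp only [emb, WithLp.toLp_add, map_add]
          rw [h1, hembc, hembc, ← hρ, ← hω]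
        rw [this]
    _ = ∫⁻ x, ψ (emb (coords R ρ + x)) ∂(μ.map fun ω => coords R (w ω)) :=
        (lintegral_map (f := fun x => ψ (emb (coords R ρ + x)))
          (hψe.fun_comp (measurable_const_add _)) (hc.fun_comp hw)).symm
    _ = ∫⁻ x, ψ (emb x) ∂(Measure.pi fun i => gaussianReal (coords R ρ i) (lam i).toNNReal) := by
        rw [hlaw_w, ← pi_gaussianReal_map_add lam (coords R ρ),
          lintegral_map hψe (measurable_const_add _)]
    _ = ∫⁻ x, ENNReal.ofReal (Real.exp (gaussLLR lam (coords R ρ) x)) * ψ (emb x)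
          ∂(μ.map fun ω => coords R (s ω)) := by
        rw [pi_gaussianReal_eq_withDensity hl, lintegral_withDensity_eq_lintegral_mul _ hg hψe,
          hlaw_s]
        rfl
    _ = ∫⁻ ω, ENNReal.ofReal (Real.exp (gaussLLR lam (coords R ρ) (coords R (s ω))))
          * ψ (emb (coords R (s ω))) ∂μ := lintegral_map (hg.mul hψe) (hc.fun_comp hs)
    _ = ∫⁻ ω, ENNReal.ofReal (Real.exp (gaussLLR lam (coords R ρ) (coords R (s ω))))
          * ψ (s ω) ∂μ := by
        refine lintegral_congr_ae ?_
        filter_upwards [ae_eq_of_covMat_range hGs.memLp_two hRT hA'] with ω hω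
        rw [hembc, ← hω]
    _ = _ := (lintegral_map ((hg.fun_comp hc).mul hψ) hs).symm

variable [IsProbabilityMeasure μ]

/-- The Gaussian lower bound: if `S` is Gaussian given `Y` with covariance `A` and some function
of `(Y, B)` estimates `S` with error covariance `D`, then `I(S;B|Y) ≥ ½ log (det A / det D)`. -/
theorem halfLogDetRatio_le_condMutualInfo (hB : Measurable B) (hY : Measurable Y)
    (hs : Measurable s) (hF : Measurable F) (hr : Measurable r)
    (hS : S = fun ω => F (Y ω) + s ω) (hind : IndepFun s Y μ) (hG : HasGaussianLaw s μ)
    (h0 : ∫ ω, s ω ∂μ = 0) (hr2 : MemLp (fun ω => r (Y ω, B ω)) 2 μ) (hA : covMat μ s s = A)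
    (hD : covMat μ (fun ω => s ω - r (Y ω, B ω)) (fun ω => s ω - r (Y ω, B ω)) = D)
    (hAD : (A - D).PosSemidef) : halfLogDetRatio A D ≤ condMutualInfo μ S B Y := by
  have hs2 := hG.memLp_two
  have hDpsd : D.PosSemidef := hD ▸ covMat_self_posSemidef (hs2.sub hr2)
  obtain ⟨k, T, R, lam, hRT, hAT, hDT, hlam⟩ := exists_simultaneous_diagonalization hDpsd hAD
  rw [halfLogDetRatio_eq_diagRate hRT hAT hDT hlam]
  refine diagRate_le_of_forall (fun i => (hlam i).1) fun lam' hl => ?_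
  obtain ⟨hinteg, hval⟩ := integral_gaussLLR (lam' := lam') hs2 hr2 hRT (hA.trans hAT)
    (hD.trans hDT)
  have hSm : Measurable S := by rw [hS]; fun_prop
  have hm : Measurable fun ω => (Y ω, (S ω, B ω)) := by fun_prop
  have hL := measurable_condLLR (R := R) (lam := lam') hF hr
  have e : (fun ω => gaussLLR lam' (coords R (r (Y ω, B ω))) (coords R (s ω)))
      = fun ω => condLLR R lam' F r (Y ω, (S ω, B ω)) := by
    funext ω
    simp only [condLLR, hS, add_sub_cancel_left]
  have := Measure.isProbabilityMeasure_map (μ := μ) hs.aemeasurable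
  have := Measure.isProbabilityMeasure_map (μ := μ) (hY.prodMk hB).aemeasurable
  have := Measure.isProbabilityMeasure_map (μ := μ) hm.aemeasurable
  have := Measure.isProbabilityMeasure_map
    (μ := (μ.map fun ω => (Y ω, B ω)).prod (μ.map s)) (measurable_assemble hF).aemeasurable
  rw [e] at hinteg hval
  rw [condMutualInfo, condIndep_coupling_eq hB hY hs hF hS hind, ← hval,
    ← integral_map hm.aemeasurable hL.aestronglyMeasurable]
  exact ofReal_integral_le_klDiv hL ((integrable_map_measure hL.aestronglyMeasurable
    hm.aemeasurable).mpr hinteg) (lintegral_exp_condLLR hB hY hs hF hr hG h0 hRT (hA.trans hAT) hl)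

/-- The Gaussian upper bound: if moreover the estimation error is Gaussian and independent of
`(Y, B)`, then `I(S;B|Y) ≤ ½ log (det A / det D)`. -/
theorem condMutualInfo_le_halfLogDetRatio {w : Ω → Vec n} (hB : Measurable B) (hY : Measurable Y)
    (hs : Measurable s) (hF : Measurable F) (hr : Measurable r)
    (hS : S = fun ω => F (Y ω) + s ω) (hind : IndepFun s Y μ) (hG : HasGaussianLaw s μ)
    (h0 : ∫ ω, s ω ∂μ = 0) (hr2 : MemLp (fun ω => r (Y ω, B ω)) 2 μ) (hA : covMat μ s s = A)
    (hw : w = fun ω => s ω - r (Y ω, B ω)) (hGw : HasGaussianLaw w μ) (hw0 : ∫ ω, w ω ∂μ = 0)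
    (hindw : IndepFun w (fun ω => (Y ω, B ω)) μ) (hD : covMat μ w w = D)
    (hAD : (A - D).PosSemidef) : condMutualInfo μ S B Y ≤ halfLogDetRatio A D := by
  have hs2 := hG.memLp_two
  have hDpsd : D.PosSemidef := hD ▸ covMat_self_posSemidef hGw.memLp_two
  obtain ⟨k, T, R, lam, hRT, hAT, hDT, hlam⟩ := exists_simultaneous_diagonalization hDpsd hAD
  rw [halfLogDetRatio_eq_diagRate hRT hAT hDT hlam]
  unfold diagRate
  split_ifs with hprod
  · exact le_top
  have hl : ∀ i, 0 < lam i := fun i => lt_of_le_of_ne (hlam i).1 fun h =>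
    hprod (Finset.prod_eq_zero (Finset.mem_univ i) h.symm)
  have hYB : Measurable fun ω => (Y ω, B ω) := hY.prodMk hB
  have hwm : Measurable w := by rw [hw]; exact hs.sub (hr.comp hYB)
  obtain ⟨hinteg, hval⟩ := integral_gaussLLR (lam' := lam) hs2 hr2 hRT (hA.trans hAT)
    (by rw [← hw, hD, hDT])
  have hSm : Measurable S := by rw [hS]; fun_prop
  have hm : Measurable fun ω => (Y ω, (S ω, B ω)) := by fun_prop
  have hL := measurable_condLLR (R := R) (lam := lam) hF hr
  have hLe : Measurable fun p => ENNReal.ofReal (Real.exp (condLLR R lam F r p)) :=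
    (Real.measurable_exp.comp hL).ennreal_ofReal
  have e : (fun ω => gaussLLR lam (coords R (r (Y ω, B ω))) (coords R (s ω)))
      = fun ω => condLLR R lam F r (Y ω, (S ω, B ω)) := by
    funext ω
    simp only [condLLR, hS, add_sub_cancel_left]
  have := Measure.isProbabilityMeasure_map (μ := μ) hs.aemeasurable
  have := Measure.isProbabilityMeasure_map (μ := μ) hwm.aemeasurable
  have := Measure.isProbabilityMeasure_map (μ := μ) hYB.aemeasurable
  have hasm := measurable_assemble (β := β) hF
  have := Measure.isProbabilityMeasure_map
    (μ := (μ.map fun ω => (Y ω, B ω)).prod (μ.map s)) hasm.aemeasurable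
  -- The estimate is `s - w`, and both terms lie almost surely in the range of `T`; so the
  -- conditional law of `s` stays on the support of its unconditional law.
  have hrange : ∀ᵐ q ∂(μ.map fun ω => (Y ω, B ω)),
      r q = toEuclideanLin T (toEuclideanLin R (r q)) := by
    have hlin := ((measurable_toEuclideanLin T).comp (measurable_toEuclideanLin R)).comp hr
    refine (ae_map_iff hYB.aemeasurable (measurableSet_eq_fun hr hlin)).mpr ?_
    filter_upwards [ae_eq_of_covMat_range hs2 hRT (lam := fun _ => 1)
      (by rw [hA, hAT, diagonal_one, Matrix.mul_one]),
      ae_eq_of_covMat_range hGw.memLp_two hRT (hD.trans hDT)] with ω h1 h2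
    have h3 : r (Y ω, B ω) = s ω - w ω := by rw [hw]; simp
    simp only [Function.comp_apply]
    rw [h3, map_sub, map_sub, ← h1, ← h2]
  -- Given `(Y, B)`, the residual `s` is `r (Y, B)` plus the independent Gaussian `w`, so the test
  -- function of the lower bound is the exact log-density.
  have hdens : μ.map (fun ω => (Y ω, (S ω, B ω)))
      = (((μ.map fun ω => (Y ω, B ω)).prod (μ.map s)).map
        fun q => (q.1.1, (F q.1.1 + q.2, q.1.2))).withDensity
          fun p => ENNReal.ofReal (Real.exp (condLLR R lam F r p)) := by
    refine Measure.ext_of_lintegral _ fun φ hφ => ?_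
    have hprodlaw := (indepFun_iff_map_prod_eq_prod_map_map hYB.aemeasurable
      hwm.aemeasurable).mp hindw.symm
    have hm1 : Measurable fun q : (γ × β) × Vec n =>
        φ (q.1.1, (F q.1.1 + (r q.1 + q.2), q.1.2)) := by fun_prop
    have hm2 : Measurable fun q : (γ × β) × Vec n => ENNReal.ofReal (Real.exp
        (condLLR R lam F r (q.1.1, (F q.1.1 + q.2, q.1.2))))
        * φ (q.1.1, (F q.1.1 + q.2, q.1.2)) := (hLe.fun_comp hasm).mul (hφ.fun_comp hasm)
    calc ∫⁻ p, φ p ∂(μ.map fun ω => (Y ω, (S ω, B ω)))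
        = ∫⁻ ω, φ (Y ω, (S ω, B ω)) ∂μ := lintegral_map hφ hm
      _ = ∫⁻ q, φ (q.1.1, (F q.1.1 + (r q.1 + q.2), q.1.2))
          ∂(μ.map fun ω => ((Y ω, B ω), w ω)) := by
          rw [lintegral_map hm1 (hYB.prodMk hwm)]
          refine lintegral_congr fun ω => ?_
          simp only [hS, hw, add_sub_cancel]
      _ = ∫⁻ q, ∫⁻ v, φ (q.1, (F q.1 + (r q + v), q.2)) ∂(μ.map w)
          ∂(μ.map fun ω => (Y ω, B ω)) := by
          rw [hprodlaw, lintegral_prod _ hm1.aemeasurable]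
      _ = ∫⁻ q, ∫⁻ v, ENNReal.ofReal (Real.exp (gaussLLR lam (coords R (r q)) (coords R v)))
          * φ (q.1, (F q.1 + v, q.2)) ∂(μ.map s) ∂(μ.map fun ω => (Y ω, B ω)) := by
          refine lintegral_congr_ae ?_
          filter_upwards [hrange] with q hq
          exact lintegral_gaussian_shift hs hwm hG hGw h0 hw0 hRT (hA.trans hAT)
            (hD.trans hDT) hl hq (ψ := fun v => φ (q.1, (F q.1 + v, q.2))) (by fun_prop)
      _ = _ := by
          rw [lintegral_withDensity_eq_lintegral_mul _ hLe hφ, lintegral_map (hLe.mul hφ) hasm]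
          simp only [Pi.mul_apply]
          rw [lintegral_prod _ hm2.aemeasurable]
          simp only [condLLR, add_sub_cancel_left]
  rw [e] at hinteg hval
  have hinteg' := (integrable_map_measure hL.aestronglyMeasurable hm.aemeasurable).mpr hinteg
  have hone := lintegral_exp_condLLR (lam := lam) hB hY hs hF hr hG h0 hRT (hA.trans hAT) hl
  rw [condMutualInfo, condIndep_coupling_eq hB hY hs hF hS hind]
  have hkl := klDiv_withDensity_exp hL hone (by rw [← hdens]; exact hinteg')
  rw [← hdens] at hkl
  rw [hkl, integral_map hm.aemeasurable hL.aestronglyMeasurable, hval]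
  refine le_of_eq ?_
  congr 1
  -- With `lam' = lam`, the terms `-lam i / (2 lam i)` and `1 / 2` cancel, leaving only the
  -- logarithms.
  rw [one_div (∏ i, lam i), Real.log_inv, Real.log_prod fun i _ => (hl i).ne', mul_neg,
    Finset.mul_sum, ← Finset.sum_neg_distrib]
  refine Finset.sum_congr rfl fun i _ => ?_
  have := (hl i).ne'
  field_simp
  ring

end MutualInfoBounds

/-! ### Linear images of a random vector -/

section LinearImage

variable {Ω : Type*}

/-- `U` is a continuous linear image of `V`. -/
def IsLinearImage {E F : Type*} [NormedAddCommGroup E] [NormedSpace ℝ E] [NormedAddCommGroup F]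
    [NormedSpace ℝ F] (V : Ω → E) (U : Ω → F) : Prop :=
  ∃ L : E →L[ℝ] F, U = fun ω => L (V ω)

namespace IsLinearImage

variable {E F G : Type*} [NormedAddCommGroup E] [NormedSpace ℝ E] [NormedAddCommGroup F]
    [NormedSpace ℝ F] [NormedAddCommGroup G] [NormedSpace ℝ G] {V : Ω → E}

theorem refl : IsLinearImage V V := ⟨.id ℝ E, rfl⟩

theorem comp {U : Ω → F} (h : IsLinearImage V U) (L : F →L[ℝ] G) :
    IsLinearImage V fun ω => L (U ω) := by
  obtain ⟨K, rfl⟩ := h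
  exact ⟨L ∘L K, rfl⟩

theorem fst {U : Ω → F × G} (h : IsLinearImage V U) : IsLinearImage V fun ω => (U ω).1 :=
  h.comp (.fst ℝ F G)

theorem snd {U : Ω → F × G} (h : IsLinearImage V U) : IsLinearImage V fun ω => (U ω).2 :=
  h.comp (.snd ℝ F G)

theorem prodMk {U : Ω → F} {U' : Ω → G} (h : IsLinearImage V U) (h' : IsLinearImage V U') :
    IsLinearImage V fun ω => (U ω, U' ω) := by
  obtain ⟨K, rfl⟩ := h
  obtain ⟨K', rfl⟩ := h'
  exact ⟨K.prod K', rfl⟩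

theorem add {U U' : Ω → F} (h : IsLinearImage V U) (h' : IsLinearImage V U') :
    IsLinearImage V fun ω => U ω + U' ω := by
  obtain ⟨K, rfl⟩ := h
  obtain ⟨K', rfl⟩ := h'
  exact ⟨K + K', rfl⟩

theorem sub {U U' : Ω → F} (h : IsLinearImage V U) (h' : IsLinearImage V U') :
    IsLinearImage V fun ω => U ω - U' ω := by
  obtain ⟨K, rfl⟩ := h
  obtain ⟨K', rfl⟩ := h'
  exact ⟨K - K', rfl⟩

theorem toEuclideanLin {m n : ℕ} (A : Matrix (Fin m) (Fin n) ℝ) {U : Ω → Vec n}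
    (h : IsLinearImage V U) : IsLinearImage V fun ω => Matrix.toEuclideanLin A (U ω) :=
  h.comp (LinearMap.toContinuousLinearMap (Matrix.toEuclideanLin A))

end IsLinearImage

end LinearImage

/-! ### Residuals of linear regression -/

section Residuals

open Matrix

variable {Ω : Type*} [MeasurableSpace Ω] {μ : Measure Ω}

/-- The normal equations, valid for singular `Q = E[V Vᵀ]`: the component of `V` in the kernel of
`Q` has zero covariance and vanishes almost surely, so it does not correlate with `U`. -/
theorem covMat_mul_pinv_mul {m n : ℕ} {U : Ω → Vec m} {V : Ω → Vec n} (hU : MemLp U 2 μ)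
    (hV : MemLp V 2 μ) :
    covMat μ U V * pinv (covMat μ V V) * covMat μ V V = covMat μ U V := by
  set Q := covMat μ V V with hQ
  have hp := isPseudoinverse_pinv (covMat_self_posSemidef hV).isHermitian
  rw [← hQ] at hp
  set N := (1 - pinv Q * Q)ᵀ with hN
  have hQN : Q * Nᵀ = 0 := by
    rw [hN, transpose_transpose, Matrix.mul_sub, Matrix.mul_one, ← Matrix.mul_assoc,
      hp.mul_mul_left, sub_self]
  have h1 : covMat μ (fun ω => toEuclideanLin N (V ω)) (fun ω => toEuclideanLin N (V ω)) = 0 := by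
    rw [covMat_lin_left _ hV (MemLp.toEuclideanLin N hV), covMat_lin_right _ hV hV, ← hQ, hQN,
      Matrix.mul_zero]
  have h2 := ae_eq_zero_of_covMat_self (MemLp.toEuclideanLin N hV) h1
  have h3 : covMat μ U V * Nᵀ = 0 := by
    rw [← covMat_lin_right _ hU hV, covMat_congr (Filter.EventuallyEq.refl _ U) h2]
    ext i j; simp [covMat]
  rw [hN, transpose_transpose, Matrix.mul_sub, Matrix.mul_one, sub_eq_zero,
    ← Matrix.mul_assoc] at h3
  exact h3.symm

/-- For symmetric `Q` the Penrose equations are stable under transposition; uniqueness concludes. -/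
theorem PosSemidef.transpose_pinv {n : ℕ} {Q : Matrix (Fin n) (Fin n) ℝ} (hQ : Q.PosSemidef) :
    (pinv Q)ᵀ = pinv Q := by
  have hp := isPseudoinverse_pinv hQ.isHermitian
  have hT := PosSemidef.transpose_eq hQ
  refine IsPseudoinverse.unique (A := Q) ⟨?_, ?_, ?_, ?_⟩ hp
  · have := congrArg transpose hp.mul_mul_left
    simpa [hT, Matrix.mul_assoc] using this
  · have := congrArg transpose hp.mul_mul_right
    simpa [hT, Matrix.mul_assoc] using this
  · have := hp.symm_right
    rw [transpose_mul, hT] at this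
    rw [this, ← this, transpose_mul, transpose_transpose, hT, this]
  · have := hp.symm_left
    rw [transpose_mul, hT] at this
    rw [this, ← this, transpose_mul, transpose_transpose, hT, this]

/-- The coefficient matrix of the linear regression of `U` on `Y`. -/
def regCoef {m n : ℕ} (μ : Measure Ω) (U : Ω → Vec m) (Y : Ω → Vec n) :
    Matrix (Fin m) (Fin n) ℝ :=
  covMat μ U Y * (covMat μ Y Y)⁻¹

/-- The residual of the linear regression of `U` on `Y`. -/
def resid {m n : ℕ} (μ : Measure Ω) (U : Ω → Vec m) (Y : Ω → Vec n) : Ω → Vec m :=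
  fun ω => U ω - toEuclideanLin (regCoef μ U Y) (Y ω)

variable {l m n : ℕ} {U : Ω → Vec m} {V : Ω → Vec l} {Y : Ω → Vec n}

theorem eq_add_resid : U = fun ω => toEuclideanLin (regCoef μ U Y) (Y ω) + resid μ U Y ω := by
  funext ω; simp [resid]

theorem measurable_resid (hU : Measurable U) (hY : Measurable Y) : Measurable (resid μ U Y) :=
  hU.sub ((measurable_toEuclideanLin _).comp hY)

theorem memLp_resid (hU : MemLp U 2 μ) (hY : MemLp Y 2 μ) : MemLp (resid μ U Y) 2 μ :=
  hU.sub (MemLp.toEuclideanLin _ hY)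

theorem integral_toEuclideanLin (A : Matrix (Fin l) (Fin m) ℝ) (hU : Integrable U μ) :
    ∫ ω, toEuclideanLin A (U ω) ∂μ = toEuclideanLin A (∫ ω, U ω ∂μ) :=
  (LinearMap.toContinuousLinearMap (toEuclideanLin A)).integral_comp_comm hU

theorem covMat_resid_left_self (hQ : IsUnit (covMat μ Y Y)) (hU : MemLp U 2 μ)
    (hY : MemLp Y 2 μ) : covMat μ (resid μ U Y) Y = 0 := by
  unfold resid
  rw [covMat_sub_left hU (MemLp.toEuclideanLin _ hY) hY, covMat_lin_left _ hY hY, regCoef,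
    Matrix.mul_assoc, nonsing_inv_mul _ ((isUnit_iff_isUnit_det _).mp hQ), Matrix.mul_one,
    sub_self]

theorem covMat_resid_resid (hQ : IsUnit (covMat μ Y Y)) (hU : MemLp U 2 μ) (hV : MemLp V 2 μ)
    (hY : MemLp Y 2 μ) : covMat μ (resid μ U Y) (resid μ V Y)
      = covMat μ U V - covMat μ U Y * (covMat μ Y Y)⁻¹ * covMat μ Y V := by
  have h1 : covMat μ (resid μ U Y) (resid μ V Y) = covMat μ (resid μ U Y) V := by
    conv_lhs => rw [show resid μ V Y
      = fun ω => V ω - toEuclideanLin (regCoef μ V Y) (Y ω) from rfl]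
    rw [covMat_sub_right (memLp_resid hU hY) hV (MemLp.toEuclideanLin _ hY),
      covMat_lin_right _ (memLp_resid hU hY) hY, covMat_resid_left_self hQ hU hY,
      Matrix.zero_mul, sub_zero]
  rw [h1]
  unfold resid
  rw [covMat_sub_left hU (MemLp.toEuclideanLin _ hY) hV, covMat_lin_left _ hY hV, regCoef]

theorem integral_resid [IsFiniteMeasure μ] (hU : MemLp U 2 μ) (hY : MemLp Y 2 μ)
    (hU0 : ∫ ω, U ω ∂μ = 0) (hY0 : ∫ ω, Y ω ∂μ = 0) : ∫ ω, resid μ U Y ω ∂μ = 0 := by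
  unfold resid
  rw [integral_sub (hU.integrable one_le_two)
    ((MemLp.toEuclideanLin _ hY).integrable one_le_two), hU0,
    integral_toEuclideanLin _ (hY.integrable one_le_two), hY0, map_zero, sub_zero]

theorem IsLinearImage.resid {E : Type*} [NormedAddCommGroup E] [NormedSpace ℝ E] {V : Ω → E}
    (hU : IsLinearImage V U)
    (hY : IsLinearImage V Y) : IsLinearImage V (resid μ U Y) :=
  hU.sub (hY.toEuclideanLin _)

theorem IsLinearImage.hasGaussianLaw {E F : Type*} [NormedAddCommGroup E] [NormedSpace ℝ E]
    [NormedAddCommGroup F] [NormedSpace ℝ F] [MeasurableSpace E] [BorelSpace E]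
    [MeasurableSpace F] [BorelSpace F] {V : Ω → E} {U : Ω → F}
    (h : IsLinearImage V U) (hV : HasGaussianLaw V μ) : HasGaussianLaw U μ := by
  obtain ⟨K, rfl⟩ := h
  exact hV.map_fun K

theorem indepFun_resid [IsProbabilityMeasure μ] (hQ : IsUnit (covMat μ Y Y))
    (hG : HasGaussianLaw (fun ω => (U ω, Y ω)) μ) (hU0 : ∫ ω, U ω ∂μ = 0)
    (hY0 : ∫ ω, Y ω ∂μ = 0) : IndepFun (resid μ U Y) Y μ := by
  have hl := IsLinearImage.refl (V := fun ω => (U ω, Y ω))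
  have hU2 := hG.fst.memLp_two
  have hY2 := hG.snd.memLp_two
  exact (Uncorrelated.of_covMat (memLp_resid hU2 hY2) hY2
    (covMat_resid_left_self hQ hU2 hY2)).indepFun
    (((IsLinearImage.resid hl.fst hl.snd).prodMk hl.snd).hasGaussianLaw hG)
    (integral_resid hU2 hY2 hU0 hY0)

theorem cexp_ae_eq_regression [IsProbabilityMeasure μ] (hQ : IsUnit (covMat μ Y Y))
    (hUm : Measurable U) (hYm : Measurable Y) (hG : HasGaussianLaw (fun ω => (U ω, Y ω)) μ)
    (hU0 : ∫ ω, U ω ∂μ = 0) (hY0 : ∫ ω, Y ω ∂μ = 0) :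
    cexp μ U Y =ᵐ[μ] fun ω => toEuclideanLin (regCoef μ U Y) (Y ω) := by
  have hU2 := hG.fst.memLp_two
  have hY2 := hG.snd.memLp_two
  exact cexp_ae_eq hYm (measurable_toEuclideanLin _) (measurable_resid hUm hYm)
    (Filter.EventuallyEq.of_eq eq_add_resid)
    ((MemLp.toEuclideanLin _ hY2).integrable one_le_two)
    ((memLp_resid hU2 hY2).integrable one_le_two) (integral_resid hU2 hY2 hU0 hY0)
    (indepFun_resid hQ hG hU0 hY0)

theorem condCov_eq_covMat_resid [IsProbabilityMeasure μ] (hQ : IsUnit (covMat μ Y Y))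
    (hUm : Measurable U) (hVm : Measurable V) (hYm : Measurable Y)
    (hGU : HasGaussianLaw (fun ω => (U ω, Y ω)) μ) (hGV : HasGaussianLaw (fun ω => (V ω, Y ω)) μ)
    (hU0 : ∫ ω, U ω ∂μ = 0) (hV0 : ∫ ω, V ω ∂μ = 0) (hY0 : ∫ ω, Y ω ∂μ = 0) :
    condCov μ U V Y = covMat μ (resid μ U Y) (resid μ V Y) := by
  refine covMat_congr ?_ ?_
  · filter_upwards [cexp_ae_eq_regression hQ hUm hYm hGU hU0 hY0] with ω hω
    rw [hω, resid]
  · filter_upwards [cexp_ae_eq_regression hQ hVm hYm hGV hV0 hY0] with ω hω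
    rw [hω, resid]

end Residuals

/-! ### The test channel -/

section TestChannel

open Matrix

variable {Ω : Type*} [MeasurableSpace Ω] {μ : Measure Ω} {nx ns ny : ℕ}

/-- `(X, S, Y)` is a centered jointly Gaussian triple with invertible `Q_Y`. -/
structure IsGaussianSource (μ : Measure Ω) (X : Ω → Vec nx) (S : Ω → Vec ns) (Y : Ω → Vec ny) :
    Prop where
  measurable_fst : Measurable X
  measurable_snd : Measurable S
  measurable_thd : Measurable Y
  gaussian : HasGaussianLaw (fun ω => (X ω, S ω, Y ω)) μ
  mean_fst : ∫ ω, X ω ∂μ = 0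
  mean_snd : ∫ ω, S ω ∂μ = 0
  mean_thd : ∫ ω, Y ω ∂μ = 0
  isUnit : IsUnit (covMat μ Y Y)

/-- The conclusions about the realization `Xhat` of a feasible `(Σ, H, Q_W)`. -/
structure IsRealization (μ : Measure Ω) [IsProbabilityMeasure μ] (X : Ω → Vec nx)
    (S : Ω → Vec ns) (Y : Ω → Vec ny) (Sig : Matrix (Fin nx) (Fin nx) ℝ)
    (H : Matrix (Fin nx) (Fin ns) ℝ) (QW : Matrix (Fin nx) (Fin nx) ℝ) (W Xhat : Ω → Vec nx) :
    Prop where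
  eq_cexp : Xhat =ᵐ[μ] fun ω => toEuclideanLin H (S ω) + cexp μ X Y ω
    - toEuclideanLin H (cexp μ S Y ω) + W ω
  error_cov : covMat μ (fun ω => X ω - Xhat ω) (fun ω => X ω - Xhat ω) = Sig
  drops_side : CondLawDrops μ X Xhat Y
  drops_source : CondLawDrops μ Xhat (fun ω => (S ω, Y ω)) X
  drops_reproduction : CondLawDrops μ X (fun ω => (S ω, Y ω)) Xhat
  cexp_pair : cexp μ X (fun ω => (Xhat ω, Y ω)) =ᵐ[μ] Xhat
  cexp_self : cexp μ X Xhat =ᵐ[μ] Xhat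
  cexp_side : cexp μ X Y =ᵐ[μ] cexp μ Xhat Y
  postCov : condCov μ S S (fun ω => (Xhat ω, Y ω))
    = postCovS (condCov μ X X Y) (condCov μ S S Y) Sig H
  reproduction_cov : condCov μ Xhat Xhat Y = H * condCov μ S S Y * Hᵀ + QW
  reproduction_cov_eq_sub : condCov μ Xhat Xhat Y = condCov μ X X Y - Sig
  measurable : Measurable Xhat
  distortion : ∫⁻ ω, ‖X ω - Xhat ω‖ₑ ^ 2 ∂μ = ENNReal.ofReal Sig.trace
  rate_source : condMutualInfo μ S Xhat Y
    = halfLogDetRatio (condCov μ S S Y) (postCovS (condCov μ X X Y) (condCov μ S S Y) Sig H)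
  rate_reproduction : condMutualInfo μ S Xhat Y = halfLogDetRatio (condCov μ X X Y - Sig) QW
  postCov_psd : (postCovS (condCov μ X X Y) (condCov μ S S Y) Sig H).PosSemidef
  sub_postCov_psd : (condCov μ S S Y
    - postCovS (condCov μ X X Y) (condCov μ S S Y) Sig H).PosSemidef

theorem lintegral_enorm_sq_eq_trace {n : ℕ} {U : Ω → Vec n} (hU : MemLp U 2 μ) :
    ∫⁻ ω, ‖U ω‖ₑ ^ 2 ∂μ = ENNReal.ofReal (covMat μ U U).trace := by
  rw [trace_covMat_self hU, ofReal_integral_eq_lintegral_ofReal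
    ((memLp_two_iff_integrable_sq_norm hU.1).mp hU) (ae_of_all _ fun ω => sq_nonneg _)]
  refine lintegral_congr fun ω => ?_
  rw [ENNReal.ofReal_pow (norm_nonneg _), ofReal_norm]

/-- `I(S;B|Y)` when the error of estimating `S` from `(Y, B)` is Gaussian and independent of
`(Y, B)`. -/
theorem condMutualInfo_eq_halfLogDetRatio [IsProbabilityMeasure μ] {β γ : Type*}
    [MeasurableSpace β] [StandardBorelSpace β] [Nonempty β] [MeasurableSpace γ]
    {n : ℕ} {S s w : Ω → Vec n} {B : Ω → β} {Y : Ω → γ} {F : γ → Vec n} {r : γ × β → Vec n}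
    {A D : Matrix (Fin n) (Fin n) ℝ} (hB : Measurable B) (hY : Measurable Y)
    (hs : Measurable s) (hF : Measurable F) (hr : Measurable r)
    (hS : S = fun ω => F (Y ω) + s ω) (hind : IndepFun s Y μ) (hG : HasGaussianLaw s μ)
    (h0 : ∫ ω, s ω ∂μ = 0) (hr2 : MemLp (fun ω => r (Y ω, B ω)) 2 μ) (hA : covMat μ s s = A)
    (hw : w = fun ω => s ω - r (Y ω, B ω)) (hGw : HasGaussianLaw w μ) (hw0 : ∫ ω, w ω ∂μ = 0)
    (hindw : IndepFun w (fun ω => (Y ω, B ω)) μ) (hD : covMat μ w w = D)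
    (hAD : (A - D).PosSemidef) : condMutualInfo μ S B Y = halfLogDetRatio A D :=
  le_antisymm
    (condMutualInfo_le_halfLogDetRatio hB hY hs hF hr hS hind hG h0 hr2 hA hw hGw hw0 hindw hD
      hAD)
    (halfLogDetRatio_le_condMutualInfo hB hY hs hF hr hS hind hG h0 hr2 hA (by rw [← hw, hD]) hAD)

/-- The error covariance of the linear estimate of `s` from `z`. -/
theorem covMat_sub_estimate {s : Ω → Vec ns} {z : Ω → Vec nx} (s2 : MemLp s 2 μ)
    (z2 : MemLp z 2 μ) {QX Sig : Matrix (Fin nx) (Fin nx) ℝ} {QS : Matrix (Fin ns) (Fin ns) ℝ}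
    {H : Matrix (Fin nx) (Fin ns) ℝ} (css : covMat μ s s = QS) (csz : covMat μ s z = QS * Hᵀ)
    (czz : covMat μ z z = QX - Sig) {G : Matrix (Fin ns) (Fin nx) ℝ}
    (hG : G = QS * Hᵀ * pinv (QX - Sig)) :
    covMat μ (fun ω => s ω - toEuclideanLin G (z ω)) z = 0 ∧
    covMat μ (fun ω => s ω - toEuclideanLin G (z ω)) (fun ω => s ω - toEuclideanLin G (z ω))
      = postCovS QX QS Sig H ∧
    (QS - postCovS QX QS Sig H).PosSemidef := by
  have Gz2 := MemLp.toEuclideanLin G z2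
  have v2 : MemLp (fun ω => s ω - toEuclideanLin G (z ω)) 2 μ := s2.sub Gz2
  have hQST : QSᵀ = QS := PosSemidef.transpose_eq (css ▸ covMat_self_posSemidef s2)
  have h1 : G * (QX - Sig) = QS * Hᵀ := by
    have := covMat_mul_pinv_mul s2 z2
    rwa [csz, czz, ← hG] at this
  have h2 : Gᵀ = pinv (QX - Sig) * H * QS := by
    rw [hG, transpose_mul, transpose_mul, transpose_transpose, hQST, PosSemidef.transpose_pinv
      (by rw [← czz]; exact covMat_self_posSemidef z2), Matrix.mul_assoc]
  have cvz : covMat μ (fun ω => s ω - toEuclideanLin G (z ω)) z = 0 := by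
    rw [covMat_sub_left s2 Gz2 z2, covMat_lin_left _ z2 z2, csz, czz, h1, sub_self]
  refine ⟨cvz, ?_, ?_⟩
  · rw [covMat_sub_right v2 s2 Gz2, covMat_lin_right _ v2 z2, cvz, Matrix.zero_mul, sub_zero,
      covMat_sub_left s2 Gz2 s2, covMat_lin_left _ z2 s2, css, ← covMat_transpose s z, csz,
      transpose_mul, transpose_transpose, hQST, hG, postCovS]
    simp only [Matrix.mul_assoc]
  · have : QS - postCovS QX QS Sig H
        = covMat μ (fun ω => toEuclideanLin G (z ω)) (fun ω => toEuclideanLin G (z ω)) := by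
      rw [covMat_lin_left _ z2 Gz2, covMat_lin_right _ z2 z2, czz, ← Matrix.mul_assoc, h1, h2,
        postCovS, sub_sub_cancel]
      simp only [Matrix.mul_assoc]
    exact this ▸ covMat_self_posSemidef Gz2

/-- Every vector involved is a linear image of `(W, X, S, Y)`, so each independence reduces to a
covariance computation. Three errors carry the result: `e = X - Xhat`, independent of `(Xhat, Y)`;
`u`, of estimating `x` from `s`, independent of `(S, Y, Xhat)`; and `v`, of estimating `s` from `z`,
independent of `(Xhat, Y)`. -/
theorem isRealization_realization [IsProbabilityMeasure μ] {X : Ω → Vec nx} {S : Ω → Vec ns}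
    {Y : Ω → Vec ny} (hsrc : IsGaussianSource μ X S Y) {Sig : Matrix (Fin nx) (Fin nx) ℝ}
    {H : Matrix (Fin nx) (Fin ns) ℝ} {QW : Matrix (Fin nx) (Fin nx) ℝ}
    (hf : IsFeasible (condCov μ X X Y) (condCov μ X S Y) (condCov μ S S Y) Sig H QW)
    {W : Ω → Vec nx} (hW : IsCenteredGaussian μ W QW)
    (hWind : IndepFun W (fun ω => (X ω, S ω, Y ω)) μ) :
    IsRealization μ X S Y Sig H QW W (realization μ X S Y H W) := by
  obtain ⟨hXm, hSm, hYm, hG, hX0, hS0, hY0, hQ⟩ := hsrc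
  obtain ⟨hWm, hWG, hW0, hWcov⟩ := hW
  obtain ⟨hSig, hgain, hgsymm, hgpsd, hnoise, hnpsd⟩ := hf
  -- the jointly Gaussian vector
  have hV : HasGaussianLaw (fun ω => (W ω, (X ω, S ω, Y ω))) μ :=
    IndepFun.hasGaussianLaw hWG hG hWind
  have lV := IsLinearImage.refl (V := fun ω => (W ω, (X ω, S ω, Y ω)))
  have lW := lV.fst
  have lX := lV.snd.fst
  have lS := lV.snd.snd.fst
  have lY := lV.snd.snd.snd
  simp only at lW lX lS lY
  set x := resid μ X Y with hx
  set s := resid μ S Y with hs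
  have lx : IsLinearImage _ x := lX.resid lY
  have ls : IsLinearImage _ s := lS.resid lY
  have X2 := (lX.hasGaussianLaw hV).memLp_two
  have S2 := (lS.hasGaussianLaw hV).memLp_two
  have Y2 := (lY.hasGaussianLaw hV).memLp_two
  have W2 := hWG.memLp_two
  have x2 : MemLp x 2 μ := memLp_resid X2 Y2
  have s2 : MemLp s 2 μ := memLp_resid S2 Y2
  have xm : Measurable x := measurable_resid hXm hYm
  have sm : Measurable s := measurable_resid hSm hYm
  have x0 : ∫ ω, x ω ∂μ = 0 := integral_resid X2 Y2 hX0 hY0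
  have s0 : ∫ ω, s ω ∂μ = 0 := integral_resid S2 Y2 hS0 hY0
  have gXY := (lX.prodMk lY).hasGaussianLaw hV
  have gSY := (lS.prodMk lY).hasGaussianLaw hV
  have eQX := condCov_eq_covMat_resid hQ hXm hXm hYm gXY gXY hX0 hX0 hY0
  have eQXS := condCov_eq_covMat_resid hQ hXm hSm hYm gXY gSY hX0 hS0 hY0
  have eQS := condCov_eq_covMat_resid hQ hSm hSm hYm gSY gSY hS0 hS0 hY0
  set QX := condCov μ X X Y
  set QXS := condCov μ X S Y
  set QS := condCov μ S S Y
  -- second moments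
  have cxY : covMat μ x Y = 0 := covMat_resid_left_self hQ X2 Y2
  have csY : covMat μ s Y = 0 := covMat_resid_left_self hQ S2 Y2
  have wX : covMat μ X W = 0 := covMat_eq_zero_of_indepFun (X2.integrable one_le_two)
    (W2.integrable one_le_two) (hWind.symm.comp (φ := fun p : Vec nx × Vec ns × Vec ny => p.1)
      (ψ := id) (by fun_prop) measurable_id) hW0
  have wS : covMat μ S W = 0 := covMat_eq_zero_of_indepFun (S2.integrable one_le_two)
    (W2.integrable one_le_two) (hWind.symm.comp (φ := fun p : Vec nx × Vec ns × Vec ny => p.2.1)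
      (ψ := id) (by fun_prop) measurable_id) hW0
  have wY : covMat μ Y W = 0 := covMat_eq_zero_of_indepFun (Y2.integrable one_le_two)
    (W2.integrable one_le_two) (hWind.symm.comp (φ := fun p : Vec nx × Vec ns × Vec ny => p.2.2)
      (ψ := id) (by fun_prop) measurable_id) hW0
  have wx : covMat μ x W = 0 := by
    rw [hx]; unfold resid
    rw [covMat_sub_left X2 (MemLp.toEuclideanLin _ Y2) W2, covMat_lin_left _ Y2 W2, wX, wY]; simp
  have ws : covMat μ s W = 0 := by
    rw [hs]; unfold resid
    rw [covMat_sub_left S2 (MemLp.toEuclideanLin _ Y2) W2, covMat_lin_left _ Y2 W2, wS, wY]; simp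
  have csx : covMat μ s x = QXSᵀ := by rw [eQXS, covMat_transpose]
  have tr : ∀ {a b : ℕ} {U : Ω → Vec a} {V : Ω → Vec b}, covMat μ U V = 0 → covMat μ V U = 0 :=
    fun h => by rw [← covMat_transpose, h, transpose_zero]
  -- the innovation of the reproduction
  set z : Ω → Vec nx := fun ω => toEuclideanLin H (s ω) + W ω with hz
  have lz : IsLinearImage _ z := (ls.toEuclideanLin H).add lW
  have Hs2 := MemLp.toEuclideanLin H s2
  have z2 : MemLp z 2 μ := Hs2.add W2
  have zm : Measurable z := ((measurable_toEuclideanLin H).comp sm).add hWm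
  have czr : ∀ {a : ℕ} {U : Ω → Vec a}, MemLp U 2 μ →
      covMat μ U z = covMat μ U s * Hᵀ + covMat μ U W := fun hU => by
    rw [hz, covMat_add_right hU Hs2 W2, covMat_lin_right _ hU s2]
  have czY : covMat μ z Y = 0 := tr (by rw [czr Y2, tr csY, wY]; simp)
  have csz : covMat μ s z = QS * Hᵀ := by rw [czr s2, ← eQS, ws, add_zero]
  have cxz : covMat μ x z = QXS * Hᵀ := by rw [czr x2, ← eQXS, wx, add_zero]
  have cWz : covMat μ W z = QW := by rw [czr W2, tr ws, hWcov]; simp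
  have czz : covMat μ z z = H * QS * Hᵀ + QW := by
    rw [hz, covMat_add_left Hs2 W2 z2, covMat_lin_left _ s2 z2, csz, cWz, Matrix.mul_assoc]
  have hQz : H * QS * Hᵀ + QW = QX - Sig := by rw [hnoise, ← hgain]; abel
  have z0 : ∫ ω, z ω ∂μ = 0 := by
    rw [hz, integral_add (Hs2.integrable one_le_two) (W2.integrable one_le_two),
      integral_toEuclideanLin _ (s2.integrable one_le_two), s0, hW0, map_zero, add_zero]
  have hXhat : realization μ X S Y H W = fun ω => toEuclideanLin (regCoef μ X Y) (Y ω) + z ω := by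
    funext ω
    have e1 : (covMat μ X Y - H * covMat μ S Y) * (covMat μ Y Y)⁻¹
        = regCoef μ X Y - H * regCoef μ S Y := by
      rw [regCoef, regCoef, Matrix.sub_mul, Matrix.mul_assoc]
    simp only [realization, e1, hz, hs, resid, map_sub, LinearMap.sub_apply,
      toEuclideanLin_mul_apply]
    abel
  set Xhat := realization μ X S Y H W
  have LY2 := MemLp.toEuclideanLin (regCoef μ X Y) Y2
  have lXhat : IsLinearImage (fun ω => (W ω, (X ω, S ω, Y ω))) Xhat := by
    rw [hXhat]; exact (lY.toEuclideanLin _).add lz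
  have Xhatm : Measurable Xhat := by
    rw [hXhat]; exact ((measurable_toEuclideanLin _).comp hYm).add zm
  have Xhat2 : MemLp Xhat 2 μ := by rw [hXhat]; exact LY2.add z2
  have Xhat0 : ∫ ω, Xhat ω ∂μ = 0 := by
    rw [hXhat, integral_add (LY2.integrable one_le_two) (z2.integrable one_le_two),
      integral_toEuclideanLin _ (Y2.integrable one_le_two), hY0, z0, map_zero, add_zero]
  have cXhat : ∀ {a : ℕ} {U : Ω → Vec a}, MemLp U 2 μ → covMat μ U Y = 0 →
      covMat μ U Xhat = covMat μ U z := fun hU h => by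
    rw [hXhat, covMat_add_right hU LY2 z2, covMat_lin_right _ hU Y2, h]; simp
  have cXhatY : covMat μ Xhat Y = covMat μ X Y := by
    rw [hXhat, covMat_add_left LY2 z2 Y2, covMat_lin_left _ Y2 Y2, czY, add_zero, regCoef,
      Matrix.mul_assoc, nonsing_inv_mul _ ((isUnit_iff_isUnit_det _).mp hQ), Matrix.mul_one]
  have rXhat : regCoef μ Xhat Y = regCoef μ X Y := by rw [regCoef, cXhatY, regCoef]
  have zres : resid μ Xhat Y = z := by
    funext ω
    rw [resid, rXhat, hXhat]; simp
  have gXhatY := (lXhat.prodMk lY).hasGaussianLaw hV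
  have cX := cexp_ae_eq_regression hQ hXm hYm gXY hX0 hY0
  have cS := cexp_ae_eq_regression hQ hSm hYm gSY hS0 hY0
  have cXh := cexp_ae_eq_regression hQ Xhatm hYm gXhatY Xhat0 hY0
  have eQz := condCov_eq_covMat_resid hQ Xhatm Xhatm hYm gXhatY gXhatY Xhat0 Xhat0 hY0
  rw [zres, czz] at eQz
  -- the reproduction error
  have hXe : X = fun ω => toEuclideanLin (regCoef μ X Y) (Y ω) + x ω := eq_add_resid
  set e : Ω → Vec nx := fun ω => X ω - Xhat ω with he
  have hexz : e = fun ω => x ω - z ω := by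
    funext ω; simp only [he, hXhat]; rw [congrFun hXe ω]; simp
  have le : IsLinearImage _ e := lX.sub lXhat
  have em : Measurable e := hXm.sub Xhatm
  have e2 : MemLp e 2 μ := X2.sub Xhat2
  have e0 : ∫ ω, e ω ∂μ = 0 := by
    rw [he, integral_sub (X2.integrable one_le_two) (Xhat2.integrable one_le_two), hX0, Xhat0,
      sub_zero]
  have ceY : covMat μ e Y = 0 := by
    rw [hexz, covMat_sub_left x2 z2 Y2, cxY, czY, sub_zero]
  -- Orthogonality of error and reproduction: `E[x zᵀ] = QXS * Hᵀ` equals `E[z zᵀ] = H * QXSᵀ` by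
  -- the symmetry constraint on the gain.
  have cez : covMat μ e z = 0 := by
    rw [hexz, covMat_sub_left x2 z2 z2, cxz, czz, hQz, ← hgain, hgsymm, sub_self]
  have cee : covMat μ e e = Sig := by
    have h1 : covMat μ e e = covMat μ e x := by
      conv_lhs => rw [show covMat μ e e = covMat μ e (fun ω => x ω - z ω) by rw [← hexz]]
      rw [covMat_sub_right e2 x2 z2, cez, sub_zero]
    rw [h1, hexz, covMat_sub_left x2 z2 x2, ← eQX, ← covMat_transpose x z, cxz, ← hgsymm,
      hgain, transpose_sub, PosSemidef.transpose_eq hSig,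
      PosSemidef.transpose_eq (eQX ▸ covMat_self_posSemidef x2), sub_sub_cancel]
  have ceXhat : covMat μ e Xhat = 0 := by rw [cXhat e2 ceY, cez]
  have ie : IndepFun e (fun ω => (Xhat ω, Y ω)) μ :=
    (Uncorrelated.prodMk e2 Xhat2 Y2 (.of_covMat e2 Xhat2 ceXhat)
      (.of_covMat e2 Y2 ceY)).indepFun ((le.prodMk (lXhat.prodMk lY)).hasGaussianLaw hV) e0
  have hXsum : X = fun ω => Xhat ω + e ω := by funext ω; simp [he]
  -- the regression of the source on the observation
  set K := QXS * pinv QS with hK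
  set u : Ω → Vec nx := fun ω => x ω - toEuclideanLin K (s ω) with hu
  have Ks2 := MemLp.toEuclideanLin K s2
  have u2 : MemLp u 2 μ := x2.sub Ks2
  have lu : IsLinearImage _ u := lx.sub (ls.toEuclideanLin K)
  have u0 : ∫ ω, u ω ∂μ = 0 := by
    rw [hu, integral_sub (x2.integrable one_le_two) (Ks2.integrable one_le_two),
      integral_toEuclideanLin _ (s2.integrable one_le_two), x0, s0, map_zero, sub_zero]
  have cul : ∀ {a : ℕ} {U : Ω → Vec a}, MemLp U 2 μ →
      covMat μ u U = covMat μ x U - K * covMat μ s U := fun hU => by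
    rw [hu, covMat_sub_left x2 Ks2 hU, covMat_lin_left _ s2 hU]
  have cus : covMat μ u s = 0 := by
    have := covMat_mul_pinv_mul x2 s2
    rw [← eQXS, ← eQS] at this
    rw [cul s2, ← eQXS, ← eQS, hK, this, sub_self]
  have cuY : covMat μ u Y = 0 := by rw [cul Y2, cxY, csY]; simp
  have cuW : covMat μ u W = 0 := by rw [cul W2, wx, ws]; simp
  have cuS : covMat μ u S = 0 := by
    rw [show covMat μ u S = covMat μ u (fun ω => toEuclideanLin (regCoef μ S Y) (Y ω) + s ω) by
      rw [hs, ← eq_add_resid],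
      covMat_add_right u2 (MemLp.toEuclideanLin _ Y2) s2, covMat_lin_right _ u2 Y2, cuY, cus]
    simp
  have cuXhat : covMat μ u Xhat = 0 := by rw [cXhat u2 cuY, czr u2, cus, cuW]; simp
  have iu : IndepFun u (fun ω => ((S ω, Y ω), Xhat ω)) μ :=
    (Uncorrelated.prodMk u2 gSY.memLp_two Xhat2
      (Uncorrelated.prodMk u2 S2 Y2 (.of_covMat u2 S2 cuS) (.of_covMat u2 Y2 cuY))
      (.of_covMat u2 Xhat2 cuXhat)).indepFun
      ((lu.prodMk ((lS.prodMk lY).prodMk lXhat)).hasGaussianLaw hV) u0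
  have drop2 : CondLawDrops μ X (fun ω => (S ω, Y ω)) Xhat := by
    refine condLawDrops_of_indepFun (u := u) (M := fun p : Vec ns × Vec ny =>
      toEuclideanLin (regCoef μ X Y) p.2
        + toEuclideanLin K (p.1 - toEuclideanLin (regCoef μ S Y) p.2))
      (hSm.prodMk hYm) Xhatm ?_ (xm.sub ((measurable_toEuclideanLin K).comp sm)) ?_ iu
    · have h1 := measurable_toEuclideanLin (regCoef μ X Y)
      have h2 := measurable_toEuclideanLin K
      have h3 := measurable_toEuclideanLin (regCoef μ S Y)
      fun_prop
    · funext ω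
      rw [congrFun hXe ω]
      simp only [hu, hs, resid]
      abel
  have drop1 : CondLawDrops μ Xhat (fun ω => (S ω, Y ω)) X := by
    refine condLawDrops_of_indepFun (u := W) (M := fun p : Vec ns × Vec ny =>
      toEuclideanLin (regCoef μ X Y) p.2
        + toEuclideanLin H (p.1 - toEuclideanLin (regCoef μ S Y) p.2))
      (hSm.prodMk hYm) hXm ?_ hWm ?_
      (hWind.comp (φ := id) (ψ := fun p : Vec nx × Vec ns × Vec ny => ((p.2.1, p.2.2), p.1))
        measurable_id (by fun_prop))
    · have h1 := measurable_toEuclideanLin (regCoef μ X Y)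
      have h2 := measurable_toEuclideanLin H
      have h3 := measurable_toEuclideanLin (regCoef μ S Y)
      fun_prop
    · rw [hXhat]
      funext ω
      simp only [hz, hs, resid]
      abel
  -- the estimation of the observation from the reproduction
  set Gm := QS * Hᵀ * pinv (QX - Sig) with hGm
  set v : Ω → Vec ns := fun ω => s ω - toEuclideanLin Gm (z ω) with hv
  have Gz2 := MemLp.toEuclideanLin Gm z2
  have v2 : MemLp v 2 μ := s2.sub Gz2
  have lv : IsLinearImage _ v := ls.sub (lz.toEuclideanLin Gm)
  have vm : Measurable v := sm.sub ((measurable_toEuclideanLin Gm).comp zm)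
  have v0 : ∫ ω, v ω ∂μ = 0 := by
    rw [hv, integral_sub (s2.integrable one_le_two) (Gz2.integrable one_le_two),
      integral_toEuclideanLin _ (z2.integrable one_le_two), s0, z0, map_zero, sub_zero]
  have cvl : ∀ {a : ℕ} {U : Ω → Vec a}, MemLp U 2 μ →
      covMat μ v U = covMat μ s U - Gm * covMat μ z U := fun hU => by
    rw [hv, covMat_sub_left s2 Gz2 hU, covMat_lin_left _ z2 hU]
  obtain ⟨cvz, cvv, hsub1psd⟩ := covMat_sub_estimate s2 z2 eQS.symm csz (czz.trans hQz) hGm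
  have cvY : covMat μ v Y = 0 := by rw [cvl Y2, csY, czY]; simp
  have cvXhat : covMat μ v Xhat = 0 := by rw [cXhat v2 cvY, cvz]
  have iv : IndepFun v (fun ω => (Xhat ω, Y ω)) μ :=
    (Uncorrelated.prodMk v2 Xhat2 Y2 (.of_covMat v2 Xhat2 cvXhat)
      (.of_covMat v2 Y2 cvY)).indepFun ((lv.prodMk (lXhat.prodMk lY)).hasGaussianLaw hV) v0
  have hSe : S = fun ω => toEuclideanLin (regCoef μ S Y) (Y ω) + s ω := eq_add_resid
  have hzX : ∀ ω, Xhat ω - toEuclideanLin (regCoef μ X Y) (Y ω) = z ω := fun ω => by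
    rw [hXhat]; simp
  have cS2 : cexp μ S (fun ω => (Xhat ω, Y ω)) =ᵐ[μ]
      fun ω => toEuclideanLin (regCoef μ S Y) (Y ω) + toEuclideanLin Gm (z ω) := by
    have h := cexp_ae_eq (μ := μ) (U := S) (u := v) (Z := fun ω => (Xhat ω, Y ω))
      (M := fun p : Vec nx × Vec ny => toEuclideanLin (regCoef μ S Y) p.2
        + toEuclideanLin Gm (p.1 - toEuclideanLin (regCoef μ X Y) p.2))
      (Xhatm.prodMk hYm) (by
        have h1 := measurable_toEuclideanLin (regCoef μ X Y)
        have h2 := measurable_toEuclideanLin Gm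
        have h3 := measurable_toEuclideanLin (regCoef μ S Y)
        fun_prop) vm (Filter.EventuallyEq.of_eq (by
          funext ω
          simp only [hzX, hv]
          rw [congrFun hSe ω]; abel)) (by
        simp only [hzX]
        exact ((MemLp.toEuclideanLin _ Y2).add Gz2).integrable one_le_two)
      (v2.integrable one_le_two) v0 iv
    simpa only [hzX] using h
  have hpost : condCov μ S S (fun ω => (Xhat ω, Y ω)) = postCovS QX QS Sig H := by
    rw [← cvv]
    have h : (fun ω => S ω - cexp μ S (fun ω => (Xhat ω, Y ω)) ω) =ᵐ[μ] v := by
      filter_upwards [cS2] with ω hω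
      rw [hω, congrFun hSe ω]; simp only [hv]; abel
    exact covMat_congr h h
  have hXhatAdd : Xhat = fun ω => toEuclideanLin (regCoef μ X Y) (Y ω) + z ω := hXhat
  have rate1 : condMutualInfo μ S Xhat Y = halfLogDetRatio QS (postCovS QX QS Sig H) := by
    refine condMutualInfo_eq_halfLogDetRatio (w := v)
      (F := fun y => toEuclideanLin (regCoef μ S Y) y)
      (r := fun p : Vec ny × Vec nx =>
        toEuclideanLin Gm (p.2 - toEuclideanLin (regCoef μ X Y) p.1))
      Xhatm hYm sm (measurable_toEuclideanLin _) ?_ hSe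
      (indepFun_resid hQ gSY hS0 hY0) (ls.hasGaussianLaw hV) s0 ?_ eQS.symm ?_
      (lv.hasGaussianLaw hV) v0 (iv.comp measurable_id measurable_swap) cvv hsub1psd
    · have h1 := measurable_toEuclideanLin (regCoef μ X Y)
      have h2 := measurable_toEuclideanLin Gm
      fun_prop
    · simpa only [hzX] using Gz2
    · simp only [hzX, hv]
  have hzs : ∀ ω, S ω - toEuclideanLin (regCoef μ S Y) (Y ω) = s ω := fun ω => rfl
  have rate2 : condMutualInfo μ S Xhat Y = halfLogDetRatio (QX - Sig) QW := by
    -- With the roles exchanged, `z` is estimated by `H s`; the error is exactly `W`, so its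
    -- covariance is `QW`.
    rw [condMutualInfo_comm hSm Xhatm hYm]
    refine condMutualInfo_eq_halfLogDetRatio (s := z) (w := W)
      (F := fun y => toEuclideanLin (regCoef μ X Y) y)
      (r := fun p : Vec ny × Vec ns =>
        toEuclideanLin H (p.2 - toEuclideanLin (regCoef μ S Y) p.1))
      hSm hYm zm (measurable_toEuclideanLin _) ?_ hXhatAdd
      ?_ (lz.hasGaussianLaw hV) z0 ?_ (czz.trans hQz) ?_ hWG hW0
      (hWind.comp (φ := id) (ψ := fun p : Vec nx × Vec ns × Vec ny => (p.2.2, p.2.1))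
        measurable_id (by fun_prop)) hWcov ?_
    · have h1 := measurable_toEuclideanLin (regCoef μ S Y)
      have h2 := measurable_toEuclideanLin H
      fun_prop
    · rw [← zres]; exact indepFun_resid hQ gXhatY Xhat0 hY0
    · simpa only [hzs] using Hs2
    · funext ω; simp only [hzs, hz]; abel
    · rw [← hQz, add_sub_cancel_right, eQS]
      exact PosSemidef.conj_transpose (covMat_self_posSemidef s2) H
  have hdist : ∫⁻ ω, ‖X ω - Xhat ω‖ₑ ^ 2 ∂μ = ENNReal.ofReal Sig.trace := by
    rw [← cee]; exact lintegral_enorm_sq_eq_trace e2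
  refine ⟨?_, cee, ?_, drop1, drop2, ?_, ?_, ?_, hpost, eQz, eQz.trans hQz, Xhatm, hdist, rate1,
    rate2, cvv ▸ covMat_self_posSemidef v2, hsub1psd⟩
  · filter_upwards [cX, cS] with ω h1 h2
    rw [h1, h2, hXhat]
    simp only [hz, hs, resid, map_sub]
    abel
  · exact condLawDrops_of_indepFun (M := id) Xhatm hYm measurable_id em hXsum ie
  · exact cexp_ae_eq (u := e) (M := Prod.fst) (Xhatm.prodMk hYm) measurable_fst em
      (Filter.EventuallyEq.of_eq hXsum) (Xhat2.integrable one_le_two) (e2.integrable one_le_two)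
      e0 ie
  · exact cexp_ae_eq (u := e) (M := id) Xhatm measurable_id em
      (Filter.EventuallyEq.of_eq hXsum) (Xhat2.integrable one_le_two) (e2.integrable one_le_two)
      e0 (ie.comp measurable_id measurable_fst)
  · rw [rXhat] at cXh
    exact cX.trans cXh.symm

end TestChannel

/-! ### Invariance under a change of the probability space -/

section Laws

open Matrix

variable {Ω Ω' : Type*} [MeasurableSpace Ω] [MeasurableSpace Ω'] {μ : Measure Ω}

theorem covMat_of_map {E : Type*} [MeasurableSpace E] {V : Ω → E} (hV : Measurable V) {m n : ℕ}
    {f : E → Vec m} {g : E → Vec n} (hf : Measurable f) (hg : Measurable g) :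
    covMat (μ.map V) f g = covMat μ (fun ω => f (V ω)) (fun ω => g (V ω)) := by
  ext i j
  simp only [covMat, of_apply]
  exact integral_map hV.aemeasurable (by fun_prop)

variable [IsProbabilityMeasure μ] {Φ : Ω → Ω'}

theorem condDistrib_map_eq {α β : Type*} [MeasurableSpace α] [StandardBorelSpace α]
    [Nonempty α] [MeasurableSpace β] (hΦ : Measurable Φ) [IsFiniteMeasure (μ.map Φ)]
    {U : Ω' → α} {V : Ω' → β} (hU : Measurable U) (hV : Measurable V) :
    condDistrib U V (μ.map Φ) = condDistrib (fun ω => U (Φ ω)) (fun ω => V (Φ ω)) μ := by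
  rw [condDistrib, condDistrib]
  congr 1
  rw [Measure.map_map (hV.prodMk hU) hΦ]
  rfl

theorem condMutualInfo_map_eq {α β γ : Type*} [MeasurableSpace α] [StandardBorelSpace α]
    [Nonempty α] [MeasurableSpace β] [StandardBorelSpace β] [Nonempty β] [MeasurableSpace γ]
    (hΦ : Measurable Φ) [IsFiniteMeasure (μ.map Φ)] {A : Ω' → α} {B : Ω' → β} {C : Ω' → γ}
    (hA : Measurable A) (hB : Measurable B) (hC : Measurable C) :
    condMutualInfo (μ.map Φ) A B C
      = condMutualInfo μ (fun ω => A (Φ ω)) (fun ω => B (Φ ω)) (fun ω => C (Φ ω)) := by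
  rw [condMutualInfo, condMutualInfo, condDistrib_map_eq hΦ hA hC, condDistrib_map_eq hΦ hB hC,
    Measure.map_map hC hΦ, Measure.map_map (hC.prodMk (hA.prodMk hB)) hΦ]
  rfl

theorem CondLawDrops.map {α β γ : Type*} [MeasurableSpace α] [StandardBorelSpace α]
    [Nonempty α] [MeasurableSpace β] [MeasurableSpace γ] (hΦ : Measurable Φ)
    [IsFiniteMeasure (μ.map Φ)] {U : Ω' → α} {V : Ω' → β} {T : Ω' → γ} (hU : Measurable U)
    (hV : Measurable V) (hT : Measurable T)
    (h : CondLawDrops μ (fun ω => U (Φ ω)) (fun ω => V (Φ ω)) (fun ω => T (Φ ω))) :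
    CondLawDrops (μ.map Φ) U V T := by
  rw [CondLawDrops, condDistrib_map_eq hΦ hU hV, condDistrib_map_eq hΦ hU (hV.prodMk hT),
    Measure.map_map (hV.prodMk hT) hΦ]
  exact h

variable {nx ns ny : ℕ} {X : Ω → Vec nx} {S : Ω → Vec ns} {Y : Ω → Vec ny}

theorem IsAdmissible.exists_law {Xhat : Ω → Vec nx} {Δ : ℝ≥0} (hX : Measurable X)
    (hS : Measurable S) (hY : Measurable Y) (h : IsAdmissible μ X S Y Xhat Δ) :
    ∃ ν ∈ admissibleLaws (μ.map fun ω => (X ω, S ω, Y ω)) Δ,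
      condMutualInfo (ν : Measure ((Vec nx × Vec ns × Vec ny) × Vec nx))
        (fun q => q.1.2.1) (fun q => q.2) (fun q => q.1.2.2) = condMutualInfo μ S Xhat Y := by
  have hXhat := h.measurable
  have hΦ : Measurable fun ω => ((X ω, S ω, Y ω), Xhat ω) := by fun_prop
  have := Measure.isProbabilityMeasure_map (μ := μ) hΦ.aemeasurable
  have hadm : IsAdmissible (μ.map fun ω => ((X ω, S ω, Y ω), Xhat ω)) (fun q => q.1.1)
      (fun q => q.1.2.1) (fun q => q.1.2.2) (fun q => q.2) Δ := by
    refine ⟨measurable_snd, ?_, ?_⟩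
    · exact CondLawDrops.map hΦ measurable_snd (by fun_prop) (by fun_prop) h.markov
    · rw [lintegral_map (by fun_prop) hΦ]
      exact h.distortion
  refine ⟨⟨μ.map fun ω => ((X ω, S ω, Y ω), Xhat ω), this⟩, ⟨?_, hadm⟩, ?_⟩
  · simp only [ProbabilityMeasure.coe_mk]
    rw [Measure.map_map measurable_fst hΦ]
    rfl
  · exact condMutualInfo_map_eq hΦ (by fun_prop) (by fun_prop) (by fun_prop)

theorem IsAdmissible.rdf_le {Xhat : Ω → Vec nx} {Δ : ℝ≥0} (hX : Measurable X)
    (hS : Measurable S) (hY : Measurable Y) (h : IsAdmissible μ X S Y Xhat Δ) :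
    rdf (μ.map fun ω => (X ω, S ω, Y ω)) Δ ≤ condMutualInfo μ S Xhat Y := by
  obtain ⟨ν, hν, he⟩ := h.exists_law hX hS hY
  rw [← he]
  exact iInf₂_le ν hν

theorem IsGaussianSource.condCov_eq_covMat_resid (h : IsGaussianSource μ X S Y) :
    condCov μ X X Y = covMat μ (resid μ X Y) (resid μ X Y) ∧
      condCov μ X S Y = covMat μ (resid μ X Y) (resid μ S Y) ∧
      condCov μ S S Y = covMat μ (resid μ S Y) (resid μ S Y) := by
  obtain ⟨hXm, hSm, hYm, hG, hX0, hS0, hY0, hQ⟩ := h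
  have lV := IsLinearImage.refl (V := fun ω => (X ω, S ω, Y ω))
  have gXY := (lV.fst.prodMk lV.snd.snd).hasGaussianLaw hG
  have gSY := (lV.snd.fst.prodMk lV.snd.snd).hasGaussianLaw hG
  exact ⟨RemoteRDF.condCov_eq_covMat_resid hQ hXm hXm hYm gXY gXY hX0 hX0 hY0,
    RemoteRDF.condCov_eq_covMat_resid hQ hXm hSm hYm gXY gSY hX0 hS0 hY0,
    RemoteRDF.condCov_eq_covMat_resid hQ hSm hSm hYm gSY gSY hS0 hS0 hY0⟩

/-- The Schur complement form involves only second moments, hence only the joint law of the source.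
-/
theorem IsGaussianSource.condCov_eq (h : IsGaussianSource μ X S Y) :
    condCov μ X X Y = covMat μ X X - covMat μ X Y * (covMat μ Y Y)⁻¹ * covMat μ Y X ∧
      condCov μ X S Y = covMat μ X S - covMat μ X Y * (covMat μ Y Y)⁻¹ * covMat μ Y S ∧
      condCov μ S S Y = covMat μ S S - covMat μ S Y * (covMat μ Y Y)⁻¹ * covMat μ Y S := by
  obtain ⟨h1, h2, h3⟩ := h.condCov_eq_covMat_resid
  have X2 := h.gaussian.fst.memLp_two
  have S2 := h.gaussian.snd.fst.memLp_two
  have Y2 := h.gaussian.snd.snd.memLp_two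
  exact ⟨h1.trans (covMat_resid_resid h.isUnit X2 X2 Y2),
    h2.trans (covMat_resid_resid h.isUnit X2 S2 Y2),
    h3.trans (covMat_resid_resid h.isUnit S2 S2 Y2)⟩

section SameLaw

variable {μ' : Measure Ω'} {X' : Ω' → Vec nx} {S' : Ω' → Vec ns} {Y' : Ω' → Vec ny}

/-- Conditional covariances are defined by conditional expectations on a given probability space.
This allows them to be carried to any other space supporting the same law. -/
theorem IsGaussianSource.congr_law [IsProbabilityMeasure μ'] (h : IsGaussianSource μ X S Y)
    (hX : Measurable X') (hS : Measurable S') (hY : Measurable Y')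
    (hlaw : (μ'.map fun ω => (X' ω, S' ω, Y' ω)) = μ.map fun ω => (X ω, S ω, Y ω)) :
    IsGaussianSource μ' X' S' Y' ∧ condCov μ' X' X' Y' = condCov μ X X Y ∧
      condCov μ' X' S' Y' = condCov μ X S Y ∧ condCov μ' S' S' Y' = condCov μ S S Y := by
  have hV : Measurable fun ω => (X ω, S ω, Y ω) :=
    h.measurable_fst.prodMk (h.measurable_snd.prodMk h.measurable_thd)
  have hV' : Measurable fun ω => (X' ω, S' ω, Y' ω) := by fun_prop
  have hinteg : ∀ {n : ℕ} {f : Vec nx × Vec ns × Vec ny → Vec n}, Measurable f →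
      ∫ ω, f (X' ω, S' ω, Y' ω) ∂μ' = ∫ ω, f (X ω, S ω, Y ω) ∂μ := fun hf => by
    rw [← integral_map hV'.aemeasurable hf.aestronglyMeasurable, hlaw,
      integral_map hV.aemeasurable hf.aestronglyMeasurable]
  have hcov : ∀ {m n : ℕ} {f : Vec nx × Vec ns × Vec ny → Vec m}
      {g : Vec nx × Vec ns × Vec ny → Vec n}, Measurable f → Measurable g →
      covMat μ' (fun ω => f (X' ω, S' ω, Y' ω)) (fun ω => g (X' ω, S' ω, Y' ω))
        = covMat μ (fun ω => f (X ω, S ω, Y ω)) (fun ω => g (X ω, S ω, Y ω)) :=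
    fun hf hg => by rw [← covMat_of_map hV' hf hg, hlaw, covMat_of_map hV hf hg]
  have m1 : Measurable fun p : Vec nx × Vec ns × Vec ny => p.1 := by fun_prop
  have m2 : Measurable fun p : Vec nx × Vec ns × Vec ny => p.2.1 := by fun_prop
  have m3 : Measurable fun p : Vec nx × Vec ns × Vec ny => p.2.2 := by fun_prop
  have hsrc : IsGaussianSource μ' X' S' Y' :=
    ⟨hX, hS, hY, ⟨by rw [hlaw]; exact h.gaussian.isGaussian_map⟩,
      (hinteg m1).trans h.mean_fst, (hinteg m2).trans h.mean_snd, (hinteg m3).trans h.mean_thd,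
      by rw [hcov m3 m3]; exact h.isUnit⟩
  refine ⟨hsrc, ?_⟩
  obtain ⟨r1, r2, r3⟩ := h.condCov_eq
  obtain ⟨r1', r2', r3'⟩ := hsrc.condCov_eq
  have c11 := hcov m1 m1
  have c12 := hcov m1 m2
  have c13 := hcov m1 m3
  have c22 := hcov m2 m2
  have c23 := hcov m2 m3
  have c33 := hcov m3 m3
  have c31 := hcov m3 m1
  have c32 := hcov m3 m2
  simp only at c11 c12 c13 c22 c23 c33 c31 c32
  exact ⟨by rw [r1, r1', c11, c13, c33, c31], by rw [r2, r2', c12, c13, c33, c32],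
    by rw [r3, r3', c22, c23, c33, c32]⟩

end SameLaw

end Laws

/-! ### The converse -/

section Converse

open Matrix

variable {Ω : Type*} [MeasurableSpace Ω] {μ : Measure Ω}

/-- Pythagoras in `L²`. -/
theorem trace_covMat_le_of_covMat_eq_zero {n : ℕ} {U V : Ω → Vec n} (hU : MemLp U 2 μ)
    (hV : MemLp V 2 μ) (h : covMat μ U V = 0) :
    (covMat μ U U).trace
      ≤ (covMat μ (fun ω => U ω + V ω) (fun ω => U ω + V ω)).trace := by
  have h' : covMat μ V U = 0 := by rw [← covMat_transpose, h, transpose_zero]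
  have hUV : MemLp (fun ω => U ω + V ω) 2 μ := hU.add hV
  rw [covMat_add_left hU hV hUV, covMat_add_right hU hU hV, covMat_add_right hV hU hV, h, h']
  have := (covMat_self_posSemidef hV).trace_nonneg
  simpa using this

theorem covMat_const_right {m n : ℕ} {U : Ω → Vec m} (hU : Integrable U μ)
    (h0 : ∫ ω, U ω ∂μ = 0) (c : Vec n) : covMat μ U (fun _ => c) = 0 := by
  ext i j
  simp only [covMat, of_apply, Matrix.zero_apply]
  rw [integral_mul_const, integral_coord hU, h0]
  simp

/-- If `A` and `T` are conditionally independent given `V`, then `A` is uncorrelated with every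
centered function of `(V, T)` that is independent of `V`. -/
theorem CondLawDrops.covMat_eq_zero [IsProbabilityMeasure μ] {m n : ℕ} {β γ : Type*}
    [MeasurableSpace β] [MeasurableSpace γ] {A : Ω → Vec m} {V : Ω → β} {T : Ω → γ}
    {g : β × γ → Vec n} {u : Ω → Vec n} (h : CondLawDrops μ A V T) (hA : Measurable A)
    (hV : Measurable V) (hT : Measurable T) (hg : Measurable g)
    (hu : u = fun ω => g (V ω, T ω)) (hA2 : MemLp A 2 μ) (hg2 : MemLp u 2 μ)
    (hind : IndepFun u V μ) (h0 : ∫ ω, u ω ∂μ = 0) : covMat μ A u = 0 := by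
  subst hu
  ext i j
  simp only [covMat, of_apply, Matrix.zero_apply]
  have hVT : Measurable fun ω => (V ω, T ω) := hV.prodMk hT
  have hf : Measurable fun q : (β × γ) × Vec m => q.2 i * g q.1 j := by fun_prop
  have hG : StronglyMeasurable fun v => ∫ b, b i ∂(condDistrib A V μ v) :=
    StronglyMeasurable.integral_kernel (f := fun b : Vec m => b i)
      (by fun_prop : Measurable fun b : Vec m => b i).stronglyMeasurable
  have hmap := compProd_map_condDistrib (mβ := inferInstance) (X := fun ω => (V ω, T ω))
    (μ := μ) hA.aemeasurable
  have hi : Integrable (fun q : (β × γ) × Vec m => q.2 i * g q.1 j)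
      ((μ.map fun ω => (V ω, T ω)) ⊗ₘ condDistrib A (fun ω => (V ω, T ω)) μ) := by
    rw [hmap, integrable_map_measure hf.aestronglyMeasurable (by fun_prop)]
    exact integrable_coord_mul hA2 hg2 i j
  calc ∫ ω, A ω i * g (V ω, T ω) j ∂μ
      = ∫ q, q.2 i * g q.1 j
          ∂((μ.map fun ω => (V ω, T ω)) ⊗ₘ condDistrib A (fun ω => (V ω, T ω)) μ) := by
        rw [hmap, integral_map (by fun_prop) hf.aestronglyMeasurable]
    -- The conditional law of `A` given `(V, T)` is replaced by that given `V`. The inner mean is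
    -- then a function of `V`, independent of the centered factor.
    _ = ∫ p, (∫ b, b i ∂(condDistrib A V μ p.1)) * g p j ∂(μ.map fun ω => (V ω, T ω)) := by
        rw [Measure.integral_compProd hi]
        refine integral_congr_ae ?_
        filter_upwards [h] with p hp
        rw [hp, integral_mul_const]
    _ = ∫ ω, (∫ b, b i ∂(condDistrib A V μ (V ω))) * g (V ω, T ω) j ∂μ := by
        rw [integral_map hVT.aemeasurable]
        exact (((hG.measurable.comp measurable_fst).mul
          (by fun_prop : Measurable fun p => g p j))).aestronglyMeasurable
    _ = 0 := by
        have hind' : IndepFun (fun ω => ∫ b, b i ∂(condDistrib A V μ (V ω)))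
            (fun ω => g (V ω, T ω) j) μ :=
          hind.symm.comp (φ := fun v => ∫ b, b i ∂(condDistrib A V μ v))
            (ψ := fun x : Vec n => x j) hG.measurable (by fun_prop)
        rw [hind'.integral_fun_mul_eq_mul_integral (hG.measurable.comp hV).aestronglyMeasurable
          (by fun_prop : Measurable fun ω => g (V ω, T ω) j).aestronglyMeasurable,
          integral_coord (hg2.integrable one_le_two), h0]
        simp

variable [IsProbabilityMeasure μ] {nx ns ny : ℕ} {X : Ω → Vec nx} {S : Ω → Vec ns}
  {Y : Ω → Vec ny}

theorem IsAdmissible.memLp_sub {Xhat : Ω → Vec nx} {Δ : ℝ≥0} (hX : Measurable X)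
    (h : IsAdmissible μ X S Y Xhat Δ) : MemLp (fun ω => X ω - Xhat ω) 2 μ := by
  refine ⟨(hX.sub h.measurable).aestronglyMeasurable, ?_⟩
  rw [eLpNorm_lt_top_iff_lintegral_rpow_enorm_lt_top two_ne_zero ENNReal.ofNat_ne_top]
  refine lt_of_le_of_lt ?_ (h.distortion.trans_lt ENNReal.coe_lt_top)
  simp

/-- The test channel built from the second moments of an admissible reproduction is at least as
good as that reproduction. -/
theorem IsAdmissible.exists_feasible {Xhat : Ω → Vec nx} {Δ : ℝ≥0}
    (hsrc : IsGaussianSource μ X S Y) (h : IsAdmissible μ X S Y Xhat Δ) :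
    ∃ (Sig : Matrix (Fin nx) (Fin nx) ℝ) (H : Matrix (Fin nx) (Fin ns) ℝ)
      (QW : Matrix (Fin nx) (Fin nx) ℝ),
      IsFeasible (condCov μ X X Y) (condCov μ X S Y) (condCov μ S S Y) Sig H QW ∧
      Sig.trace ≤ Δ ∧
      halfLogDetRatio (condCov μ S S Y) (postCovS (condCov μ X X Y) (condCov μ S S Y) Sig H)
        ≤ condMutualInfo μ S Xhat Y := by
  obtain ⟨eQX, eQXS, eQS⟩ := hsrc.condCov_eq_covMat_resid
  obtain ⟨hXm, hSm, hYm, hG, hX0, hS0, hY0, hQ⟩ := hsrc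
  have lV := IsLinearImage.refl (V := fun ω => (X ω, S ω, Y ω))
  have lX := lV.fst
  have lS := lV.snd.fst
  have lY := lV.snd.snd
  simp only at lX lS lY
  set x := resid μ X Y with hx
  set s := resid μ S Y with hs
  have lx : IsLinearImage _ x := lX.resid lY
  have ls : IsLinearImage _ s := lS.resid lY
  have X2 := (lX.hasGaussianLaw hG).memLp_two
  have S2 := (lS.hasGaussianLaw hG).memLp_two
  have Y2 := (lY.hasGaussianLaw hG).memLp_two
  have x2 : MemLp x 2 μ := memLp_resid X2 Y2
  have s2 : MemLp s 2 μ := memLp_resid S2 Y2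
  have xm : Measurable x := measurable_resid hXm hYm
  have sm : Measurable s := measurable_resid hSm hYm
  have x0 : ∫ ω, x ω ∂μ = 0 := integral_resid X2 Y2 hX0 hY0
  have s0 : ∫ ω, s ω ∂μ = 0 := integral_resid S2 Y2 hS0 hY0
  have cxY : covMat μ x Y = 0 := covMat_resid_left_self hQ X2 Y2
  have csY : covMat μ s Y = 0 := covMat_resid_left_self hQ S2 Y2
  set QX := condCov μ X X Y
  set QXS := condCov μ X S Y
  set QS := condCov μ S S Y
  have tr : ∀ {a b : ℕ} {U : Ω → Vec a} {V : Ω → Vec b}, covMat μ U V = 0 → covMat μ V U = 0 :=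
    fun h => by rw [← covMat_transpose, h, transpose_zero]
  -- the part of the source that is independent of the observations
  set K := QXS * pinv QS with hK
  have Ks2 := MemLp.toEuclideanLin K s2
  set u : Ω → Vec nx := fun ω => x ω - toEuclideanLin K (s ω) with hu
  have u2 : MemLp u 2 μ := x2.sub Ks2
  have u0 : ∫ ω, u ω ∂μ = 0 := by
    rw [hu, integral_sub (x2.integrable one_le_two) (Ks2.integrable one_le_two),
      integral_toEuclideanLin _ (s2.integrable one_le_two), x0, s0, map_zero, sub_zero]
  have cul : ∀ {a : ℕ} {U : Ω → Vec a}, MemLp U 2 μ →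
      covMat μ u U = covMat μ x U - K * covMat μ s U := fun hU => by
    rw [hu, covMat_sub_left x2 Ks2 hU, covMat_lin_left _ s2 hU]
  have hKQS : K * QS = QXS := by
    have := covMat_mul_pinv_mul x2 s2
    rwa [← eQXS, ← eQS] at this
  have cus : covMat μ u s = 0 := by rw [cul s2, ← eQXS, ← eQS, hKQS, sub_self]
  have cuY : covMat μ u Y = 0 := by rw [cul Y2, cxY, csY]; simp
  have cuS : covMat μ u S = 0 := by
    rw [show covMat μ u S
      = covMat μ u (fun ω => toEuclideanLin (regCoef μ S Y) (Y ω) + s ω) by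
        rw [hs, ← eq_add_resid],
      covMat_add_right u2 (MemLp.toEuclideanLin _ Y2) s2, covMat_lin_right _ u2 Y2, cuY, cus]
    simp
  have iu : IndepFun u (fun ω => (S ω, Y ω)) μ :=
    (Uncorrelated.prodMk u2 S2 Y2 (.of_covMat u2 S2 cuS) (.of_covMat u2 Y2 cuY)).indepFun
      (((lx.sub (ls.toEuclideanLin K)).prodMk (lS.prodMk lY)).hasGaussianLaw hG) u0
  -- the innovation of the reproduction
  have Xhatm := h.measurable
  have e2 := h.memLp_sub hXm
  have Xhat2 : MemLp Xhat 2 μ := by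
    have := X2.sub e2
    rwa [show (fun ω => X ω) - (fun ω => X ω - Xhat ω) = Xhat by funext ω; simp] at this
  -- The only use of the Markov condition: `u` is a centered function of `((S, Y), X)` independent
  -- of `(S, Y)`.
  have cuXhat : covMat μ Xhat u = 0 := by
    have h1 := measurable_toEuclideanLin (regCoef μ X Y)
    have h2 := measurable_toEuclideanLin (regCoef μ S Y)
    have h3 := measurable_toEuclideanLin K
    exact h.markov.covMat_eq_zero (g := fun q => (q.2 - toEuclideanLin (regCoef μ X Y) q.1.2)
      - toEuclideanLin K (q.1.1 - toEuclideanLin (regCoef μ S Y) q.1.2)) Xhatm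
      (hSm.prodMk hYm) hXm (by fun_prop) (by rw [hu, hx, hs]; rfl) Xhat2 u2 iu u0
  -- An admissible reproduction need not be centered.
  set c := ∫ ω, Xhat ω ∂μ with hc
  have c2 : MemLp (fun _ : Ω => c) 2 μ := memLp_const c
  have hXc2 : MemLp (fun ω => Xhat ω - c) 2 μ := Xhat2.sub c2
  set z := resid μ (fun ω => Xhat ω - c) Y with hz
  set L := regCoef μ (fun ω => Xhat ω - c) Y with hL
  have z2 : MemLp z 2 μ := memLp_resid hXc2 Y2
  have zm : Measurable z := measurable_resid (Xhatm.sub_const c) hYm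
  have z0 : ∫ ω, z ω ∂μ = 0 := integral_resid hXc2 Y2 (by
    rw [integral_sub (Xhat2.integrable one_le_two) (integrable_const c)]; simp [hc]) hY0
  have czY : covMat μ z Y = 0 := covMat_resid_left_self hQ hXc2 Y2
  have cuz : covMat μ u z = 0 := by
    rw [hz]; unfold resid
    rw [covMat_sub_right u2 hXc2 (MemLp.toEuclideanLin _ Y2), covMat_lin_right _ u2 Y2, cuY,
      covMat_sub_right u2 Xhat2 c2, tr cuXhat,
      covMat_const_right (u2.integrable one_le_two) u0]
    simp
  obtain ⟨Kz, hKzQS⟩ : ∃ Kz, Kz * QS = covMat μ z s := ⟨covMat μ z s * pinv QS, by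
    have := covMat_mul_pinv_mul z2 s2
    rwa [← eQS] at this⟩
  have hQST : QSᵀ = QS := PosSemidef.transpose_eq (eQS ▸ covMat_self_posSemidef s2)
  have csz : covMat μ s z = QS * Kzᵀ := by
    rw [← covMat_transpose z s, ← hKzQS, transpose_mul, hQST]
  -- Since `u` is uncorrelated with `z`, the correlation of `x` with `z` passes entirely through
  -- `s`.
  have cxz : covMat μ x z = QXS * Kzᵀ := by
    have := cul z2
    rw [cuz, eq_comm, sub_eq_zero] at this
    rw [this, csz, ← Matrix.mul_assoc, hKQS]
  -- `P z` is the best linear estimate of `x` from `z`. Replacing `z` by it supplies the identity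
  -- `E[x (P z)ᵀ] = E[(P z)(P z)ᵀ]` demanded of a feasible channel.
  obtain ⟨P, hPQ⟩ : ∃ P, P * covMat μ z z = covMat μ x z := ⟨_, covMat_mul_pinv_mul x2 z2⟩
  -- the modified reproduction
  obtain ⟨H, hH⟩ : ∃ H, H = P * Kz := ⟨_, rfl⟩
  obtain ⟨M, hM⟩ : ∃ M, M = P * covMat μ z z * Pᵀ := ⟨_, rfl⟩
  have Pz2 := MemLp.toEuclideanLin P z2
  have Hs2 := MemLp.toEuclideanLin H s2
  have cPP : covMat μ (fun ω => toEuclideanLin P (z ω)) (fun ω => toEuclideanLin P (z ω)) = M := by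
    rw [covMat_lin_left _ z2 Pz2, covMat_lin_right _ z2 z2, hM, Matrix.mul_assoc]
  have csP : covMat μ s (fun ω => toEuclideanLin P (z ω)) = QS * Hᵀ := by
    rw [covMat_lin_right _ s2 z2, csz, hH, transpose_mul, Matrix.mul_assoc]
  have cxP : covMat μ x (fun ω => toEuclideanLin P (z ω)) = M := by
    rw [covMat_lin_right _ x2 z2, ← hPQ, hM]
  have hMpsd : M.PosSemidef := cPP ▸ covMat_self_posSemidef Pz2
  have hMT : Mᵀ = M := PosSemidef.transpose_eq hMpsd
  have hgainT : QXS * Hᵀ = M := by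
    rw [hH, transpose_mul, ← Matrix.mul_assoc, ← cxz, ← hPQ, hM]
  have hgain : H * QXSᵀ = M := by rw [← hMT, ← hgainT, transpose_mul, transpose_transpose]
  have d2 : MemLp (fun ω => x ω - toEuclideanLin P (z ω)) 2 μ := x2.sub Pz2
  have w2 : MemLp (fun ω => toEuclideanLin P (z ω) - toEuclideanLin H (s ω)) 2 μ := Pz2.sub Hs2
  have cdz : covMat μ (fun ω => x ω - toEuclideanLin P (z ω)) z = 0 := by
    rw [covMat_sub_left x2 Pz2 z2, covMat_lin_left _ z2 z2, hPQ, sub_self]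
  have cdd : covMat μ (fun ω => x ω - toEuclideanLin P (z ω))
      (fun ω => x ω - toEuclideanLin P (z ω)) = QX - M := by
    rw [covMat_sub_right d2 x2 Pz2, covMat_lin_right _ d2 z2, cdz, Matrix.zero_mul, sub_zero,
      covMat_sub_left x2 Pz2 x2, ← eQX, ← covMat_transpose x, cxP, hMT]
  -- `H s` is the regression of `P z` on `s`, so the required noise covariance is that of the
  -- regression error, hence positive semidefinite.
  have cww : covMat μ (fun ω => toEuclideanLin P (z ω) - toEuclideanLin H (s ω))
      (fun ω => toEuclideanLin P (z ω) - toEuclideanLin H (s ω)) = M - H * QS * Hᵀ := by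
    rw [covMat_sub_left Pz2 Hs2 w2, covMat_sub_right Pz2 Pz2 Hs2, cPP, covMat_lin_right _ Pz2 s2,
      ← covMat_transpose s, csP, covMat_lin_left _ s2 w2, covMat_sub_right s2 Pz2 Hs2, csP,
      covMat_lin_right _ s2 s2, ← eQS, sub_self, Matrix.mul_zero, sub_zero, transpose_mul,
      transpose_transpose, hQST]
  refine ⟨QX - M, H, M - H * QS * Hᵀ, ⟨cdd ▸ covMat_self_posSemidef d2, ?_, ?_, ?_, ?_,
    cww ▸ covMat_self_posSemidef w2⟩, ?_, ?_⟩
  · rw [hgain, sub_sub_cancel]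
  · rw [hgain, hgainT]
  · rwa [hgain]
  · rw [hgain]
  -- Two orthogonal decompositions: `x - P z` is orthogonal to `P z - z`, and `x - z` is orthogonal
  -- to the affine function of `Y` by which it differs from `X - Xhat`.
  · have xz2 : MemLp (fun ω => x ω - z ω) 2 μ := x2.sub z2
    have t2 : MemLp (fun ω => toEuclideanLin P (z ω) - z ω) 2 μ := Pz2.sub z2
    have h1 := trace_covMat_le_of_covMat_eq_zero d2 t2 (by
      rw [covMat_sub_right d2 Pz2 z2, covMat_lin_right _ d2 z2, cdz]; simp)
    simp only [sub_add_sub_cancel] at h1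
    have R2 := MemLp.toEuclideanLin (regCoef μ X Y - L) Y2
    have cxzY : covMat μ (fun ω => x ω - z ω) Y = 0 := by
      rw [covMat_sub_left x2 z2 Y2, cxY, czY, sub_zero]
    have r2 : MemLp (fun ω => toEuclideanLin (regCoef μ X Y - L) (Y ω) - c) 2 μ := R2.sub c2
    have h2 := trace_covMat_le_of_covMat_eq_zero xz2 r2 (by
      rw [covMat_sub_right xz2 R2 c2, covMat_lin_right _ xz2 Y2, cxzY,
        covMat_const_right (xz2.integrable one_le_two) (by
          rw [integral_sub (x2.integrable one_le_two) (z2.integrable one_le_two), x0, z0,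
            sub_zero])]
      simp)
    have he : (fun ω => x ω - z ω + (toEuclideanLin (regCoef μ X Y - L) (Y ω) - c))
        = fun ω => X ω - Xhat ω := by
      funext ω
      simp only [hx, hz, resid, ← hL, map_sub, LinearMap.sub_apply]
      abel
    rw [he] at h2
    have h3 : (covMat μ (fun ω => X ω - Xhat ω) (fun ω => X ω - Xhat ω)).trace ≤ Δ := by
      rw [← ENNReal.ofReal_le_coe, ← lintegral_enorm_sq_eq_trace e2]
      exact h.distortion
    rw [← cdd]
    exact h1.trans (h2.trans h3)
  -- `P z` has the same second moments with `s` as the new channel, so estimating `s` from it gives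
  -- error covariance `postCovS`. As `P z` is a function of `(Y, Xhat)`, the Gaussian lower bound
  -- applies to the original `Xhat`.
  · obtain ⟨-, cvv, hpsd⟩ := covMat_sub_estimate (QX := QX) (Sig := QX - M) s2 Pz2 eQS.symm csP
      (by rw [cPP, sub_sub_cancel]) rfl
    refine halfLogDetRatio_le_condMutualInfo (s := s)
      (F := fun y => toEuclideanLin (regCoef μ S Y) y)
      (r := fun p : Vec ny × Vec nx => toEuclideanLin (QS * Hᵀ * pinv (QX - (QX - M)))
        (toEuclideanLin P (p.2 - c - toEuclideanLin L p.1)))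
      Xhatm hYm sm (measurable_toEuclideanLin _) ?_ eq_add_resid
      (indepFun_resid hQ ((lS.prodMk lY).hasGaussianLaw hG) hS0 hY0) (ls.hasGaussianLaw hG) s0
      (MemLp.toEuclideanLin _ Pz2) eQS.symm cvv hpsd
    have h1 := measurable_toEuclideanLin L
    have h2 := measurable_toEuclideanLin P
    have h3 := measurable_toEuclideanLin (QS * Hᵀ * pinv (QX - (QX - M)))
    fun_prop

end Converse

/-! ### Optimal test channels -/

section Minimizer

open Matrix

theorem isClosed_setOf_posSemidef {n : ℕ} :
    IsClosed {A : Matrix (Fin n) (Fin n) ℝ | A.PosSemidef} := by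
  simp only [posSemidef_iff_dotProduct_mulVec, Set.ofPred_and, Set.ofPred_forall]
  refine IsClosed.inter ?_ (isClosed_iInter fun x => ?_)
  · exact isClosed_eq (by fun_prop) continuous_id
  · exact isClosed_le continuous_const (by fun_prop)

variable {nx ns : ℕ} {QX : Matrix (Fin nx) (Fin nx) ℝ} {QXS : Matrix (Fin nx) (Fin ns) ℝ}
  {QS : Matrix (Fin ns) (Fin ns) ℝ}

theorem IsFeasible.sub_sub_posSemidef {Sig QW : Matrix (Fin nx) (Fin nx) ℝ}
    {H : Matrix (Fin nx) (Fin ns) ℝ} (hQS : QS.PosSemidef) (h : IsFeasible QX QXS QS Sig H QW) :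
    (QX - Sig - QW).PosSemidef := by
  rw [← h.gain, h.noise, sub_sub_cancel]
  exact PosSemidef.conj_transpose hQS H

/-- Gains with rows in the range of `QS`, for feasible parameters of distortion at most `Δ`. -/
def reducedGains (QX : Matrix (Fin nx) (Fin nx) ℝ) (QXS : Matrix (Fin nx) (Fin ns) ℝ)
    (QS : Matrix (Fin ns) (Fin ns) ℝ) (Δ : ℝ) : Set (Matrix (Fin nx) (Fin ns) ℝ) :=
  {H | IsFeasible QX QXS QS (QX - H * QXSᵀ) H (H * QXSᵀ - H * QS * Hᵀ) ∧
    (QX - H * QXSᵀ).trace ≤ Δ ∧ H * QS * pinv QS = H}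

theorem isClosed_reducedGains (Δ : ℝ) : IsClosed (reducedGains QX QXS QS Δ) := by
  have h : reducedGains QX QXS QS Δ =
      {H | (QX - H * QXSᵀ).PosSemidef} ∩ {H | H * QXSᵀ = QXS * Hᵀ} ∩ {H | (H * QXSᵀ).PosSemidef} ∩
      {H | (H * QXSᵀ - H * QS * Hᵀ).PosSemidef} ∩ {H | (QX - H * QXSᵀ).trace ≤ Δ} ∩
      {H | H * QS * pinv QS = H} := by
    ext H
    constructor
    · rintro ⟨⟨h1, -, h2, h3, -, h4⟩, h5, h6⟩
      exact ⟨⟨⟨⟨⟨h1, h2⟩, h3⟩, h4⟩, h5⟩, h6⟩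
    · rintro ⟨⟨⟨⟨⟨h1, h2⟩, h3⟩, h4⟩, h5⟩, h6⟩
      exact ⟨⟨h1, (sub_sub_cancel _ _).symm, h2, h3, rfl, h4⟩, h5, h6⟩
  rw [h]
  refine (((((isClosed_setOf_posSemidef.preimage ?_).inter (isClosed_eq ?_ ?_)).inter
    (isClosed_setOf_posSemidef.preimage ?_)).inter (isClosed_setOf_posSemidef.preimage ?_)).inter
    (isClosed_le ?_ continuous_const)).inter (isClosed_eq ?_ continuous_id)
  all_goals fun_prop

/-- With `QS = Bᵀ B`, the constraints bound `H Bᵀ`, not `H` itself. The range condition recovers `H`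
as `(H Bᵀ)(B QS†)`, placing the closed set inside the continuous image of a box. -/
theorem isCompact_reducedGains (hQS : QS.PosSemidef) (Δ : ℝ) :
    IsCompact (reducedGains QX QXS QS Δ) := by
  obtain ⟨B, hB⟩ := PosSemidef.exists_eq_transpose_mul hQS
  have hbox : IsCompact {N : Matrix (Fin nx) (Fin ns) ℝ |
      ∀ i j, N i j ∈ Set.Icc (-√QX.trace) (√QX.trace)} := by
    have := isCompact_univ_pi (X := fun _ : Fin nx => Fin ns → ℝ)
      (s := fun _ => Set.univ.pi fun _ => Set.Icc (-√QX.trace) (√QX.trace))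
      fun _ => isCompact_univ_pi fun _ => isCompact_Icc
    simp only [Set.pi, Set.mem_univ, true_imp_iff, Set.mem_ofPred_eq] at this
    exact this
  refine (hbox.image (f := fun N => N * (B * pinv QS)) (by fun_prop)).of_isClosed_subset
    (isClosed_reducedGains Δ) ?_
  rintro H ⟨hf, -, hH⟩
  refine ⟨H * Bᵀ, fun i j => ?_, ?_⟩
  · refine abs_le.mp (Real.abs_le_sqrt ?_)
    have h1 : (H * Bᵀ) * (H * Bᵀ)ᵀ = H * QS * Hᵀ := by
      rw [hB, transpose_mul, transpose_transpose]; simp only [Matrix.mul_assoc]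
    have h2 : (H * Bᵀ) i j ^ 2 ≤ ((H * Bᵀ) * (H * Bᵀ)ᵀ).trace := by
      simp only [trace, diag, mul_apply (M := H * Bᵀ), transpose_apply]
      refine le_trans ?_ (Finset.single_le_sum (f := fun i => ∑ j, (H * Bᵀ) i j * (H * Bᵀ) i j)
        (fun i _ => Finset.sum_nonneg fun j _ => mul_self_nonneg _) (Finset.mem_univ i))
      rw [sq]
      exact Finset.single_le_sum (f := fun j => (H * Bᵀ) i j * (H * Bᵀ) i j)
        (fun j _ => mul_self_nonneg _) (Finset.mem_univ j)
    -- `tr (H QS Hᵀ) ≤ tr (H QXSᵀ) ≤ tr QX`, from positivity of the noise and of the distortion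
    -- matrix.
    have h3 := hf.sig_psd.trace_nonneg
    have h4 := hf.noise_psd.trace_nonneg
    rw [trace_sub] at h3 h4
    rw [h1] at h2
    linarith
  · change H * Bᵀ * (B * pinv QS) = H
    rw [← Matrix.mul_assoc, Matrix.mul_assoc H, ← hB, hH]

/-- For each `ε > 0` both determinants are positive, so each term is continuous; a supremum of
continuous functions is lower semicontinuous. -/
theorem lowerSemicontinuousOn_regLogDetRatio {E : Type*} [TopologicalSpace E] {s : Set E} {n : ℕ}
    {A B : E → Matrix (Fin n) (Fin n) ℝ} (hA : Continuous A) (hB : Continuous B)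
    (hApsd : ∀ x ∈ s, (A x).PosSemidef) (hBpsd : ∀ x ∈ s, (B x).PosSemidef) :
    LowerSemicontinuousOn (fun x => regLogDetRatio (A x) (B x)) s := by
  refine lowerSemicontinuousOn_biSup fun ε hε => ContinuousOn.lowerSemicontinuousOn ?_
  refine ENNReal.continuous_ofReal.comp_continuousOn (continuousOn_const.mul
    (ContinuousOn.log (ContinuousOn.div ?_ ?_ ?_) ?_))
  · exact Continuous.continuousOn (by fun_prop)
  · exact Continuous.continuousOn (by fun_prop)
  · exact fun x hx => (PosSemidef.add_smul_one_posDef (hBpsd x hx) hε).det_pos.ne'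
  · exact fun x hx => (div_pos (PosSemidef.add_smul_one_posDef (hApsd x hx) hε).det_pos
      (PosSemidef.add_smul_one_posDef (hBpsd x hx) hε).det_pos).ne'

/-- The rows of `QXS` lie in the range of `QS`, so projecting the rows of `H` onto that range
changes neither `H QXSᵀ` nor `H QS Hᵀ`. The triple keeps its `Sig` and `QW`, hence its rate. -/
theorem IsFeasible.mul_mem_reducedGains (hQS : QS.PosSemidef) (hQXS : QXS * pinv QS * QS = QXS)
    {Sig QW : Matrix (Fin nx) (Fin nx) ℝ} {H : Matrix (Fin nx) (Fin ns) ℝ} {Δ : ℝ}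
    (h : IsFeasible QX QXS QS Sig H QW) (hΔ : Sig.trace ≤ Δ) :
    H * QS * pinv QS ∈ reducedGains QX QXS QS Δ ∧ H * QS * pinv QS * QXSᵀ = QX - Sig ∧
      H * QS * pinv QS * QXSᵀ - H * QS * pinv QS * QS * (H * QS * pinv QS)ᵀ = QW := by
  have hp := isPseudoinverse_pinv hQS.isHermitian
  have hT := PosSemidef.transpose_eq hQS
  have hpT := PosSemidef.transpose_pinv hQS
  have h1 : H * QS * pinv QS * QXSᵀ = H * QXSᵀ := by
    conv_rhs => rw [← hQXS]
    rw [transpose_mul, transpose_mul, hT, hpT]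
    simp only [Matrix.mul_assoc]
  have h2 : H * QS * pinv QS * QS * (H * QS * pinv QS)ᵀ = H * QS * Hᵀ := by
    have e1 : H * QS * pinv QS * QS = H * QS := by
      rw [Matrix.mul_assoc H, Matrix.mul_assoc H, hp.mul_mul_left]
    rw [e1, transpose_mul, transpose_mul, hT, hpT, ← Matrix.mul_assoc, ← Matrix.mul_assoc, e1]
  have h3 : QX - H * QXSᵀ = Sig := by rw [h.gain, sub_sub_cancel]
  refine ⟨⟨?_, ?_, ?_⟩, by rw [h1, h.gain], by rw [h1, h2, h.noise]⟩
  · rw [h1, h2, h3, ← h.noise]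
    refine ⟨h.sig_psd, by rw [h1, h.gain], ?_, by rw [h1]; exact h.gain_psd,
      by rw [h1, h2, h.noise], h.noise_psd⟩
    have := congrArg transpose h1
    rw [h1, h.gain_symm]
    simpa [transpose_mul] using this.symm
  · rw [h1, h3]; exact hΔ
  · rw [Matrix.mul_assoc H, Matrix.mul_assoc H, hp.mul_mul_left, Matrix.mul_assoc]

/-- The rate is minimized by some feasible parameters. -/
theorem exists_feasible_minimizer (hQS : QS.PosSemidef) (hQXS : QXS * pinv QS * QS = QXS) {Δ : ℝ}
    (hne : ∃ Sig H QW, IsFeasible QX QXS QS Sig H QW ∧ Sig.trace ≤ Δ) :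
    ∃ Sig H QW, IsFeasible QX QXS QS Sig H QW ∧ Sig.trace ≤ Δ ∧
      ∀ Sig' H' QW', IsFeasible QX QXS QS Sig' H' QW' → Sig'.trace ≤ Δ →
        halfLogDetRatio (QX - Sig) QW ≤ halfLogDetRatio (QX - Sig') QW' := by
  have hrate : ∀ {Sig H QW}, IsFeasible QX QXS QS Sig H QW →
      halfLogDetRatio (QX - Sig) QW = regLogDetRatio (QX - Sig) QW := fun hf =>
    halfLogDetRatio_eq_regLogDetRatio hf.noise_psd (hf.sub_sub_posSemidef hQS)
  obtain ⟨H, hH, hmin⟩ := LowerSemicontinuousOn.exists_isMinOn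
    (s := reducedGains QX QXS QS Δ) (by
      obtain ⟨Sig, H, QW, hf, hΔ⟩ := hne
      exact ⟨_, (hf.mul_mem_reducedGains hQS hQXS hΔ).1⟩) (isCompact_reducedGains hQS Δ)
    (lowerSemicontinuousOn_regLogDetRatio (A := fun H => H * QXSᵀ)
      (B := fun H => H * QXSᵀ - H * QS * Hᵀ) (by fun_prop) (by fun_prop)
      (fun H hH => hH.1.gain_psd) fun H hH => hH.1.noise_psd)
  refine ⟨_, H, _, hH.1, hH.2.1, fun Sig' H' QW' hf hΔ => ?_⟩
  obtain ⟨hmem, e1, e2⟩ := hf.mul_mem_reducedGains hQS hQXS hΔ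
  rw [hrate hH.1, hrate hf, ← e1, ← e2, sub_sub_cancel]
  exact hmin hmem

end Minimizer

/-! ### Realizations on product spaces and bounds for the rate distortion function. -/

section Existence

open Matrix

theorem isCenteredGaussian_snd_prod {E : Type*} [MeasurableSpace E] {P : Measure E}
    [IsProbabilityMeasure P] {n : ℕ} {Q : Matrix (Fin n) (Fin n) ℝ} (hQ : Q.PosSemidef) :
    IsCenteredGaussian (P.prod (multivariateGaussian 0 Q)) (fun q => q.2) Q := by
  have hmap : (P.prod (multivariateGaussian 0 Q)).map (fun q => q.2) = multivariateGaussian 0 Q :=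
    (Measure.map_snd_prod).trans (by simp)
  have hm : Measurable fun q : E × Vec n => q.2 := measurable_snd
  have hmean : ∫ x, x ∂(multivariateGaussian (0 : Vec n) Q) = 0 := integral_id_multivariateGaussian
  refine ⟨hm, ⟨by rw [hmap]; infer_instance⟩, ?_, ?_⟩
  · have := integral_map (μ := P.prod (multivariateGaussian 0 Q)) (f := fun x : Vec n => x)
      hm.aemeasurable (by fun_prop)
    rw [← this, hmap, hmean]
  · have := covMat_of_map (μ := P.prod (multivariateGaussian 0 Q)) (f := fun x : Vec n => x)
      (g := fun x : Vec n => x) hm (by fun_prop) (by fun_prop)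
    rw [← this, hmap]
    have h2 : MemLp (fun x : Vec n => x) 2 (multivariateGaussian 0 Q) := IsGaussian.memLp_two_id
    ext i j
    have := covariance_eval_multivariateGaussian (μ := (0 : Vec n)) hQ i j
    rw [covariance_eq_sub (MemLp.coord h2 i) (MemLp.coord h2 j),
      integral_coord (h2.integrable one_le_two), hmean] at this
    simpa [covMat] using this

variable {Ω : Type*} [MeasurableSpace Ω] {μ : Measure Ω} [IsProbabilityMeasure μ]
  {nx ns ny : ℕ} {X : Ω → Vec nx} {S : Ω → Vec ns} {Y : Ω → Vec ny}

/-- Feasible parameters have a realization on some probability space. -/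
theorem IsGaussianSource.exists_isRealization (hsrc : IsGaussianSource μ X S Y)
    {Sig QW : Matrix (Fin nx) (Fin nx) ℝ} {H : Matrix (Fin nx) (Fin ns) ℝ}
    (hf : IsFeasible (condCov μ X X Y) (condCov μ X S Y) (condCov μ S S Y) Sig H QW) :
    ∃ (Ω' : Type) (_ : MeasurableSpace Ω') (μ' : Measure Ω') (_ : IsProbabilityMeasure μ')
      (X' : Ω' → Vec nx) (S' : Ω' → Vec ns) (Y' : Ω' → Vec ny) (W' : Ω' → Vec nx),
      Measurable X' ∧ Measurable S' ∧ Measurable Y' ∧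
      (μ'.map fun ω => (X' ω, S' ω, Y' ω)) = (μ.map fun ω => (X ω, S ω, Y ω)) ∧
      IsCenteredGaussian μ' W' QW ∧ IndepFun W' (fun ω => (X' ω, S' ω, Y' ω)) μ' ∧
      condCov μ' X' X' Y' = condCov μ X X Y ∧ condCov μ' S' S' Y' = condCov μ S S Y ∧
      IsRealization μ' X' S' Y' Sig H QW W' (realization μ' X' S' Y' H W') := by
  have hV : Measurable fun ω => (X ω, S ω, Y ω) :=
    hsrc.measurable_fst.prodMk (hsrc.measurable_snd.prodMk hsrc.measurable_thd)
  have := Measure.isProbabilityMeasure_map (μ := μ) hV.aemeasurable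
  set P := μ.map fun ω => (X ω, S ω, Y ω) with hP
  have hlaw : ((P.prod (multivariateGaussian (0 : Vec nx) QW)).map
      fun q => (q.1.1, q.1.2.1, q.1.2.2)) = P := (Measure.map_fst_prod).trans (by simp)
  have h1 : Measurable fun q : (Vec nx × Vec ns × Vec ny) × Vec nx => q.1.1 := by fun_prop
  have h2 : Measurable fun q : (Vec nx × Vec ns × Vec ny) × Vec nx => q.1.2.1 := by fun_prop
  have h3 : Measurable fun q : (Vec nx × Vec ns × Vec ny) × Vec nx => q.1.2.2 := by fun_prop
  obtain ⟨hsrc', c1, c2, c3⟩ := hsrc.congr_law h1 h2 h3 hlaw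
  have hW := isCenteredGaussian_snd_prod (P := P) hf.noise_psd
  have hind : IndepFun (fun q : (Vec nx × Vec ns × Vec ny) × Vec nx => q.2)
      (fun q => (q.1.1, q.1.2.1, q.1.2.2)) (P.prod (multivariateGaussian (0 : Vec nx) QW)) :=
    (indepFun_prod (X := id) (Y := id) measurable_id measurable_id).symm
  rw [← c1, ← c2, ← c3] at hf
  exact ⟨_, inferInstance, _, inferInstance, _, _, _, _, h1, h2, h3, hlaw, hW, hind, c1, c3,
    isRealization_realization hsrc' hf hW hind⟩

theorem IsRealization.isAdmissible {Sig QW : Matrix (Fin nx) (Fin nx) ℝ}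
    {H : Matrix (Fin nx) (Fin ns) ℝ} {W Xhat : Ω → Vec nx} {Δ : ℝ≥0}
    (h : IsRealization μ X S Y Sig H QW W Xhat) (hΔ : Sig.trace ≤ Δ) :
    IsAdmissible μ X S Y Xhat Δ :=
  ⟨h.measurable, h.drops_source, by rw [h.distortion]; exact ENNReal.ofReal_le_coe.mpr hΔ⟩

/-- Both expressions of the rate of feasible parameters agree, and they bound the rate distortion
function from above. -/
theorem IsGaussianSource.rdf_le_halfLogDetRatio (hsrc : IsGaussianSource μ X S Y)
    {Sig QW : Matrix (Fin nx) (Fin nx) ℝ} {H : Matrix (Fin nx) (Fin ns) ℝ} {Δ : ℝ≥0}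
    (hf : IsFeasible (condCov μ X X Y) (condCov μ X S Y) (condCov μ S S Y) Sig H QW)
    (hΔ : Sig.trace ≤ Δ) :
    rdf (μ.map fun ω => (X ω, S ω, Y ω)) Δ ≤ halfLogDetRatio (condCov μ X X Y - Sig) QW ∧
      halfLogDetRatio (condCov μ S S Y) (postCovS (condCov μ X X Y) (condCov μ S S Y) Sig H)
        = halfLogDetRatio (condCov μ X X Y - Sig) QW ∧
      (postCovS (condCov μ X X Y) (condCov μ S S Y) Sig H).PosSemidef ∧
      (condCov μ S S Y - postCovS (condCov μ X X Y) (condCov μ S S Y) Sig H).PosSemidef := by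
  obtain ⟨Ω', _, μ', _, X', S', Y', W', h1, h2, h3, hlaw, -, -, c1, c3, hR⟩ :=
    hsrc.exists_isRealization hf
  rw [← c1, ← c3, ← hlaw]
  exact ⟨((hR.isAdmissible hΔ).rdf_le h1 h2 h3).trans_eq hR.rate_reproduction,
    hR.rate_source.symm.trans hR.rate_reproduction, hR.postCov_psd, hR.sub_postCov_psd⟩

/-- The converse is run on the space of quadruples with its coordinate projections, and the
conditional covariances are transported by `IsGaussianSource.congr_law`. -/
theorem IsGaussianSource.exists_feasible_of_mem_admissibleLaws (hsrc : IsGaussianSource μ X S Y)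
    {Δ : ℝ≥0} {ν : ProbabilityMeasure ((Vec nx × Vec ns × Vec ny) × Vec nx)}
    (hν : ν ∈ admissibleLaws (μ.map fun ω => (X ω, S ω, Y ω)) Δ) :
    ∃ (Sig : Matrix (Fin nx) (Fin nx) ℝ) (H : Matrix (Fin nx) (Fin ns) ℝ)
      (QW : Matrix (Fin nx) (Fin nx) ℝ),
      IsFeasible (condCov μ X X Y) (condCov μ X S Y) (condCov μ S S Y) Sig H QW ∧
      Sig.trace ≤ Δ ∧
      halfLogDetRatio (condCov μ S S Y) (postCovS (condCov μ X X Y) (condCov μ S S Y) Sig H)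
        ≤ condMutualInfo (ν : Measure ((Vec nx × Vec ns × Vec ny) × Vec nx))
          (fun q => q.1.2.1) (fun q => q.2) (fun q => q.1.2.2) := by
  obtain ⟨hsrc', c1, c2, c3⟩ := hsrc.congr_law
    (μ' := (ν : Measure ((Vec nx × Vec ns × Vec ny) × Vec nx))) (X' := fun q => q.1.1)
    (S' := fun q => q.1.2.1) (Y' := fun q => q.1.2.2) (by fun_prop) (by fun_prop) (by fun_prop) hν.1
  rw [← c1, ← c2, ← c3]
  exact hν.2.exists_feasible hsrc'

end Existence

end RemoteRDF

end

open RemoteRDF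
theorem theorem4 {nx ns ny : ℕ} {Ω : Type*} [MeasurableSpace Ω]
    (μ : Measure Ω) [IsProbabilityMeasure μ]
    (X : Ω → Vec nx) (S : Ω → Vec ns) (Y : Ω → Vec ny)
    (hX : Measurable X) (hS : Measurable S) (hY : Measurable Y)
    -- `(X, S, Y)` is a centered jointly Gaussian triple with invertible `Q_Y`
    (hG : HasGaussianLaw (fun ω => (X ω, S ω, Y ω)) μ)
    (hX0 : ∫ ω, X ω ∂μ = 0) (hS0 : ∫ ω, S ω ∂μ = 0) (hY0 : ∫ ω, Y ω ∂μ = 0)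
    (hQY : IsUnit (covMat μ Y Y))
    -- the matrices `Q_{X|Y}`, `Q_{X,S|Y}`, `Q_{S|Y}`
    (QX : Matrix (Fin nx) (Fin nx) ℝ) (hQX : QX = condCov μ X X Y)
    (QXS : Matrix (Fin nx) (Fin ns) ℝ) (hQXS : QXS = condCov μ X S Y)
    (QS : Matrix (Fin ns) (Fin ns) ℝ) (hQS : QS = condCov μ S S Y)
    (Δ : ℝ≥0) :
    (QX.PosSemidef ∧ QS.PosSemidef ∧
      QXS = covMat μ X S - covMat μ X Y * (covMat μ Y Y)⁻¹ * covMat μ Y S) ∧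
    -- (a) the realization determined by `(Σ, H, Q_W)` and its structural properties
    (∀ (Sig : Matrix (Fin nx) (Fin nx) ℝ) (H : Matrix (Fin nx) (Fin ns) ℝ)
        (QW : Matrix (Fin nx) (Fin nx) ℝ), IsFeasible QX QXS QS Sig H QW →
      ∀ W : Ω → Vec nx, IsCenteredGaussian μ W QW →
        IndepFun W (fun ω => (X ω, S ω, Y ω)) μ →
      ∀ Xhat : Ω → Vec nx, Xhat = realization μ X S Y H W →
        (Xhat =ᵐ[μ] fun ω => Matrix.toEuclideanLin H (S ω) + cexp μ X Y ω
          - Matrix.toEuclideanLin H (cexp μ S Y ω) + W ω) ∧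
        covMat μ (fun ω => X ω - Xhat ω) (fun ω => X ω - Xhat ω) = Sig ∧
        -- (i)
        CondLawDrops μ X Xhat Y ∧
        -- (ii)
        CondLawDrops μ Xhat (fun ω => (S ω, Y ω)) X ∧
        CondLawDrops μ X (fun ω => (S ω, Y ω)) Xhat ∧
        -- (iii)
        cexp μ X (fun ω => (Xhat ω, Y ω)) =ᵐ[μ] Xhat ∧
        cexp μ X Xhat =ᵐ[μ] Xhat ∧
        cexp μ X Y =ᵐ[μ] cexp μ Xhat Y ∧
        -- the conditional covariances
        condCov μ S S (fun ω => (Xhat ω, Y ω)) = postCovS QX QS Sig H ∧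
        condCov μ Xhat Xhat Y = H * QS * Hᵀ + QW ∧
        condCov μ Xhat Xhat Y = QX - Sig ∧
        -- admissibility and rate
        (Sig.trace ≤ Δ → IsAdmissible μ X S Y Xhat Δ) ∧
        condMutualInfo μ S Xhat Y = halfLogDetRatio QS (postCovS QX QS Sig H) ∧
        condMutualInfo μ S Xhat Y = halfLogDetRatio (QX - Sig) QW) ∧
    -- (b) the two characterizations of the RDF
    rdf (μ.map fun ω => (X ω, S ω, Y ω)) Δ =
      (⨅ (Sig : Matrix (Fin nx) (Fin nx) ℝ) (H : Matrix (Fin nx) (Fin ns) ℝ)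
        (QW : Matrix (Fin nx) (Fin nx) ℝ) (_ : IsFeasible QX QXS QS Sig H QW)
        (_ : Sig.trace ≤ Δ)
        (_ : (postCovS QX QS Sig H).PosSemidef ∧ (QS - postCovS QX QS Sig H).PosSemidef),
        halfLogDetRatio QS (postCovS QX QS Sig H)) ∧
    rdf (μ.map fun ω => (X ω, S ω, Y ω)) Δ =
      (⨅ (Sig : Matrix (Fin nx) (Fin nx) ℝ) (H : Matrix (Fin nx) (Fin ns) ℝ)
        (QW : Matrix (Fin nx) (Fin nx) ℝ) (_ : IsFeasible QX QXS QS Sig H QW)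
        (_ : Sig.trace ≤ Δ) (_ : (QX - Sig - QW).PosSemidef),
        halfLogDetRatio (QX - Sig) QW) ∧
    -- no admissible reproduction on `Ω` has a rate below the RDF
    (∀ Xhat : Ω → Vec nx, IsAdmissible μ X S Y Xhat Δ →
      rdf (μ.map fun ω => (X ω, S ω, Y ω)) Δ ≤ condMutualInfo μ S Xhat Y) ∧
    -- the RDF is achieved by a realization as in (a), as soon as some reproduction is admissible
    ((admissibleLaws (μ.map fun ω => (X ω, S ω, Y ω)) Δ).Nonempty →
      ∃ (Sig : Matrix (Fin nx) (Fin nx) ℝ) (H : Matrix (Fin nx) (Fin ns) ℝ)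
        (QW : Matrix (Fin nx) (Fin nx) ℝ),
        IsFeasible QX QXS QS Sig H QW ∧ Sig.trace ≤ Δ ∧
        halfLogDetRatio QS (postCovS QX QS Sig H) =
          rdf (μ.map fun ω => (X ω, S ω, Y ω)) Δ ∧
        halfLogDetRatio (QX - Sig) QW = rdf (μ.map fun ω => (X ω, S ω, Y ω)) Δ ∧
        ∃ (Ω' : Type) (_ : MeasurableSpace Ω') (μ' : Measure Ω') (_ : IsProbabilityMeasure μ')
          (X' : Ω' → Vec nx) (S' : Ω' → Vec ns) (Y' : Ω' → Vec ny) (W' : Ω' → Vec nx),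
          Measurable X' ∧ Measurable S' ∧ Measurable Y' ∧
          (μ'.map fun ω => (X' ω, S' ω, Y' ω)) = (μ.map fun ω => (X ω, S ω, Y ω)) ∧
          IsCenteredGaussian μ' W' QW ∧
          IndepFun W' (fun ω => (X' ω, S' ω, Y' ω)) μ' ∧
          IsAdmissible μ' X' S' Y' (realization μ' X' S' Y' H W') Δ ∧
          condMutualInfo μ' S' (realization μ' X' S' Y' H W') Y' =
            rdf (μ.map fun ω => (X ω, S ω, Y ω)) Δ) := by
  subst hQX hQXS hQS
  have hsrc : IsGaussianSource μ X S Y := ⟨hX, hS, hY, hG, hX0, hS0, hY0, hQY⟩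
  obtain ⟨r1, r2, r3⟩ := hsrc.condCov_eq_covMat_resid
  have x2 := memLp_resid hG.fst.memLp_two hG.snd.snd.memLp_two
  have s2 := memLp_resid hG.snd.fst.memLp_two hG.snd.snd.memLp_two
  have hQXpsd : (condCov μ X X Y).PosSemidef := r1 ▸ covMat_self_posSemidef x2
  have hQSpsd : (condCov μ S S Y).PosSemidef := r3 ▸ covMat_self_posSemidef s2
  have hinf : rdf (μ.map fun ω => (X ω, S ω, Y ω)) Δ =
      ⨅ (Sig : Matrix (Fin nx) (Fin nx) ℝ) (H : Matrix (Fin nx) (Fin ns) ℝ)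
        (QW : Matrix (Fin nx) (Fin nx) ℝ)
        (_ : IsFeasible (condCov μ X X Y) (condCov μ X S Y) (condCov μ S S Y) Sig H QW)
        (_ : Sig.trace ≤ Δ), halfLogDetRatio (condCov μ X X Y - Sig) QW := by
    refine le_antisymm ?_ ?_
    · exact le_iInf fun Sig => le_iInf fun H => le_iInf fun QW => le_iInf fun hf =>
        le_iInf fun hΔ => (hsrc.rdf_le_halfLogDetRatio hf hΔ).1
    · refine le_iInf₂ fun ν hν => ?_
      obtain ⟨Sig, H, QW, hf, hΔ, hle⟩ := hsrc.exists_feasible_of_mem_admissibleLaws hν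
      rw [(hsrc.rdf_le_halfLogDetRatio hf hΔ).2.1] at hle
      exact iInf_le_of_le Sig (iInf_le_of_le H (iInf_le_of_le QW (iInf_le_of_le hf
        (iInf_le_of_le hΔ hle))))
  refine ⟨⟨hQXpsd, hQSpsd, hsrc.condCov_eq.2.1⟩, ?_, ?_, ?_, ?_, ?_⟩
  · rintro Sig H QW hf W hW hind Xhat rfl
    have hR := isRealization_realization hsrc hf hW hind
    exact ⟨hR.eq_cexp, hR.error_cov, hR.drops_side, hR.drops_source, hR.drops_reproduction,
      hR.cexp_pair, hR.cexp_self, hR.cexp_side, hR.postCov, hR.reproduction_cov,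
      hR.reproduction_cov_eq_sub, hR.isAdmissible, hR.rate_source, hR.rate_reproduction⟩
  · rw [hinf]
    refine iInf_congr fun Sig => iInf_congr fun H => iInf_congr fun QW => iInf_congr fun hf =>
      iInf_congr fun hΔ => ?_
    obtain ⟨-, he, hpsd⟩ := hsrc.rdf_le_halfLogDetRatio hf hΔ
    -- The ordering constraints on the covariances hold for all feasible parameters, so they do not
    -- restrict the infimum.
    rw [iInf_pos hpsd, he]
  · rw [hinf]
    refine iInf_congr fun Sig => iInf_congr fun H => iInf_congr fun QW => iInf_congr fun hf =>
      iInf_congr fun hΔ => ?_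
    rw [iInf_pos (hf.sub_sub_posSemidef hQSpsd)]
  · exact fun Xhat h => h.rdf_le hX hS hY
  · rintro ⟨ν, hν⟩
    obtain ⟨Sig₀, H₀, QW₀, hf₀, hΔ₀, -⟩ := hsrc.exists_feasible_of_mem_admissibleLaws hν
    -- The range condition on `QXS` is the normal equation for the residuals. The converse turns an
    -- admissible law into feasible parameters, so the set to minimize over is nonempty.
    obtain ⟨Sig, H, QW, hf, hΔ, hmin⟩ := exists_feasible_minimizer hQSpsd (by
      have := covMat_mul_pinv_mul x2 s2
      rwa [← r2, ← r3] at this) ⟨Sig₀, H₀, QW₀, hf₀, hΔ₀⟩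
    obtain ⟨hle, he, -⟩ := hsrc.rdf_le_halfLogDetRatio hf hΔ
    have hrate : halfLogDetRatio (condCov μ X X Y - Sig) QW
        = rdf (μ.map fun ω => (X ω, S ω, Y ω)) Δ := by
      refine le_antisymm ?_ hle
      rw [hinf]
      exact le_iInf fun Sig' => le_iInf fun H' => le_iInf fun QW' => le_iInf fun hf' =>
        le_iInf fun hΔ' => hmin Sig' H' QW' hf' hΔ'
    obtain ⟨Ω', mΩ', μ', hμ', X', S', Y', W', h1, h2, h3, hlaw, hW, hind, c1, -, hR⟩ :=
      hsrc.exists_isRealization hf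
    refine ⟨Sig, H, QW, hf, hΔ, he.trans hrate, hrate, Ω', mΩ', μ', hμ', X', S', Y', W', h1, h2,
      h3, hlaw, hW, hind, hR.isAdmissible hΔ, ?_⟩
    rw [hR.rate_reproduction, c1, hrate]
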